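/- Let $X$ be a countable set and $m\colon X\to(0,\infty)$, viewed as a measure on $X$; write $\ell^2(X,m)$ for the real Hilbert space of $m$-square-summable functions and $C_c(X)$ for the finitely supported functions. **Forms.** A form $Q$ on a real Hilbert space is a symmetric, positive bilinear map on a subspace $D(Q)$; $Q(f):=Q(f,f)$ for $f\in D(Q)$ and $Q(f):=\infty$ otherwise; $Q\le Q'$ means $Q(f)\le Q'(f)$ for all $f$; $Q_1(f):=Q(f)+\|f\|^2$. $Q$ is closed if $D(Q)$ is complete with respect to $Q_1^{1/2}$. A form on an $L^2$-space is Markovian if $Q(C\circ f)\le Q(f)$ for all $f$ and all normal contractions $C\colon\mathbb R\to\mathbb R$ (i.e. $C(0)=0$ and $C$ is $1$-Lipschitz). A Dirichlet form in the wide sense is a closed Markovian form; it is a Dirichlet form if it is also densely defined. Let $\mathfrak D$ be the set of Dirichlet forms $Q$ on $\ell^2(X,m)$ with $C_c(X)\subset D(Q)$. **Graphs.** A graph $(b,0)$ over $X$ is a symmetric function $b\colon X\times X\to[0,\infty)$ with zero diagonal and $\sum_y b(x,y)<\infty$ for all $x$. Let $Q^{(N)}_{b,0}$ be the form with $Q^{(N)}_{b,0}(f)=\frac12\sum_{x,y}b(x,y)(f(x)-f(y))^2$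 on all $f\in\ell^2(X,m)$ for which this is finite, and $Q^{(D)}_{b,0}$ its restriction to the closure of $C_c(X)$ with respect to $(Q^{(N)}_{b,0})_1^{1/2}$. A function $u$ is $1$-harmonic if $\sum_y b(x,y)|u(y)|<\infty$ and $\frac1{m(x)}\sum_y b(x,y)(u(x)-u(y))+u(x)=0$ for all $x$. **Boundary.** Fix a graph $(b,0)$. Let $\hat X$ be the (unique) compact Hausdorff space containing $X$ as a dense subset with open points, to which all functions in $D(Q^{(N)})\cap\ell^\infty(X)$ extend continuously, these extensions separating points. The $1$-harmonic boundary $\partial X$ is the set of points of $\hat X\setminus X$ at which the extensions of all $f\in D(Q^{(D)})\cap\ell^\infty(X)$ vanish. Every $f\in D(Q^{(N)})$ extends uniquely to a continuous function $\hat X\to[-\infty,\infty]$; its restriction to $\partial X$ is denoted by $\gamma f$. For $x\in X$ let $\mu_x$ be the $1$-harmonic measure of $x$: the unique Radon measure on $\partial X$ with $\mu_x(\partial X)\le1$ such that $\int\gamma f\,d\mu_x=u(x)$ for every $f\in D(Q^{(N)})\cap\ell^\infty(X)$, where $u\in D(Q^{(N)})$ is the $1$-harmonic function with $\gamma u=\gamma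 f$, and such that $\mu_x(\{\infty\})=0$ if there is a point $\infty\in\partial X$ at which $\gamma f$ vanishes for all $f\in D(Q^{(N)})\cap\ell^\infty(X)$. For each graph fix a reference measure $\mu=\sum_x w(x)\mu_x$ on $\partial X$, where $w\colon X\to[0,\infty)$ satisfies $\sum_x w(x)<\infty$ and $\sum_x w(x)/m(x)<\infty$ and does not vanish identically on any connected component of the graph (if the graph is connected, $\mu=\mu_o$ with any vertex $o$ is allowed). Put $L^2(\partial X)=L^2(\partial X,\mu)$. **Traces.** For a Dirichlet form $Q$ with $Q^{(N)}_{b,0}\le Q\le Q^{(D)}_{b,0}$, the trace form $\mathrm{Tr}\,Q$ on $L^2(\partial X)$ has domain $\gamma D(Q)$ and is given by $\mathrm{Tr}\,Q(\varphi)=Q_1(H\varphi)$, where $H\varphi\in D(Q^{(N)}_{b,0})$ is the $1$-harmonic function with $\gamma H\varphi=\varphi$ $\mu$-a.e. Let $q^{DN}_{b,0}=\mathrm{Tr}\,Q^{(N)}_{b,0}$, and let $\mathrm{Tr}\,\mathfrak D(b,0)$ be the set of all Dirichlet forms in the wide sense $q$ on $L^2(\partial X)$ with $q\ge q^{DN}_{b,0}$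 such that $q-q^{DN}_{b,0}$, with domain $D(q)$, is Markovian. **Statement.** For $Q\in\mathfrak D$ the following are equivalent: (i) there is a graph $(b_Q,0)$ such that $Q$ is an extension of $Q^{(D)}_{b_Q,0}$; (ii) there are a graph $(b_Q,0)$ with $D(Q)\subset D(Q^{(N)}_{b_Q,0})$ and a form $q\in\mathrm{Tr}\,\mathfrak D(b_Q,0)$ such that for all $f\in D(Q)$ one has $\gamma f\in D(q)$ and $$Q(f)=Q^{(N)}_{b_Q,0}(f)+q(\gamma f)-q^{DN}_{b_Q,0}(\gamma f).$$ More precisely, a graph satisfies the condition in (i) if and only if it satisfies the condition in (ii), there is at most one such graph, and in (ii) one can choose $q=\mathrm{Tr}\,Q$ (which belongs to $\mathrm{Tr}\,\mathfrak D(b_Q,0)$). If $\mathfrak D_0$ denotes the set of all $Q\in\mathfrak D$ satisfying (i) and (ii), then the map $$\mathfrak D_0\to\bigsqcup_{(b,0)\text{ graph}}\mathrm{Tr}\,\mathfrak D(b,0),\qquad Q\mapsto((b_Q,0),\mathrm{Tr}\,Q)$$ is a bijection. -/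

import Mathlib

open Set Filter Topology MeasureTheory
open scoped NNReal ENNReal

noncomputable section

namespace GraphForm

/-! ### Symmetric positive forms -/

/-- A symmetric positive form on a real vector space: a subspace `dom` (the domain) together with
a symmetric positive bilinear map on it. -/
structure Form (E : Type*) [AddCommGroup E] [Module ℝ E] where
  dom : Submodule ℝ E
  bilin : LinearMap.BilinForm ℝ dom
  symm : ∀ f g, bilin f g = bilin g f
  nonneg : ∀ f, 0 ≤ bilin f f

/-- The quadratic form `Q(f) = Q(f,f)` for `f ∈ D(Q)` and `Q(f) = ∞` otherwise. -/
def Form.val {E : Type*} [AddCommGroup E] [Module ℝ E] (Q : Form E) (f : E) : ℝ≥0∞ :=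
  open Classical in
  if h : f ∈ Q.dom then ENNReal.ofReal (Q.bilin ⟨f, h⟩ ⟨f, h⟩) else ⊤

/-- `Q` is an extension of `Q'`. -/
def Form.Extends {E : Type*} [AddCommGroup E] [Module ℝ E] (Q Q' : Form E) : Prop :=
  ∃ h : Q'.dom ≤ Q.dom, ∀ f g : Q'.dom,
    Q.bilin (Submodule.inclusion h f) (Submodule.inclusion h g) = Q'.bilin f g

/-- The restriction of a form to a smaller domain. -/
def Form.restrict {E : Type*} [AddCommGroup E] [Module ℝ E] (Q : Form E) (S : Submodule ℝ E)
    (h : S ≤ Q.dom) : Form E where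
  dom := S
  bilin := Q.bilin.compl₁₂ (Submodule.inclusion h) (Submodule.inclusion h)
  symm _ _ := Q.symm _ _
  nonneg _ := Q.nonneg _

section Normed

variable {E : Type*} [NormedAddCommGroup E] [NormedSpace ℝ E]

/-- `Q₁(f) = Q(f) + ‖f‖²`, the square of the form norm. -/
def Form.val₁ (Q : Form E) (f : E) : ℝ≥0∞ := Q.val f + ENNReal.ofReal (‖f‖ ^ 2)

/-- The form is closed: its domain is complete with respect to the form norm. -/
def Form.IsClosed (Q : Form E) : Prop :=
  ∀ u : ℕ → E, (∀ n, u n ∈ Q.dom) →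
    (∀ ε : ℝ≥0∞, 0 < ε → ∃ N, ∀ n ≥ N, ∀ k ≥ N, Q.val₁ (u n - u k) < ε) →
    ∃ f ∈ Q.dom, Tendsto (fun n => Q.val₁ (u n - f)) atTop (𝓝 0)

lemma Form.val_add_le (Q : Form E) (f g : E) : Q.val (f + g) ≤ 2 * Q.val f + 2 * Q.val g := by
  by_cases hf : f ∈ Q.dom
  · by_cases hg : g ∈ Q.dom
    · have hfg := Q.dom.add_mem hf hg
      rw [Form.val, Form.val, Form.val, dif_pos hf, dif_pos hg, dif_pos hfg]
      have h2 : (2 : ℝ≥0∞) = ENNReal.ofReal 2 := by simp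
      rw [h2, ← ENNReal.ofReal_mul (by norm_num), ← ENNReal.ofReal_mul (by norm_num),
        ← ENNReal.ofReal_add (mul_nonneg (by norm_num) (Q.nonneg _))
          (mul_nonneg (by norm_num) (Q.nonneg _))]
      apply ENNReal.ofReal_le_ofReal
      have h := Q.nonneg (⟨f, hf⟩ - ⟨g, hg⟩)
      have e : (⟨f + g, hfg⟩ : Q.dom) = ⟨f, hf⟩ + ⟨g, hg⟩ := rfl
      rw [e]
      simp only [map_add, map_sub, LinearMap.add_apply, LinearMap.sub_apply] at h ⊢
      linarith
    · simp [Form.val, hg]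
  · simp [Form.val, hf]

lemma Form.val_smul_le (Q : Form E) (a : ℝ) (f : E) (hf : f ∈ Q.dom) :
    Q.val (a • f) ≤ ENNReal.ofReal (a ^ 2) * Q.val f := by
  have haf := Q.dom.smul_mem a hf
  rw [Form.val, Form.val, dif_pos hf, dif_pos haf, ← ENNReal.ofReal_mul (sq_nonneg a)]
  apply ENNReal.ofReal_le_ofReal
  have e : (⟨a • f, haf⟩ : Q.dom) = a • ⟨f, hf⟩ := rfl
  rw [e]
  simp only [map_smul, LinearMap.smul_apply, smul_eq_mul]
  apply le_of_eq
  ring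

lemma Form.val₁_add_le (Q : Form E) (f g : E) :
    Q.val₁ (f + g) ≤ 2 * Q.val₁ f + 2 * Q.val₁ g := by
  have h1 := Q.val_add_le f g
  have h2 : ENNReal.ofReal (‖f + g‖ ^ 2) ≤
      2 * ENNReal.ofReal (‖f‖ ^ 2) + 2 * ENNReal.ofReal (‖g‖ ^ 2) := by
    have h2 : (2 : ℝ≥0∞) = ENNReal.ofReal 2 := by simp
    rw [h2, ← ENNReal.ofReal_mul (by norm_num), ← ENNReal.ofReal_mul (by norm_num),
        ← ENNReal.ofReal_add (by positivity) (by positivity)]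
    apply ENNReal.ofReal_le_ofReal
    have h3 : ‖f + g‖ ^ 2 ≤ (‖f‖ + ‖g‖) ^ 2 := by gcongr; exact norm_add_le f g
    nlinarith [sq_nonneg (‖f‖ - ‖g‖)]
  calc Q.val₁ (f + g) ≤ (2 * Q.val f + 2 * Q.val g) +
        (2 * ENNReal.ofReal (‖f‖ ^ 2) + 2 * ENNReal.ofReal (‖g‖ ^ 2)) := add_le_add h1 h2
    _ = _ := by simp only [Form.val₁]; ring

lemma Form.val₁_smul_le (Q : Form E) (a : ℝ) (f : E) (hf : f ∈ Q.dom) :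
    Q.val₁ (a • f) ≤ ENNReal.ofReal (a ^ 2) * Q.val₁ f := by
  have h1 := Q.val_smul_le a f hf
  have h2 : ENNReal.ofReal (‖a • f‖ ^ 2) = ENNReal.ofReal (a ^ 2) * ENNReal.ofReal (‖f‖ ^ 2) := by
    rw [← ENNReal.ofReal_mul (sq_nonneg a), norm_smul, mul_pow, Real.norm_eq_abs, sq_abs]
  rw [Form.val₁, Form.val₁, mul_add, h2]
  gcongr

/-- The elements of `D(Q)` that lie in the form norm closure of `S ∩ D(Q)`. -/
def Form.formClosure (Q : Form E) (S : Submodule ℝ E) : Submodule ℝ E where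
  carrier := {f | f ∈ Q.dom ∧ ∀ ε : ℝ≥0∞, 0 < ε → ∃ g ∈ S, g ∈ Q.dom ∧ Q.val₁ (f - g) < ε}
  add_mem' := by
    rintro f g ⟨hf, hf'⟩ ⟨hg, hg'⟩
    refine ⟨Q.dom.add_mem hf hg, fun ε hε => ?_⟩
    have hε4 : 0 < ε / 4 := ENNReal.div_pos hε.ne' (by simp)
    obtain ⟨u, huS, hu, hu'⟩ := hf' _ hε4
    obtain ⟨v, hvS, hv, hv'⟩ := hg' _ hε4
    refine ⟨u + v, S.add_mem huS hvS, Q.dom.add_mem hu hv, ?_⟩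
    have e : f + g - (u + v) = (f - u) + (g - v) := by abel
    rw [e]
    refine (Q.val₁_add_le _ _).trans_lt ?_
    calc 2 * Q.val₁ (f - u) + 2 * Q.val₁ (g - v) < 2 * (ε / 4) + 2 * (ε / 4) := by
          apply ENNReal.add_lt_add
          · exact (ENNReal.mul_lt_mul_iff_right (by simp) (by simp)).2 hu'
          · exact (ENNReal.mul_lt_mul_iff_right (by simp) (by simp)).2 hv'
      _ = ε := by
          rw [← add_mul]
          norm_num
          exact ENNReal.mul_div_cancel (by simp) (by simp)
  zero_mem' := ⟨Q.dom.zero_mem, fun ε hε => ⟨0, S.zero_mem, Q.dom.zero_mem, by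
    have h := Q.val_smul_le 0 0 Q.dom.zero_mem
    simp only [smul_zero, ne_eq, OfNat.ofNat_ne_zero, not_false_eq_true, zero_pow,
      ENNReal.ofReal_zero, zero_mul, nonpos_iff_eq_zero] at h
    simpa [Form.val₁, h] using hε⟩⟩
  smul_mem' := by
    rintro a f ⟨hf, hf'⟩
    refine ⟨Q.dom.smul_mem a hf, fun ε hε => ?_⟩
    have hA : 0 < ENNReal.ofReal (a ^ 2) + 1 := by positivity
    have hA' : ENNReal.ofReal (a ^ 2) + 1 ≠ ⊤ := by simp
    obtain ⟨u, huS, hu, hu'⟩ := hf' (ε / (ENNReal.ofReal (a ^ 2) + 1))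
      (ENNReal.div_pos hε.ne' hA')
    refine ⟨a • u, S.smul_mem a huS, Q.dom.smul_mem a hu, ?_⟩
    rw [← smul_sub]
    refine (Q.val₁_smul_le a _ (Q.dom.sub_mem hf hu)).trans_lt ?_
    calc ENNReal.ofReal (a ^ 2) * Q.val₁ (f - u)
        ≤ (ENNReal.ofReal (a ^ 2) + 1) * Q.val₁ (f - u) := by gcongr; exact le_self_add
      _ < (ENNReal.ofReal (a ^ 2) + 1) * (ε / (ENNReal.ofReal (a ^ 2) + 1)) :=
          (ENNReal.mul_lt_mul_iff_right hA.ne' hA').2 hu'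
      _ = ε := ENNReal.mul_div_cancel hA.ne' hA'

end Normed

/-! ### Dirichlet forms on `L²`-spaces -/

section Dirichlet

variable {α : Type*} [MeasurableSpace α] {μ : Measure α}

/-- A form on an `L²`-space is Markovian if `Q(C ∘ f) ≤ Q(f)` for all `f` and all normal
contractions `C`. -/
def Form.IsMarkovian (Q : Form (Lp ℝ 2 μ)) : Prop :=
  ∀ (C : ℝ → ℝ) (hC : LipschitzWith 1 C) (h0 : C 0 = 0) (f : Lp ℝ 2 μ),
    Q.val (hC.compLp h0 f) ≤ Q.val f

/-- Dirichlet forms in the wide sense: closed Markovian forms. -/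
def Form.IsWideDirichlet (Q : Form (Lp ℝ 2 μ)) : Prop := Q.IsClosed ∧ Q.IsMarkovian

/-- Dirichlet forms: densely defined closed Markovian forms. -/
def Form.IsDirichlet (Q : Form (Lp ℝ 2 μ)) : Prop :=
  Dense (Q.dom : Set (Lp ℝ 2 μ)) ∧ Q.IsClosed ∧ Q.IsMarkovian

end Dirichlet

/-! ### Graphs over a discrete measure space -/

/-- The graphs `(b,0)` over `X` (no killing), given by their edge weight `b`. -/
structure WGraph (X : Type*) where
  b : X → X → ℝ
  nonneg : ∀ x y, 0 ≤ b x y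
  symm : ∀ x y, b x y = b y x
  diag : ∀ x, b x x = 0
  summable : ∀ x, Summable (b x)

/-- Two vertices are connected if there is a finite path between them. -/
def WGraph.Connected {X : Type*} (G : WGraph X) (x y : X) : Prop :=
  Relation.ReflTransGen (fun u v => 0 < G.b u v) x y

/-- The summand of the energy form at a pair of vertices. -/
def energyTerm {X : Type*} (G : WGraph X) (f g : X → ℝ) (p : X × X) : ℝ :=
  G.b p.1 p.2 * ((f p.1 - f p.2) * (g p.1 - g p.2))

lemma summable_energyTerm {X : Type*} (G : WGraph X) {f g : X → ℝ} (hf : Summable (energyTerm G f f))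
    (hg : Summable (energyTerm G g g)) : Summable (energyTerm G f g) := by
  refine Summable.of_norm_bounded (hf.add hg) fun p => ?_
  rw [Real.norm_eq_abs, energyTerm, abs_mul, abs_of_nonneg (G.nonneg _ _)]
  simp only [energyTerm]
  rw [← mul_add]
  refine mul_le_mul_of_nonneg_left ?_ (G.nonneg _ _)
  rw [abs_le]
  constructor <;> nlinarith [sq_nonneg ((f p.1 - f p.2) + (g p.1 - g p.2)),
    sq_nonneg ((f p.1 - f p.2) - (g p.1 - g p.2)), sq_nonneg (f p.1 - f p.2),
    sq_nonneg (g p.1 - g p.2)]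

section Discrete

variable {X : Type*} [MeasurableSpace X]

/-- The measure on `X` with point masses `m x ∈ (0,∞)`. -/
def vertexMeasure (m : X → Ioi (0 : ℝ)) : Measure X :=
  Measure.sum fun x => ENNReal.ofReal (m x : ℝ) • Measure.dirac x

/-- The Hilbert space `ℓ²(X,m)`. -/
abbrev ell2 (m : X → Ioi (0 : ℝ)) : Type _ := Lp ℝ 2 (vertexMeasure m)

variable [DiscreteMeasurableSpace X]

lemma eq_of_ae_eq (m : X → Ioi (0 : ℝ)) {f g : X → ℝ} (h : f =ᵐ[vertexMeasure m] g) : f = g := by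
  funext x
  have h' : ∀ᵐ y ∂(ENNReal.ofReal (m x : ℝ) • Measure.dirac x), f y = g y :=
    h.filter_mono (ae_mono (Measure.le_sum _ x))
  have hm : ENNReal.ofReal (m x : ℝ) ≠ 0 := by
    have h0 : (0 : ℝ) < m x := (m x).2
    rw [Ne, ENNReal.ofReal_eq_zero, not_le]
    exact h0
  rw [Measure.ae_ennreal_smul_measure_iff hm, ae_dirac_eq] at h'
  exact h'

lemma ell2_add_apply {m : X → Ioi (0 : ℝ)} (f g : ell2 m) (x : X) : (f + g) x = f x + g x :=
  congrFun (eq_of_ae_eq m (Lp.coeFn_add f g)) x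

lemma ell2_smul_apply {m : X → Ioi (0 : ℝ)} (a : ℝ) (f : ell2 m) (x : X) : (a • f) x = a * f x :=
  congrFun (eq_of_ae_eq m (Lp.coeFn_smul a f)) x

lemma ell2_zero_apply {m : X → Ioi (0 : ℝ)} (x : X) : (0 : ell2 m) x = 0 :=
  congrFun (eq_of_ae_eq m (Lp.coeFn_zero ℝ 2 (vertexMeasure m))) x

/-- `C_c(X)`: the finitely supported functions, as a subspace of `ℓ²(X,m)`. -/
def finSupp (m : X → Ioi (0 : ℝ)) : Submodule ℝ (ell2 m) where
  carrier := {f | (Function.support (f : X → ℝ)).Finite}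
  add_mem' := by
    intro f g hf hg
    refine (hf.union hg).subset fun x hx => ?_
    by_contra hc
    simp only [mem_union, Function.mem_support, not_or, not_not] at hc
    exact hx (by rw [ell2_add_apply, hc.1, hc.2, add_zero])
  zero_mem' := by
    refine Set.finite_empty.subset fun x hx => hx (ell2_zero_apply x)
  smul_mem' := by
    intro a f hf
    refine hf.subset fun x hx hfx => hx ?_
    rw [ell2_smul_apply, hfx, mul_zero]

/-- `𝔇`: the Dirichlet forms on `ℓ²(X,m)` whose domain contains `C_c(X)`. -/
def discreteForms (m : X → Ioi (0 : ℝ)) : Set (Form (ell2 m)) :=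
  {Q | Q.IsDirichlet ∧ finSupp m ≤ Q.dom}

variable (m : X → Ioi (0 : ℝ)) (G : WGraph X)

/-- `D(Q^(N))`: the functions of finite energy in `ℓ²(X,m)`. -/
def neumannDom : Submodule ℝ (ell2 m) where
  carrier := {f | Summable (energyTerm G f f)}
  add_mem' := by
    intro f g hf hg
    have hfg := summable_energyTerm G hf hg
    refine ((hf.add hg).add (hfg.mul_left 2)).congr fun p => ?_
    simp only [energyTerm, ell2_add_apply]
    ring
  zero_mem' := by
    refine summable_zero.congr fun p => ?_
    simp only [energyTerm]
    rw [ell2_zero_apply, ell2_zero_apply]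
    ring
  smul_mem' := by
    intro a f hf
    refine (Summable.mul_left (a ^ 2) hf).congr fun p => ?_
    simp only [energyTerm, ell2_smul_apply]
    ring

/-- The Neumann form `Q^(N)`: the restriction of the energy form
`(f,g) ↦ 1/2 ∑ b(x,y)(f(x)-f(y))(g(x)-g(y))` to the functions of finite energy in `ℓ²(X,m)`. -/
def neumannForm : Form (ell2 m) where
  dom := neumannDom m G
  bilin := LinearMap.mk₂ ℝ (fun f g => (1 / 2) * ∑' p, energyTerm G (f : ell2 m) (g : ell2 m) p)
    (by
      intro f f' g
      rw [← mul_add, ← (summable_energyTerm G f.2 g.2).tsum_add (summable_energyTerm G f'.2 g.2)]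
      congr 2; funext p
      simp only [energyTerm, Submodule.coe_add, ell2_add_apply]; ring)
    (by
      intro a f g
      rw [smul_eq_mul, mul_left_comm a, ← tsum_mul_left (a := a)]
      congr 2; funext p
      simp only [energyTerm, Submodule.coe_smul, ell2_smul_apply]; ring)
    (by
      intro f g g'
      rw [← mul_add, ← (summable_energyTerm G f.2 g.2).tsum_add (summable_energyTerm G f.2 g'.2)]
      congr 2; funext p
      simp only [energyTerm, Submodule.coe_add, ell2_add_apply]; ring)
    (by
      intro a f g
      rw [smul_eq_mul, mul_left_comm a, ← tsum_mul_left (a := a)]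
      congr 2; funext p
      simp only [energyTerm, Submodule.coe_smul, ell2_smul_apply]; ring)
  symm f g := by
    simp only [LinearMap.mk₂_apply]
    congr 2; funext p
    simp only [energyTerm]; ring
  nonneg f := by
    simp only [LinearMap.mk₂_apply]
    refine mul_nonneg (by norm_num) (tsum_nonneg fun p => ?_)
    exact mul_nonneg (G.nonneg _ _) (mul_self_nonneg _)

/-- The form `Q^(D)`: the restriction of `Q^(N)` to the form norm closure of `C_c(X)`. -/
def dirichletForm : Form (ell2 m) :=
  (neumannForm m G).restrict ((neumannForm m G).formClosure (finSupp m)) fun _ h => h.1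

/-- `u` is `1`-harmonic: `u` belongs to the domain of the formal Laplacian `𝓛` and
`𝓛 u + u = 0`. -/
def IsHarmonic (u : X → ℝ) : Prop :=
  (∀ x, Summable fun y => G.b x y * |u y|) ∧
    ∀ x, (1 / (m x : ℝ)) * ∑' y, G.b x y * (u x - u y) + u x = 0

/-! ### The compactification, the harmonic boundary and the trace -/

/-- `D(Q^(N)) ∩ ℓ^∞(X)`. -/
def BddDom : Type _ :=
  {f : ell2 m // f ∈ (neumannForm m G).dom ∧ ∃ K : ℝ, ∀ x, |f x| ≤ K}

/-- The Royden compactification `X̂`: the closure of the image of `X` under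
`x ↦ (f(x))_f`, `f ∈ D(Q^(N)) ∩ ℓ^∞(X)`, in the product of copies of `ℝ`. -/
def Royden : Type _ :=
  closure (range fun (x : X) (f : BddDom m G) => (f.1 x : ℝ))

instance : TopologicalSpace (Royden m G) :=
  inferInstanceAs (TopologicalSpace (closure (range fun (x : X) (f : BddDom m G) => (f.1 x : ℝ))))

/-- The embedding of `X` into `X̂`. -/
def Royden.embed (x : X) : Royden m G :=
  ⟨fun f => f.1 x, subset_closure ⟨x, rfl⟩⟩

variable {m G} in
/-- The continuous extension to `X̂` of a function in `D(Q^(N)) ∩ ℓ^∞(X)`. -/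
def Royden.extend (f : BddDom m G) (ξ : Royden m G) : ℝ := ξ.1 f

/-- The `1`-harmonic boundary `∂X`. -/
def Boundary : Type _ :=
  {ξ : Royden m G // ξ ∉ range (Royden.embed m G) ∧
    ∀ f : BddDom m G, f.1 ∈ (dirichletForm m G).dom → Royden.extend f ξ = 0}

instance : TopologicalSpace (Boundary m G) :=
  inferInstanceAs (TopologicalSpace (Subtype _))

instance : MeasurableSpace (Boundary m G) := borel _

instance : BorelSpace (Boundary m G) := ⟨rfl⟩

variable {m} in
/-- The trace `γ f` of `f ∈ D(Q^(N))`: the restriction to `∂X` of the continuous extension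
`X̂ → [-∞,∞]` of `f`. -/
def trace (f : ell2 m) (ξ : Boundary m G) : EReal :=
  limUnder (comap (Royden.embed m G) (𝓝 ξ.1)) fun x => ((f x : ℝ) : EReal)

/-! ### Harmonic measures -/

/-- `μ` is a `1`-harmonic measure of the vertex `x`: a Radon measure on `∂X` of mass at most `1`
with `u(x) = ∫ φ dμ` whenever `φ` is the trace of a bounded function in `D(Q^(N))` and
`u ∈ D(Q^(N))` is its `1`-harmonic extension. The last condition is the normalization
`μ({∞}) = 0`; a point `∞` at which all functions in `D(Q^(N)) ∩ ℓ^∞(X)` vanish exists only if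
`1 ∉ D(Q^(N))`, and it is then unique. -/
def IsHarmonicMeasure (x : X) (μ : Measure (Boundary m G)) : Prop :=
  μ.Regular ∧ μ univ ≤ 1 ∧
  (∀ (f : BddDom m G) (u : ell2 m), u ∈ (neumannForm m G).dom → IsHarmonic m G u →
    trace G u = trace G f.1 → ∫ ξ, Royden.extend f ξ.1 ∂μ = u x) ∧
  ∀ ξ : Boundary m G, (∀ f : BddDom m G, Royden.extend f ξ.1 = 0) → μ {ξ} = 0

/-- The `1`-harmonic measure `μ_x`. -/
def harmonicMeasure (x : X) : Measure (Boundary m G) :=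
  open Classical in
  if h : ∃ μ, IsHarmonicMeasure m G x μ then h.choose else 0

/-- Weights for the reference measure `∑ w(x) μ_x` on `∂X`: they are summable, also after
division by `m`, and do not vanish identically on any connected component of the graph. If the
graph is connected, then the indicator function of any single vertex is admissible. -/
structure IsAdmissible (w : X → ℝ≥0) : Prop where
  summable : Summable w
  summable_div : Summable fun x => (w x : ℝ) / (m x : ℝ)
  meets : ∀ x, ∃ y, G.Connected x y ∧ 0 < w y

variable (w : X → ℝ≥0)

/-- The reference measure `μ = ∑ w(x) μ_x` on `∂X`. -/
def refMeasure : Measure (Boundary m G) :=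
  Measure.sum fun x => (w x : ℝ≥0∞) • harmonicMeasure m G x

/-- The space `L²(∂X)`. -/
abbrev BoundaryL2 : Type _ := Lp ℝ 2 (refMeasure m G w)

variable {m}

/-- `φ ∈ L²(∂X)` is the class of the trace of `f`. -/
def IsTrace (f : ell2 m) (φ : BoundaryL2 m G w) : Prop :=
  ∀ᵐ ξ ∂(refMeasure m G w), ((φ ξ : ℝ) : EReal) = trace G f ξ

/-- The `1`-harmonic extension `H φ` of `φ`. -/
def harmonicExt (φ : BoundaryL2 m G w) : ell2 m :=
  open Classical in
  if h : ∃ u : ell2 m, u ∈ (neumannForm m G).dom ∧ IsHarmonic m G u ∧ IsTrace G w u φ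
  then h.choose else 0

/-- The trace form `Tr Q`, as an `[0,∞]`-valued quadratic form on `L²(∂X)`: its domain is
`γ D(Q)`, and there `Tr Q (φ) = Q₁(H φ)`. -/
def traceForm (Q : Form (ell2 m)) (φ : BoundaryL2 m G w) : ℝ≥0∞ :=
  open Classical in
  if ∃ f ∈ Q.dom, IsTrace G w f φ then Q.val₁ (harmonicExt G w φ) else ⊤

variable (m)

/-- The Dirichlet-to-Neumann form `q^{DN} = Tr Q^(N)`. -/
def dnForm (φ : BoundaryL2 m G w) : ℝ≥0∞ := traceForm G w (neumannForm m G) φ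

/-- `Tr 𝔇(b,0)`: the Dirichlet forms in the wide sense `q` on `L²(∂X)` with `q ≥ q^{DN}` for which
`q - q^{DN}`, considered on the domain `D(q)`, is Markovian. -/
def traceForms : Set (Form (BoundaryL2 m G w)) :=
  {q | q.IsWideDirichlet ∧ (∀ φ, dnForm m G w φ ≤ q.val φ) ∧
    ∀ (C : ℝ → ℝ) (hC : LipschitzWith 1 C) (h0 : C 0 = 0), ∀ φ ∈ q.dom,
      hC.compLp h0 φ ∈ q.dom ∧
      (q.val (hC.compLp h0 φ)).toReal - (dnForm m G w (hC.compLp h0 φ)).toReal ≤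
        (q.val φ).toReal - (dnForm m G w φ).toReal}

variable {m}

/-- `D(Q) ⊆ D(Q^(N))`, and for all `f ∈ D(Q)` one has `γ f ∈ D(q)` and
`Q(f) = Q^(N)(f) + q(γ f) - q^{DN}(γ f)`. -/
def Represents (q : Form (BoundaryL2 m G w)) (Q : Form (ell2 m)) : Prop :=
  Q.dom ≤ (neumannForm m G).dom ∧
  ∀ f ∈ Q.dom, ∃ φ ∈ q.dom, IsTrace G w f φ ∧
    (Q.val f).toReal =
      ((neumannForm m G).val f).toReal + (q.val φ).toReal - (dnForm m G w φ).toReal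

end Discrete

end GraphForm

end

open GraphForm

/-!
With the inner product `Q^(N)_1`, the domain of `Q^(N)` is a Hilbert space in which `D(Q^(D))` is a
closed subspace, whose orthogonal complement consists of the `1`-harmonic functions. By the maximum
principle, evaluating the harmonic part of `f` at `x` is a positive functional of `γ f`; it is
integration against `μ_x`. Testing with truncations bounds `m(x) ∫ (γ f)² dμ_x` by three times the
squared norm of `f`, so `γ` is bounded into `L²(∂X)`. Its kernel is `D(Q^(D))`: if `γ f = 0`
`μ`-almost everywhere, the harmonic part of `|f|` vanishes at a vertex of every connected component,
hence everywhere. So `γ` identifies harmonic functions with their traces.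

If a closed Markovian `Q` extends `Q^(D)`, write `P` for the resolvent of `t Q` at `1`. The form
`t⁻¹ ⟨f - P f, f⟩` tends to `Q(f)` as `t → 0`, and it is half the sum of `t⁻¹ P(x,y) (f(x) - f(y))²`
plus a nonnegative killing term, with `t⁻¹ P(x,y) → b(x,y)`. What remains of it after subtracting
the terms of finitely many pairs `(x,y)` is still Markovian, so in the limit `Q - Q^(N)` is
nonnegative and Markovian. It vanishes on `D(Q^(D))`, hence depends on `γ f` only and equals
`Tr Q - q^{DN}` there. Conversely, `q ∈ Tr 𝔇(b,0)` is the trace of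
`f ↦ Q^(N)(f) + q(γ f) - q^{DN}(γ f)`.
-/

noncomputable section

namespace GraphForm

/-! ### Forms and their Hilbert spaces -/

section FormVal

variable {E : Type*} [AddCommGroup E] [Module ℝ E]

namespace Form

lemma val_of_mem (Q : Form E) (f : Q.dom) : Q.val f = ENNReal.ofReal (Q.bilin f f) := by
  rw [val, dif_pos f.2]

lemma toReal_val (Q : Form E) (f : Q.dom) : (Q.val f).toReal = Q.bilin f f := by
  rw [Q.val_of_mem, ENNReal.toReal_ofReal (Q.nonneg f)]

lemma val_of_notMem (Q : Form E) {f : E} (h : f ∉ Q.dom) : Q.val f = ⊤ := by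
  rw [val, dif_neg h]

lemma mem_dom_iff (Q : Form E) {f : E} : f ∈ Q.dom ↔ Q.val f ≠ ⊤ :=
  ⟨fun h => Q.val_of_mem ⟨f, h⟩ ▸ ENNReal.ofReal_ne_top, fun h => not_imp_comm.1 Q.val_of_notMem h⟩

lemma val_zero (Q : Form E) : Q.val 0 = 0 := by
  simpa using Q.val_of_mem 0

lemma bilin_eq_polar (Q : Form E) (f g : Q.dom) :
    Q.bilin f g = (Q.bilin (f + g) (f + g) - Q.bilin (f - g) (f - g)) / 4 := by
  simp only [map_add, map_sub, LinearMap.add_apply, LinearMap.sub_apply]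
  rw [Q.symm g f]
  ring

lemma extends_iff {Q Q' : Form E} : Q.Extends Q' ↔ ∀ f ∈ Q'.dom, Q.val f = Q'.val f := by
  refine ⟨fun ⟨hdom, hbilin⟩ f hf => ?_, fun h => ?_⟩
  · rw [Q.val_of_mem ⟨f, hdom hf⟩, Q'.val_of_mem ⟨f, hf⟩, ← hbilin]
    rfl
  · have hdom : Q'.dom ≤ Q.dom := fun f hf => by
      rw [Q.mem_dom_iff, h f hf]
      exact Q'.mem_dom_iff.1 hf
    have hdiag (f : Q'.dom) : Q.bilin (Submodule.inclusion hdom f) (Submodule.inclusion hdom f)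
        = Q'.bilin f f := by
      rw [← Q.toReal_val, ← Q'.toReal_val, ← h f f.2]
      rfl
    exact ⟨hdom, fun f g => by
      rw [Q.bilin_eq_polar, Q'.bilin_eq_polar, ← map_add, ← map_sub, hdiag, hdiag]⟩

lemma val_injective : Function.Injective (val : Form E → E → ℝ≥0∞) := by
  intro Q Q' h
  have hdom : Q.dom = Q'.dom := by
    ext f
    rw [Q.mem_dom_iff, Q'.mem_dom_iff, h]
  obtain ⟨hle, hbilin⟩ := extends_iff.2 fun f (_ : f ∈ Q'.dom) => congrFun h f
  rcases Q with ⟨dom, bilin⟩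
  rcases Q' with ⟨dom', bilin'⟩
  dsimp only at hdom hle hbilin
  subst hdom
  congr
  ext f g
  exact hbilin f g

lemma bilin_eq_zero_of_self (Q : Form E) {g : Q.dom} (hg : Q.bilin g g = 0) (f : Q.dom) :
    Q.bilin f g = 0 := by
  by_contra hne
  set t : ℝ := -(Q.bilin f f + 1) / (2 * Q.bilin f g) with ht
  have hmul : t * Q.bilin f g = -(Q.bilin f f + 1) / 2 := by
    rw [ht]
    field_simp
  have hnonneg := Q.nonneg (f + t • g)
  simp only [map_add, LinearMap.add_apply, map_smul, LinearMap.smul_apply, smul_eq_mul, hg,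
    Q.symm g f] at hnonneg
  linarith

lemma bilin_add_self_of_self (Q : Form E) {g : Q.dom} (hg : Q.bilin g g = 0) (f : Q.dom) :
    Q.bilin (f + g) (f + g) = Q.bilin f f := by
  simp only [map_add, LinearMap.add_apply, hg, Q.symm g f, Q.bilin_eq_zero_of_self hg f, add_zero]

lemma dom_le_of_val_le {Q Q' : Form E} (hle : Q'.val ≤ Q.val) : Q.dom ≤ Q'.dom := fun f hf =>
  Q'.mem_dom_iff.2 (ne_top_of_le_ne_top (Q.mem_dom_iff.1 hf) (hle f))

lemma bilin_inclusion_self_le {Q Q' : Form E} (hle : Q'.val ≤ Q.val) (f : Q.dom) :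
    Q'.bilin (Submodule.inclusion (dom_le_of_val_le hle) f)
      (Submodule.inclusion (dom_le_of_val_le hle) f) ≤ Q.bilin f f := by
  rw [← Q.toReal_val, ← Q'.toReal_val]
  exact ENNReal.toReal_mono (Q.mem_dom_iff.1 f.2) (hle f)

/-- The form `Q - Q'` on the domain of `Q`, for `Q' ≤ Q`. -/
@[reducible] def difference {Q Q' : Form E} (hle : Q'.val ≤ Q.val) : Form E where
  dom := Q.dom
  bilin := Q.bilin - Q'.bilin.compl₁₂ (Submodule.inclusion (dom_le_of_val_le hle))
    (Submodule.inclusion (dom_le_of_val_le hle))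
  symm f g := by
    simp only [LinearMap.sub_apply, LinearMap.compl₁₂_apply]
    rw [Q.symm, Q'.symm]
  nonneg f := by
    simp only [LinearMap.sub_apply, LinearMap.compl₁₂_apply]
    exact sub_nonneg.2 (bilin_inclusion_self_le hle f)

lemma difference_bilin_self {Q Q' : Form E} (hle : Q'.val ≤ Q.val) (f : Q.dom) :
    (difference hle).bilin f f = (Q.val f).toReal - (Q'.val f).toReal := by
  rw [Q.toReal_val, Q'.toReal_val ⟨f, dom_le_of_val_le hle f.2⟩]
  rfl

lemma toReal_val_add_sub_of_val_eq {Q Q' : Form E} (hle : Q'.val ≤ Q.val) {f g : E}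
    (hf : f ∈ Q.dom) (hg : g ∈ Q.dom) (heq : Q.val g = Q'.val g) :
    (Q.val (f + g)).toReal - (Q'.val (f + g)).toReal = (Q.val f).toReal - (Q'.val f).toReal := by
  have hzero : (difference hle).bilin ⟨g, hg⟩ ⟨g, hg⟩ = 0 := by
    rw [difference_bilin_self, heq, sub_self]
  have hadd := (difference hle).bilin_add_self_of_self hzero ⟨f, hf⟩
  rwa [difference_bilin_self, difference_bilin_self] at hadd

/-- The multiple `s Q` of a form. -/
@[reducible] def scale (Q : Form E) (s : ℝ≥0) : Form E where
  dom := Q.dom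
  bilin := (s : ℝ) • Q.bilin
  symm f g := by simp only [LinearMap.smul_apply, Q.symm f g]
  nonneg f := mul_nonneg s.2 (Q.nonneg f)

end Form

end FormVal

section FormSpace

lemma exists_pos_sq_eq {ε : ℝ≥0∞} (hε : 0 < ε) : ∃ δ > 0, δ ^ 2 = ε :=
  ⟨ε ^ (2⁻¹ : ℝ), ENNReal.rpow_pos_of_nonneg hε (by norm_num),
    by exact_mod_cast ENNReal.rpow_inv_rpow (two_ne_zero (α := ℝ)) ε⟩

variable {E : Type*} [NormedAddCommGroup E] [InnerProductSpace ℝ E]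

namespace Form

/-- The domain of a form, equipped with the inner product `Q(f,g) + ⟪f,g⟫`. -/
def Space (Q : Form E) : Type _ := Q.dom

instance (Q : Form E) : AddCommGroup Q.Space := inferInstanceAs (AddCommGroup Q.dom)

instance (Q : Form E) : Module ℝ Q.Space := inferInstanceAs (Module ℝ Q.dom)

/-- The identity, from the domain as a subspace of `E` to the domain with the form norm. -/
def toSpace (Q : Form E) : Q.dom ≃ₗ[ℝ] Q.Space := LinearEquiv.refl ℝ Q.dom

/-- The inner product `Q₁(f,g) = Q(f,g) + ⟪f,g⟫` on the domain of a form. -/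
@[reducible] def core (Q : Form E) : InnerProductSpace.Core ℝ Q.Space where
  inner f g := Q.bilin (Q.toSpace.symm f) (Q.toSpace.symm g) +
    inner ℝ (Q.toSpace.symm f : E) (Q.toSpace.symm g : E)
  conj_inner_symm f g := by
    simp only [conj_trivial]
    rw [Q.symm, real_inner_comm]
  re_inner_nonneg f := add_nonneg (Q.nonneg _) real_inner_self_nonneg
  add_left f g h := by
    simp only [map_add, LinearMap.add_apply, Submodule.coe_add, inner_add_left]
    ring
  smul_left f g r := by
    simp only [map_smul, LinearMap.smul_apply, Submodule.coe_smul, real_inner_smul_left,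
      smul_eq_mul, conj_trivial]
    ring
  definite f h := by
    have hzero : inner ℝ (Q.toSpace.symm f : E) (Q.toSpace.symm f : E) = 0 := by
      linarith [Q.nonneg (Q.toSpace.symm f),
        real_inner_self_nonneg (F := E) (x := Q.toSpace.symm f)]
    exact Q.toSpace.symm.injective (Subtype.ext (inner_self_eq_zero.1 hzero))

instance (Q : Form E) : NormedAddCommGroup Q.Space := Q.core.toNormedAddCommGroup

instance (Q : Form E) : InnerProductSpace ℝ Q.Space := InnerProductSpace.ofCore Q.core.toCore

lemma inner_toSpace (Q : Form E) (f g : Q.dom) :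
    inner ℝ (Q.toSpace f) (Q.toSpace g) = Q.bilin f g + inner ℝ (f : E) (g : E) := rfl

lemma norm_sq_toSpace (Q : Form E) (f : Q.dom) :
    ‖Q.toSpace f‖ ^ 2 = Q.bilin f f + ‖(f : E)‖ ^ 2 := by
  rw [← real_inner_self_eq_norm_sq, Q.inner_toSpace, real_inner_self_eq_norm_sq]

lemma val₁_of_mem (Q : Form E) (f : Q.dom) : Q.val₁ f = ENNReal.ofReal (‖Q.toSpace f‖ ^ 2) := by
  rw [val₁, Q.val_of_mem, Q.norm_sq_toSpace, ENNReal.ofReal_add (Q.nonneg f) (by positivity)]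

lemma val₁_sub_eq_edist_sq (Q : Form E) (f g : Q.dom) :
    Q.val₁ (f - g) = edist (Q.toSpace f) (Q.toSpace g) ^ 2 := by
  rw [edist_dist, dist_eq_norm, ← ENNReal.ofReal_pow (norm_nonneg _), ← map_sub]
  exact Q.val₁_of_mem (f - g)

lemma norm_coe_le_norm_toSpace (Q : Form E) (f : Q.dom) : ‖(f : E)‖ ≤ ‖Q.toSpace f‖ :=
  abs_le_of_sq_le_sq' (by linarith [Q.norm_sq_toSpace f, Q.nonneg f]) (norm_nonneg _) |>.2

/-- The inclusion of the form space in the ambient Hilbert space. -/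
def incl (Q : Form E) : Q.Space →L[ℝ] E :=
  (Q.dom.subtype ∘ₗ Q.toSpace.symm.toLinearMap).mkContinuous 1 fun f =>
    (Q.norm_coe_le_norm_toSpace (Q.toSpace.symm f)).trans_eq (one_mul _).symm

lemma incl_mem (Q : Form E) (f : Q.Space) : Q.incl f ∈ Q.dom := (Q.toSpace.symm f).2

lemma incl_injective (Q : Form E) : Function.Injective Q.incl :=
  Subtype.val_injective.comp Q.toSpace.symm.injective

lemma norm_incl_le (Q : Form E) (f : Q.Space) : ‖Q.incl f‖ ≤ ‖f‖ :=
  Q.norm_coe_le_norm_toSpace (Q.toSpace.symm f)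

lemma forall_val₁_sub_lt_iff_cauchySeq (Q : Form E) (u : ℕ → Q.dom) :
    (∀ ε : ℝ≥0∞, 0 < ε → ∃ N, ∀ n ≥ N, ∀ k ≥ N, Q.val₁ (u n - u k) < ε) ↔
      CauchySeq fun n => Q.toSpace (u n) := by
  simp only [val₁_sub_eq_edist_sq, EMetric.cauchySeq_iff]
  refine ⟨fun h ε hε => ?_, fun h ε hε => ?_⟩
  · obtain ⟨N, hN⟩ := h (ε ^ 2) (by positivity)
    exact ⟨N, fun n hn k hk => (ENNReal.pow_lt_pow_left_iff two_ne_zero).1 (hN n hn k hk)⟩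
  · obtain ⟨δ, hδ, rfl⟩ := exists_pos_sq_eq hε
    obtain ⟨N, hN⟩ := h δ hδ
    exact ⟨N, fun n hn k hk => (ENNReal.pow_lt_pow_left_iff two_ne_zero).2 (hN n hn k hk)⟩

lemma tendsto_val₁_sub_iff (Q : Form E) (u : ℕ → Q.dom) (f : Q.dom) :
    Tendsto (fun n => Q.val₁ (u n - f)) atTop (𝓝 0) ↔
      Tendsto (fun n => Q.toSpace (u n)) atTop (𝓝 (Q.toSpace f)) := by
  rw [tendsto_iff_edist_tendsto_0]
  simp only [val₁_sub_eq_edist_sq]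
  refine ⟨fun h => ?_, fun h => ?_⟩
  · have hsqrt (n : ℕ) : (edist (Q.toSpace (u n)) (Q.toSpace f) ^ 2) ^ (2⁻¹ : ℝ) =
        edist (Q.toSpace (u n)) (Q.toSpace f) := by
      exact_mod_cast ENNReal.rpow_rpow_inv (two_ne_zero (α := ℝ)) _
    simpa [hsqrt] using h.ennrpow_const (2⁻¹ : ℝ)
  · simpa using ENNReal.Tendsto.pow (n := 2) h

lemma isClosed_iff_completeSpace (Q : Form E) : Q.IsClosed ↔ CompleteSpace Q.Space := by
  refine ⟨fun h => ?_, fun h u hu hcauchy => ?_⟩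
  · refine UniformSpace.complete_of_cauchySeq_tendsto fun u hu => ?_
    obtain ⟨f, hf, hlim⟩ := h (fun n => Q.incl (u n)) (fun n => Q.incl_mem _)
      ((Q.forall_val₁_sub_lt_iff_cauchySeq fun n => Q.toSpace.symm (u n)).2 hu)
    exact ⟨Q.toSpace ⟨f, hf⟩,
      (Q.tendsto_val₁_sub_iff (fun n => Q.toSpace.symm (u n)) ⟨f, hf⟩).1 hlim⟩
  · obtain ⟨f, hlim⟩ := cauchySeq_tendsto_of_complete
      ((Q.forall_val₁_sub_lt_iff_cauchySeq fun n => ⟨u n, hu n⟩).1 hcauchy)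
    exact ⟨Q.incl f, Q.incl_mem f,
      (Q.tendsto_val₁_sub_iff (fun n => ⟨u n, hu n⟩) (Q.toSpace.symm f)).2 hlim⟩

/-- The inclusion of the form space of `Q` in the form space of `Q' ≤ Q`. -/
def spaceInclusion {Q Q' : Form E} (hle : Q'.val ≤ Q.val) : Q.Space →L[ℝ] Q'.Space :=
  (Q'.toSpace.toLinearMap ∘ₗ Submodule.inclusion (dom_le_of_val_le hle) ∘ₗ
    Q.toSpace.symm.toLinearMap).mkContinuous 1 fun f => by
    rw [one_mul]
    refine abs_le_of_sq_le_sq' ?_ (norm_nonneg _) |>.2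
    exact (Q'.norm_sq_toSpace _).trans_le ((add_le_add_left
      (bilin_inclusion_self_le hle (Q.toSpace.symm f)) _).trans_eq
        (Q.norm_sq_toSpace (Q.toSpace.symm f)).symm)

lemma isClosed_of_isClosed_graph [CompleteSpace E] {H : Type*} [NormedAddCommGroup H]
    [NormedSpace ℝ H] [CompleteSpace H] (Q : Form E) (L : Q.dom →ₗ[ℝ] H) {K K' : ℝ}
    (hL : ∀ f, ‖L f‖ ≤ K * ‖Q.toSpace f‖) (hQ : ∀ f, Q.bilin f f ≤ K' * ‖L f‖ ^ 2)
    (hclosed : _root_.IsClosed (range fun f : Q.dom => ((f : E), L f))) : Q.IsClosed := by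
  rw [Q.isClosed_iff_completeSpace]
  let L' : Q.Space →L[ℝ] H := (L ∘ₗ Q.toSpace.symm.toLinearMap).mkContinuous K
    fun f => hL (Q.toSpace.symm f)
  have norm_le (f : Q.Space) : ‖f‖ ≤ √(|K'| + 1) * ‖(Q.incl.prod L') f‖ := by
    refine abs_le_of_sq_le_sq' ?_ (by positivity) |>.2
    rw [mul_pow, Real.sq_sqrt (by positivity)]
    have hE : ‖Q.incl f‖ ^ 2 ≤ ‖(Q.incl.prod L') f‖ ^ 2 :=
      pow_le_pow_left₀ (norm_nonneg _) (norm_fst_le ((Q.incl.prod L') f)) 2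
    have hH : ‖L' f‖ ^ 2 ≤ ‖(Q.incl.prod L') f‖ ^ 2 :=
      pow_le_pow_left₀ (norm_nonneg _) (norm_snd_le ((Q.incl.prod L') f)) 2
    calc ‖f‖ ^ 2 = Q.bilin (Q.toSpace.symm f) (Q.toSpace.symm f) + ‖Q.incl f‖ ^ 2 :=
          Q.norm_sq_toSpace (Q.toSpace.symm f)
      _ ≤ |K'| * ‖L' f‖ ^ 2 + ‖Q.incl f‖ ^ 2 := by
          gcongr
          exact (hQ _).trans (mul_le_mul_of_nonneg_right (le_abs_self K') (sq_nonneg _))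
      _ ≤ |K'| * ‖(Q.incl.prod L') f‖ ^ 2 + ‖(Q.incl.prod L') f‖ ^ 2 := by gcongr
      _ = (|K'| + 1) * ‖(Q.incl.prod L') f‖ ^ 2 := by ring
  have hind : IsUniformInducing (Q.incl.prod L') :=
    (AddMonoidHomClass.antilipschitz_of_bound (Q.incl.prod L')
      (K := (√(|K'| + 1)).toNNReal) fun f => by
        simpa only [Real.coe_toNNReal _ (Real.sqrt_nonneg _)] using norm_le f).isUniformInducing
      (Q.incl.prod L').uniformContinuous
  exact (completeSpace_iff_isComplete_range hind).2 hclosed.isComplete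

lemma IsClosed.incl_mem_of_mem_topologicalClosure {Q Q' : Form E} (hQ : Q.IsClosed)
    {S : Submodule ℝ Q'.Space}
    (hle : ∀ f ∈ S, Q.val (Q'.incl f) ≤ Q'.val (Q'.incl f)) {f : Q'.Space}
    (hf : f ∈ S.topologicalClosure) : Q'.incl f ∈ Q.dom := by
  have : CompleteSpace Q.Space := Q.isClosed_iff_completeSpace.1 hQ
  have hmem (g : S) : Q'.incl g ∈ Q.dom :=
    Q.mem_dom_iff.2 ((hle g g.2).trans_lt (Q'.mem_dom_iff.1 (Q'.incl_mem g)).lt_top).ne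
  let T : S →ₗ[ℝ] Q.Space :=
    Q.toSpace.toLinearMap ∘ₗ LinearMap.codRestrict Q.dom (Q'.incl.toLinearMap ∘ₗ S.subtype) hmem
  have hT (g : S) : ‖T g‖ ≤ 1 * ‖g‖ := by
    have hg := hle g g.2
    rw [Q.val_of_mem ⟨_, hmem g⟩, Q'.val_of_mem ⟨_, Q'.incl_mem g⟩,
      ENNReal.ofReal_le_ofReal_iff (Q'.nonneg _)] at hg
    have hsq : ‖(g : Q'.Space)‖ ^ 2 = _ := Q'.norm_sq_toSpace (Q'.toSpace.symm g)
    rw [one_mul]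
    refine abs_le_of_sq_le_sq' ?_ (norm_nonneg _) |>.2
    change ‖Q.toSpace ⟨Q'.incl g, hmem g⟩‖ ^ 2 ≤ ‖(g : Q'.Space)‖ ^ 2
    rw [Q.norm_sq_toSpace, hsq]
    exact add_le_add_left hg _
  obtain ⟨u, hu, hlim⟩ := mem_closure_iff_seq_limit.1 (show f ∈ closure (S : Set Q'.Space) from hf)
  have hcauchy : CauchySeq fun n => (⟨u n, hu n⟩ : S) :=
    (isUniformInducing_val _).cauchy_map_iff.1 hlim.cauchySeq
  obtain ⟨g, hg⟩ := cauchySeq_tendsto_of_complete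
    ((T.mkContinuous 1 hT).uniformContinuous.comp_cauchySeq hcauchy)
  rw [← tendsto_nhds_unique ((Q.incl.continuous.tendsto g).comp hg)
    ((Q'.incl.continuous.tendsto f).comp hlim)]
  exact Q.incl_mem g

lemma IsClosed.scale {Q : Form E} (h : Q.IsClosed) {s : ℝ≥0} (hs : 0 < s) :
    (Q.scale s).IsClosed := by
  rw [isClosed_iff_completeSpace] at h ⊢
  let e : (Q.scale s).Space ≃ₗ[ℝ] Q.Space := (Q.scale s).toSpace.symm.trans Q.toSpace
  have norm_sq_scale (f : Q.dom) :
      ‖(Q.scale s).toSpace f‖ ^ 2 = s * Q.bilin f f + ‖(f : E)‖ ^ 2 :=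
    (Q.scale s).norm_sq_toSpace f
  have norm_le (f : Q.dom) : ‖Q.toSpace f‖ ≤ √(1 + (s : ℝ)⁻¹) * ‖(Q.scale s).toSpace f‖ := by
    refine abs_le_of_sq_le_sq' ?_ (by positivity) |>.2
    rw [mul_pow, Real.sq_sqrt (by positivity), norm_sq_scale, norm_sq_toSpace]
    have hcancel : (s : ℝ)⁻¹ * (s * Q.bilin f f) = Q.bilin f f :=
      inv_mul_cancel_left₀ (NNReal.coe_ne_zero.2 hs.ne') _
    have : 0 ≤ (s : ℝ) * Q.bilin f f := mul_nonneg s.2 (Q.nonneg f)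
    have : 0 ≤ (s : ℝ)⁻¹ * ‖(f : E)‖ ^ 2 := by positivity
    linarith
  have norm_scale_le (f : Q.dom) : ‖(Q.scale s).toSpace f‖ ≤ √(1 + (s : ℝ)) * ‖Q.toSpace f‖ := by
    refine abs_le_of_sq_le_sq' ?_ (by positivity) |>.2
    rw [mul_pow, Real.sq_sqrt (by positivity), norm_sq_scale, norm_sq_toSpace]
    have : 0 ≤ (s : ℝ) * ‖(f : E)‖ ^ 2 := by positivity
    linarith [Q.nonneg f]
  let e' := e.toContinuousLinearEquivOfBounds _ _ norm_le norm_scale_le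
  exact (completeSpace_congr (e := e'.toEquiv) e'.isUniformEmbedding).2 h

end Form

end FormSpace

section WeakConvergence

variable {H E : Type*} [NormedAddCommGroup H] [InnerProductSpace ℝ H] [CompleteSpace H]
  [NormedAddCommGroup E] [InnerProductSpace ℝ E] [CompleteSpace E]

lemma tendsto_inner_of_bounded {ι : H →L[ℝ] E} (hι : Function.Injective ι) {u : ℕ → H} {f : H}
    {K : ℝ} (hK : ∀ n, ‖u n‖ ≤ K) (hu : Tendsto (fun n => ι (u n)) atTop (𝓝 (ι f))) (g : H) :
    Tendsto (fun n => inner ℝ (u n) g) atTop (𝓝 (inner ℝ f g)) := by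
  have hdense : Dense (ι.adjoint.range : Set H) := by
    rw [Submodule.dense_iff_topologicalClosure_eq_top, Submodule.topologicalClosure_eq_top_iff,
      ContinuousLinearMap.orthogonal_range, ContinuousLinearMap.adjoint_adjoint]
    exact LinearMap.ker_eq_bot.2 hι
  have hequi : Equicontinuous fun n g => inner ℝ (u n) g := by
    refine (LipschitzWith.uniformEquicontinuous _ K.toNNReal fun n => ?_).equicontinuous
    refine (innerSL ℝ (u n)).lipschitz.weaken ?_
    rw [← NNReal.coe_le_coe, coe_nnnorm, innerSL_apply_norm]
    exact (hK n).trans K.le_coe_toNNReal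
  have hclosed := hequi.isClosed_setOfPred_tendsto (l := atTop) (f := fun g => inner ℝ f g)
    (by fun_prop)
  refine hclosed.closure_subset_iff.2 ?_ (hdense g)
  rintro _ ⟨e, rfl⟩
  simpa only [Set.mem_ofPred_eq, ContinuousLinearMap.coe_coe,
    ContinuousLinearMap.adjoint_inner_right] using hu.inner tendsto_const_nhds

lemma mem_of_bounded_of_tendsto {ι : H →L[ℝ] E} (hι : Function.Injective ι) {u : ℕ → H} {f : H}
    {K : ℝ} (hK : ∀ n, ‖u n‖ ≤ K) (hu : Tendsto (fun n => ι (u n)) atTop (𝓝 (ι f)))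
    {S : Submodule ℝ H} (hS : IsClosed (S : Set H)) (hmem : ∀ n, u n ∈ S) : f ∈ S := by
  have : CompleteSpace S := hS.completeSpace_coe
  rw [← Submodule.orthogonal_orthogonal S, Submodule.mem_orthogonal']
  intro g hg
  refine tendsto_nhds_unique (tendsto_inner_of_bounded hι hK hu g) ?_
  simp only [(Submodule.mem_orthogonal S g).1 hg _ (hmem _), tendsto_const_nhds]

end WeakConvergence

section Ell2

variable {X : Type*}

lemma weight_pos (m : X → Ioi (0 : ℝ)) (x : X) : (0 : ℝ) < m x := (m x).2

variable [MeasurableSpace X] {m : X → Ioi (0 : ℝ)}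

lemma ell2_ext {f g : ell2 m} (h : ∀ x, f x = g x) : f = g := Lp.ext (Eventually.of_forall h)

variable [DiscreteMeasurableSpace X]

lemma ell2_neg_apply (f : ell2 m) (x : X) : (-f) x = -f x :=
  congrFun (eq_of_ae_eq m (Lp.coeFn_neg f)) x

lemma ell2_sub_apply (f g : ell2 m) (x : X) : (f - g) x = f x - g x :=
  congrFun (eq_of_ae_eq m (Lp.coeFn_sub f g)) x

lemma ell2_comp_apply {C : ℝ → ℝ} (hC : LipschitzWith 1 C) (h0 : C 0 = 0) (f : ell2 m) (x : X) :
    (hC.compLp h0 f : ell2 m) x = C (f x) :=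
  congrFun (eq_of_ae_eq m (hC.coeFn_compLp h0 f)) x

lemma lintegral_vertexMeasure (m : X → Ioi (0 : ℝ)) (F : X → ℝ≥0∞) :
    ∫⁻ x, F x ∂(vertexMeasure m) = ∑' x, ENNReal.ofReal (m x) * F x := by
  rw [vertexMeasure, lintegral_sum_measure]
  congr with x
  rw [lintegral_smul_measure, lintegral_dirac, smul_eq_mul]

lemma memLp_of_summable {f : X → ℝ} (hf : Summable fun x => (m x : ℝ) * f x ^ 2) :
    MemLp f 2 (vertexMeasure m) := by
  refine ⟨(Measurable.of_discrete (f := f)).aestronglyMeasurable, ?_⟩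
  rw [eLpNorm_lt_top_iff_lintegral_rpow_enorm_lt_top (by norm_num) (by norm_num),
    lintegral_vertexMeasure]
  have hterm (x : X) : ENNReal.ofReal (m x) * ‖f x‖ₑ ^ (ENNReal.toReal 2) =
      ENNReal.ofReal ((m x : ℝ) * f x ^ 2) := by
    rw [ENNReal.ofReal_mul (weight_pos m x).le, Real.enorm_eq_ofReal_abs,
      ENNReal.ofReal_rpow_of_nonneg (abs_nonneg _) (by simp)]
    simp
  simp only [hterm]
  rw [← ENNReal.ofReal_tsum_of_nonneg (fun x => mul_nonneg (weight_pos m x).le (sq_nonneg _)) hf]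
  exact ENNReal.ofReal_lt_top

lemma exists_ell2 {f : X → ℝ} (hf : Summable fun x => (m x : ℝ) * f x ^ 2) :
    ∃ u : ell2 m, ∀ x, u x = f x :=
  ⟨(memLp_of_summable hf).toLp f,
    fun x => congrFun (eq_of_ae_eq m (memLp_of_summable hf).coeFn_toLp) x⟩

lemma hasSum_inner (f g : ell2 m) : HasSum (fun x => (m x : ℝ) * (f x * g x)) (inner ℝ f g) := by
  rw [L2.inner_def]
  refine (hasSum_integral_measure (μ := fun x => ENNReal.ofReal (m x : ℝ) • Measure.dirac x)
    (L2.integrable_inner f g)).congr_fun fun x => ?_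
  rw [integral_smul_measure, integral_dirac, ENNReal.toReal_ofReal (weight_pos m x).le]
  simp [mul_comm]

lemma hasSum_norm_sq (f : ell2 m) : HasSum (fun x => (m x : ℝ) * f x ^ 2) (‖f‖ ^ 2) := by
  have := hasSum_inner f f
  rw [real_inner_self_eq_norm_sq] at this
  simpa [sq] using this

lemma weight_mul_sq_le (f : ell2 m) (x : X) : (m x : ℝ) * f x ^ 2 ≤ ‖f‖ ^ 2 :=
  le_hasSum (hasSum_norm_sq f) x fun y _ => mul_nonneg (weight_pos m y).le (sq_nonneg _)

lemma tendsto_apply {ι : Type*} {l : Filter ι} {u : ι → ell2 m} {f : ell2 m}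
    (h : Tendsto u l (𝓝 f)) (x : X) : Tendsto (fun i => u i x) l (𝓝 (f x)) := by
  rw [tendsto_iff_norm_sub_tendsto_zero] at h ⊢
  have hbound : Tendsto (fun i => (√(m x))⁻¹ * ‖u i - f‖) l (𝓝 0) := by
    simpa using h.const_mul (√(m x))⁻¹
  refine squeeze_zero (fun _ => norm_nonneg _) (fun i => ?_) hbound
  rw [← div_eq_inv_mul, le_div_iff₀ (Real.sqrt_pos.2 (weight_pos m x)), ← ell2_sub_apply]
  refine abs_le_of_sq_le_sq' ?_ (norm_nonneg _) |>.2
  rw [mul_pow, Real.sq_sqrt (weight_pos m x).le, Real.norm_eq_abs, sq_abs, mul_comm]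
  exact weight_mul_sq_le (u i - f) x

lemma exists_ell2_of_le {f : X → ℝ} (g : ell2 m) (K : ℝ) (h : ∀ x, |f x| ≤ K * |g x|) :
    ∃ u : ell2 m, ∀ x, u x = f x := by
  refine exists_ell2 (Summable.of_nonneg_of_le
    (fun x => mul_nonneg (weight_pos m x).le (sq_nonneg _)) (fun x => ?_)
    ((hasSum_norm_sq g).summable.mul_left (K ^ 2)))
  have hsq : f x ^ 2 ≤ K ^ 2 * g x ^ 2 := by
    rw [← sq_abs (f x), ← sq_abs (g x), ← mul_pow]
    exact pow_le_pow_left₀ (abs_nonneg _) (h x) 2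
  linarith [mul_le_mul_of_nonneg_left hsq (weight_pos m x).le]

lemma norm_sq_le_of_abs_le {f g : ell2 m} (h : ∀ x, |f x| ≤ |g x|) : ‖f‖ ^ 2 ≤ ‖g‖ ^ 2 :=
  hasSum_le (fun x => mul_le_mul_of_nonneg_left (sq_le_sq.2 (h x)) (weight_pos m x).le)
    (hasSum_norm_sq f) (hasSum_norm_sq g)

lemma ell2_tendsto_of_dominated {ι : Type*} {l : Filter ι} {u : ι → ell2 m} {f g : ell2 m}
    (hu : ∀ i x, |u i x| ≤ |g x|) (hf : ∀ x, |f x| ≤ |g x|)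
    (hlim : ∀ x, Tendsto (fun i => u i x) l (𝓝 (f x))) : Tendsto u l (𝓝 f) := by
  have hterm (i : ι) (x : X) : ‖(m x : ℝ) * (u i x - f x) ^ 2‖ ≤ 4 * ((m x : ℝ) * g x ^ 2) := by
    rw [Real.norm_of_nonneg (mul_nonneg (weight_pos m x).le (sq_nonneg _))]
    have habs : |u i x - f x| ≤ |2 * g x| := by
      rw [abs_mul, abs_two]
      linarith [abs_sub (u i x) (f x), hu i x, hf x]
    linarith [mul_le_mul_of_nonneg_left (sq_le_sq.2 habs) (weight_pos m x).le]
  have htsum : Tendsto (fun i => ∑' x, (m x : ℝ) * (u i x - f x) ^ 2) l (𝓝 (∑' _ : X, (0 : ℝ))) :=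
    tendsto_tsum_of_dominated_convergence ((hasSum_norm_sq g).summable.mul_left 4)
      (fun x => by simpa using (((hlim x).sub_const (f x)).pow 2).const_mul (m x : ℝ))
      (Eventually.of_forall hterm)
  have hnorm_sq : Tendsto (fun i => ‖u i - f‖ ^ 2) l (𝓝 0) := by
    simpa only [← (hasSum_norm_sq (_ - f)).tsum_eq, ell2_sub_apply, tsum_zero] using htsum
  rw [tendsto_iff_norm_sub_tendsto_zero]
  simpa [Real.sqrt_sq] using hnorm_sq.sqrt

open Classical in
lemma exists_delta (m : X → Ioi (0 : ℝ)) (x : X) :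
    ∃ u : ell2 m, ∀ y, u y = if y = x then 1 else 0 :=
  exists_ell2 (summable_of_ne_finset_zero (s := {x}) fun y hy => by
    simp [if_neg (Finset.notMem_singleton.1 hy)])

/-- The indicator function of a vertex. -/
def delta (m : X → Ioi (0 : ℝ)) (x : X) : ell2 m := (exists_delta m x).choose

open Classical in
lemma delta_apply (x y : X) : delta m x y = if y = x then 1 else 0 :=
  (exists_delta m x).choose_spec y

lemma delta_self (x : X) : delta m x x = 1 := by simp [delta_apply]

lemma delta_of_ne {x y : X} (h : y ≠ x) : delta m x y = 0 := by simp [delta_apply, h]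

lemma delta_mem_finSupp (x : X) : delta m x ∈ finSupp m := by
  refine (Set.finite_singleton x).subset fun y hy => ?_
  by_contra hc
  exact hy (delta_of_ne hc)

lemma inner_delta (f : ell2 m) (x : X) : inner ℝ f (delta m x) = m x * f x := by
  refine (hasSum_inner f (delta m x)).unique ?_
  simpa [delta_self] using hasSum_single (f := fun y => (m y : ℝ) * (f y * delta m x y)) x
    fun y hy => by simp [delta_of_ne hy]

open Classical in
lemma exists_cutoff (f : ell2 m) (s : Set X) : ∃ u : ell2 m, ∀ y, u y = if y ∈ s then f y else 0 :=
  exists_ell2_of_le f 1 fun x => by split_ifs <;> simp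

/-- The product of a function with the indicator function of a set. -/
def cutoff (f : ell2 m) (s : Set X) : ell2 m := (exists_cutoff f s).choose

open Classical in
lemma cutoff_apply (f : ell2 m) (s : Set X) (y : X) : cutoff f s y = if y ∈ s then f y else 0 :=
  (exists_cutoff f s).choose_spec y

lemma tendsto_cutoff (f : ell2 m) :
    Tendsto (fun s : Finset X => cutoff f (s : Set X)) atTop (𝓝 f) := by
  refine ell2_tendsto_of_dominated (g := f) (fun s x => ?_) (fun x => le_rfl) (fun x => ?_)
  · rw [cutoff_apply]
    split_ifs <;> simp
  · refine tendsto_const_nhds.congr' ?_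
    filter_upwards [eventually_ge_atTop {x}] with s hs
    rw [cutoff_apply, if_pos]
    exact hs (Finset.mem_singleton_self x)

lemma cutoff_mem_finSupp (f : ell2 m) (s : Finset X) : cutoff f (s : Set X) ∈ finSupp m := by
  refine s.finite_toSet.subset fun y hy => ?_
  by_contra hc
  exact hy (by rw [cutoff_apply, if_neg hc])

lemma dense_finSupp (m : X → Ioi (0 : ℝ)) : Dense (finSupp m : Set (ell2 m)) := fun f =>
  mem_closure_of_tendsto (tendsto_cutoff f) (Eventually.of_forall fun s => cutoff_mem_finSupp f s)

lemma eq_sum_delta {f : ell2 m} {s : Finset X} (hs : ∀ x ∉ s, f x = 0) :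
    f = ∑ x ∈ s, f x • delta m x := by
  classical
  have hsum (t : Finset X) (y : X) : (∑ x ∈ t, f x • delta m x : ell2 m) y =
      ∑ x ∈ t, f x * delta m x y := by
    induction t using Finset.induction_on with
    | empty => rw [Finset.sum_empty, Finset.sum_empty, ell2_zero_apply]
    | insert a t ha ih =>
      rw [Finset.sum_insert ha, Finset.sum_insert ha, ell2_add_apply, ih, ell2_smul_apply]
  refine ell2_ext fun y => ?_
  simp only [hsum, delta_apply, mul_ite, mul_one, mul_zero, Finset.sum_ite_eq]
  split_ifs with hy
  · rfl
  · exact hs y hy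

end Ell2

/-! ### The energy of a graph -/

section Energy

variable {X : Type*} {G : WGraph X}

/-- The energy `½ ∑ b(x,y)(f(x)-f(y))²` of a function; it is `0` if the sum diverges. -/
def energy (G : WGraph X) (f : X → ℝ) : ℝ := 1 / 2 * ∑' p, energyTerm G f f p

lemma energyTerm_self_nonneg (f : X → ℝ) (p : X × X) : 0 ≤ energyTerm G f f p :=
  mul_nonneg (G.nonneg _ _) (mul_self_nonneg _)

lemma energy_nonneg (f : X → ℝ) : 0 ≤ energy G f :=
  mul_nonneg (by norm_num) (tsum_nonneg fun p => energyTerm_self_nonneg f p)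

lemma energyTerm_le_of_sq_le {f g h : X → ℝ} {c d : ℝ}
    (hsq : ∀ x y, (f x - f y) ^ 2 ≤ c * (g x - g y) ^ 2 + d * (h x - h y) ^ 2) (p : X × X) :
    energyTerm G f f p ≤ c * energyTerm G g g p + d * energyTerm G h h p := by
  have := mul_le_mul_of_nonneg_left (hsq p.1 p.2) (G.nonneg p.1 p.2)
  simp only [energyTerm]
  linarith

end Energy

section NormalContraction

/-- The truncation of `t` to the interval `[a,b]`, a normal contraction if `a ≤ 0 ≤ b`. -/
def clamp (a b t : ℝ) : ℝ := max a (min t b)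

lemma lipschitz_clamp (a b : ℝ) : LipschitzWith 1 (clamp a b) :=
  (LipschitzWith.id.min_const b).const_max a

lemma monotone_clamp (a b : ℝ) : Monotone (clamp a b) := fun _ _ hst =>
  max_le_max le_rfl (min_le_min hst le_rfl)

lemma clamp_eq_self {a b t : ℝ} (ha : a ≤ t) (hb : t ≤ b) : clamp a b t = t := by
  rw [clamp, min_eq_left hb, max_eq_right ha]

lemma clamp_mem_Icc {a b : ℝ} (hab : a ≤ b) (t : ℝ) : clamp a b t ∈ Icc a b :=
  ⟨le_max_left _ _, max_le hab (min_le_right _ _)⟩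

variable {C : ℝ → ℝ} (hC : LipschitzWith 1 C)
include hC

lemma abs_le_of_lipschitz (h0 : C 0 = 0) (t : ℝ) : |C t| ≤ |t| := by
  simpa [Real.dist_eq, h0] using hC.dist_le_mul t 0

lemma sq_sub_le_of_lipschitz (s t : ℝ) : (C s - C t) ^ 2 ≤ (s - t) ^ 2 := by
  rw [sq_le_sq]
  simpa [Real.dist_eq] using hC.dist_le_mul s t

lemma comp_sub_mul_self_le (hm : Monotone C) (s t : ℝ) :
    (C s - C t) * (C s - C t) ≤ (s - t) * (C s - C t) := by
  have hnonneg : 0 ≤ (s - t) * (C s - C t) := by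
    rcases le_total s t with hst | hst
    · exact mul_nonneg_of_nonpos_of_nonpos (sub_nonpos.2 hst) (sub_nonpos.2 (hm hst))
    · exact mul_nonneg (sub_nonneg.2 hst) (sub_nonneg.2 (hm hst))
  rw [← abs_of_nonneg hnonneg, ← abs_mul_abs_self (C s - C t), abs_mul]
  exact mul_le_mul_of_nonneg_right (sq_le_sq.1 (sq_sub_le_of_lipschitz hC s t)) (abs_nonneg _)

end NormalContraction

section Neumann

variable {X : Type*} [MeasurableSpace X] [DiscreteMeasurableSpace X] {m : X → Ioi (0 : ℝ)}
  {G : WGraph X}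

/-- The Hilbert space `D(Q^(N))`. -/
abbrev NeumannSpace (m : X → Ioi (0 : ℝ)) (G : WGraph X) : Type _ := (neumannForm m G).Space

/-- The function in `ℓ²(X,m)` underlying an element of `D(Q^(N))`. -/
abbrev toEll2 : NeumannSpace m G →L[ℝ] ell2 m := (neumannForm m G).incl

instance : CoeFun (NeumannSpace m G) fun _ => X → ℝ := ⟨fun u => toEll2 u⟩

lemma toEll2_injective : Function.Injective (toEll2 : NeumannSpace m G → ell2 m) :=
  (neumannForm m G).incl_injective

lemma neumann_ext {f g : NeumannSpace m G} (h : ∀ x, f x = g x) : f = g :=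
  toEll2_injective (ell2_ext h)

lemma neumann_add_apply (f g : NeumannSpace m G) (x : X) : (f + g) x = f x + g x := by
  rw [map_add, ell2_add_apply]

lemma neumann_sub_apply (f g : NeumannSpace m G) (x : X) : (f - g) x = f x - g x := by
  rw [map_sub, ell2_sub_apply]

lemma neumann_neg_apply (f : NeumannSpace m G) (x : X) : (-f) x = -f x := by
  rw [map_neg, ell2_neg_apply]

lemma neumann_smul_apply (a : ℝ) (f : NeumannSpace m G) (x : X) : (a • f) x = a * f x := by
  rw [map_smul, ell2_smul_apply]

lemma neumann_zero_apply (x : X) : (0 : NeumannSpace m G) x = 0 := by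
  rw [map_zero, ell2_zero_apply]

lemma summable_energy (f : NeumannSpace m G) : Summable (energyTerm G f f) :=
  (neumannForm m G).incl_mem f

lemma neumann_inner (f g : NeumannSpace m G) :
    inner ℝ f g = 1 / 2 * ∑' p, energyTerm G f g p + inner ℝ (toEll2 f) (toEll2 g) := rfl

lemma neumann_norm_sq (f : NeumannSpace m G) : ‖f‖ ^ 2 = energy G f + ‖toEll2 f‖ ^ 2 :=
  (neumannForm m G).norm_sq_toSpace ((neumannForm m G).toSpace.symm f)

lemma exists_toEll2_eq {f : ell2 m} (h : f ∈ (neumannForm m G).dom) :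
    ∃ u : NeumannSpace m G, toEll2 u = f :=
  ⟨(neumannForm m G).toSpace ⟨f, h⟩, rfl⟩

lemma energy_le_of_sq_le {f : ell2 m} {g h : NeumannSpace m G} {c d : ℝ}
    (hsq : ∀ x y, (f x - f y) ^ 2 ≤ c * (g x - g y) ^ 2 + d * (h x - h y) ^ 2) :
    f ∈ (neumannForm m G).dom ∧ energy G f ≤ c * energy G g + d * energy G h := by
  have hg := (summable_energy g).mul_left c
  have hh := (summable_energy h).mul_left d
  have hf : Summable (energyTerm G f f) := Summable.of_nonneg_of_le
    (fun p => energyTerm_self_nonneg f p) (energyTerm_le_of_sq_le hsq) (hg.add hh)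
  have htsum := hf.tsum_le_tsum (energyTerm_le_of_sq_le hsq) (hg.add hh)
  rw [hg.tsum_add hh, tsum_mul_left, tsum_mul_left] at htsum
  refine ⟨hf, ?_⟩
  simp only [energy]
  linarith

lemma exists_neumann_of_sq_le {φ : X → ℝ} (g h : NeumannSpace m G) {c d K : ℝ}
    (habs : ∀ x, |φ x| ≤ K * |g x|)
    (hsq : ∀ x y, (φ x - φ y) ^ 2 ≤ c * (g x - g y) ^ 2 + d * (h x - h y) ^ 2) :
    ∃ u : NeumannSpace m G, ∀ x, u x = φ x := by
  obtain ⟨f, hf⟩ := exists_ell2_of_le (toEll2 g) K habs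
  simp only [← hf] at hsq
  obtain ⟨u, hu⟩ := exists_toEll2_eq (energy_le_of_sq_le hsq).1
  exact ⟨u, fun x => by rw [hu, hf]⟩

lemma neumann_norm_sq_le_of_sq_le {u g h : NeumannSpace m G} {c d : ℝ} (hc : 0 ≤ c) (hd : 0 ≤ d)
    (habs : ∀ x, |u x| ≤ |g x|)
    (hsq : ∀ x y, (u x - u y) ^ 2 ≤ c * (g x - g y) ^ 2 + d * (h x - h y) ^ 2) :
    ‖u‖ ^ 2 ≤ (1 + c) * ‖g‖ ^ 2 + d * ‖h‖ ^ 2 := by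
  have henergy := (energy_le_of_sq_le hsq).2
  have hnorm := norm_sq_le_of_abs_le habs
  have hg : 0 ≤ energy G g := energy_nonneg g
  have hcg := mul_nonneg hc (sq_nonneg ‖toEll2 g‖)
  have hdh := mul_nonneg hd (sq_nonneg ‖toEll2 h‖)
  simp only [neumann_norm_sq]
  linarith

lemma exists_neumann_mul {f g : NeumannSpace m G} {K : ℝ} (hf : ∀ x, |f x| ≤ K)
    (hg : ∀ x, |g x| ≤ K) : ∃ u : NeumannSpace m G, ∀ x, u x = f x * g x := by
  refine exists_neumann_of_sq_le f g (c := 2 * K ^ 2) (d := 2 * K ^ 2) (K := K) (fun x => ?_)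
    (fun x y => ?_)
  · rw [abs_mul, mul_comm]
    exact mul_le_mul_of_nonneg_right (hg x) (abs_nonneg _)
  · have hgx : g x ^ 2 ≤ K ^ 2 := sq_le_sq.2 ((hg x).trans (le_abs_self K))
    have hfy : f y ^ 2 ≤ K ^ 2 := sq_le_sq.2 ((hf y).trans (le_abs_self K))
    calc (f x * g x - f y * g y) ^ 2 = (g x * (f x - f y) + f y * (g x - g y)) ^ 2 := by ring
      _ ≤ 2 * ((g x * (f x - f y)) ^ 2 + (f y * (g x - g y)) ^ 2) := add_sq_le
      _ = 2 * (g x ^ 2 * (f x - f y) ^ 2) + 2 * (f y ^ 2 * (g x - g y) ^ 2) := by ring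
      _ ≤ 2 * (K ^ 2 * (f x - f y) ^ 2) + 2 * (K ^ 2 * (g x - g y) ^ 2) := by gcongr
      _ = 2 * K ^ 2 * (f x - f y) ^ 2 + 2 * K ^ 2 * (g x - g y) ^ 2 := by ring

section Contraction

variable {C : ℝ → ℝ} (hC : LipschitzWith 1 C) (h0 : C 0 = 0) (f : NeumannSpace m G)

lemma compLp_mem_neumannDom_and_energy_le :
    hC.compLp h0 (toEll2 f) ∈ (neumannForm m G).dom ∧
      energy G (hC.compLp h0 (toEll2 f) : ell2 m) ≤ energy G f := by
  simpa only [one_mul, zero_mul, add_zero] using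
    energy_le_of_sq_le (f := hC.compLp h0 (toEll2 f)) (g := f) (h := f) (c := 1) (d := 0)
      fun x y => by
        rw [ell2_comp_apply, ell2_comp_apply, one_mul, zero_mul, add_zero]
        exact sq_sub_le_of_lipschitz hC _ _

/-- The composition of `f ∈ D(Q^(N))` with a normal contraction. -/
def neumannComp : NeumannSpace m G :=
  (exists_toEll2_eq (compLp_mem_neumannDom_and_energy_le hC h0 f).1).choose

lemma toEll2_neumannComp : toEll2 (neumannComp hC h0 f) = hC.compLp h0 (toEll2 f) :=
  (exists_toEll2_eq (compLp_mem_neumannDom_and_energy_le hC h0 f).1).choose_spec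

lemma neumannComp_apply (x : X) : neumannComp hC h0 f x = C (f x) := by
  rw [toEll2_neumannComp, ell2_comp_apply]

lemma energy_neumannComp_le : energy G (neumannComp hC h0 f) ≤ energy G f := by
  rw [toEll2_neumannComp]
  exact (compLp_mem_neumannDom_and_energy_le hC h0 f).2

lemma norm_neumannComp_le : ‖neumannComp hC h0 f‖ ≤ ‖f‖ := by
  refine abs_le_of_sq_le_sq' ?_ (norm_nonneg _) |>.2
  rw [neumann_norm_sq, neumann_norm_sq]
  refine add_le_add (energy_neumannComp_le hC h0 f) (norm_sq_le_of_abs_le fun x => ?_)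
  rw [neumannComp_apply]
  exact abs_le_of_lipschitz hC h0 _

lemma norm_sq_neumannComp_le_inner (hm : Monotone C) :
    ‖neumannComp hC h0 f‖ ^ 2 ≤ inner ℝ f (neumannComp hC h0 f) := by
  rw [← real_inner_self_eq_norm_sq, neumann_inner, neumann_inner]
  refine add_le_add (mul_le_mul_of_nonneg_left ?_ (by norm_num)) ?_
  · refine (summable_energy _).tsum_le_tsum (fun p => ?_)
      (summable_energyTerm G (summable_energy _) (summable_energy _))
    refine mul_le_mul_of_nonneg_left ?_ (G.nonneg _ _)
    simpa only [neumannComp_apply] using comp_sub_mul_self_le hC hm (f p.1) (f p.2)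
  · refine hasSum_le (fun x => ?_) (hasSum_inner _ _) (hasSum_inner _ _)
    refine mul_le_mul_of_nonneg_left ?_ (weight_pos m x).le
    simpa only [neumannComp_apply, h0, sub_zero] using comp_sub_mul_self_le hC hm (f x) 0

end Contraction

lemma exists_norm_le_of_tendsto {ι : Type*} {l : Filter ι} [l.NeBot] {u : ι → NeumannSpace m G}
    {f : ell2 m} {K : ℝ} (hK : ∀ᶠ i in l, ‖u i‖ ≤ K)
    (hlim : Tendsto (fun i => toEll2 (u i)) l (𝓝 f)) :
    ∃ v : NeumannSpace m G, toEll2 v = f ∧ ‖v‖ ≤ K := by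
  have hK0 : 0 ≤ K := hK.exists.elim fun i hi => (norm_nonneg _).trans hi
  have hfin (s : Finset (X × X)) : ∑ p ∈ s, energyTerm G f f p ≤ 2 * (K ^ 2 - ‖f‖ ^ 2) := by
    have hsum : Tendsto (fun i => ∑ p ∈ s, energyTerm G (u i) (u i) p) l
        (𝓝 (∑ p ∈ s, energyTerm G f f p)) := by
      refine tendsto_finsetSum _ fun p _ => ?_
      have hdiff := (tendsto_apply hlim p.1).sub (tendsto_apply hlim p.2)
      exact (hdiff.mul hdiff).const_mul _
    refine le_of_tendsto_of_tendsto hsum (((hlim.norm.pow 2).const_sub (K ^ 2)).const_mul 2) ?_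
    filter_upwards [hK] with i hi
    have hle := (summable_energy (u i)).sum_le_tsum s fun p _ => energyTerm_self_nonneg _ p
    have hnorm := pow_le_pow_left₀ (norm_nonneg _) hi 2
    rw [neumann_norm_sq, energy] at hnorm
    linarith
  have hsummable : Summable (energyTerm G f f) :=
    summable_of_sum_le (fun p => energyTerm_self_nonneg _ p) hfin
  obtain ⟨v, hv⟩ := exists_toEll2_eq (G := G) (f := f) hsummable
  refine ⟨v, hv, abs_le_of_sq_le_sq' ?_ hK0 |>.2⟩
  rw [neumann_norm_sq, hv, energy]
  linarith [hsummable.tsum_le_of_sum_le hfin]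

instance : CompleteSpace (NeumannSpace m G) := by
  refine Metric.complete_of_cauchySeq_tendsto fun u hu => ?_
  obtain ⟨f, hf⟩ := cauchySeq_tendsto_of_complete
    ((toEll2 (m := m) (G := G)).uniformContinuous.comp_cauchySeq hu)
  obtain ⟨K, hK⟩ := hu.norm_bddAbove
  obtain ⟨v, hv, -⟩ := exists_norm_le_of_tendsto
    (Eventually.of_forall fun n => hK (mem_range_self n)) hf
  refine ⟨v, Metric.tendsto_atTop'.2 fun ε hε => ?_⟩
  obtain ⟨N, hN⟩ := Metric.cauchySeq_iff.1 hu (ε / 2) (half_pos hε)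
  refine ⟨N, fun n hn => ?_⟩
  obtain ⟨w, hw, hwle⟩ := exists_norm_le_of_tendsto (u := fun k => u n - u k) (K := ε / 2)
    ((eventually_ge_atTop N).mono fun k hk => dist_eq_norm (u n) (u k) ▸ (hN n hn.le k hk).le)
    (by simpa only [map_sub, Function.comp_apply] using hf.const_sub (toEll2 (u n)))
  have hw' : w = u n - v := toEll2_injective (by rw [hw, map_sub, hv])
  rw [dist_eq_norm, ← hw']
  exact hwle.trans_lt (half_lt_self hε)

end Neumann

/-! ### Harmonic functions -/

section DirichletSubspace

variable {X : Type*} [MeasurableSpace X] [DiscreteMeasurableSpace X] {m : X → Ioi (0 : ℝ)}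
  {G : WGraph X}

open Classical in
lemma hasSum_energyTerm_delta {u : X → ℝ} {x : X} {s : ℝ}
    (hs : HasSum (fun y => G.b x y * (u x - u y)) s) :
    HasSum (energyTerm G u (delta m x)) (2 * s) := by
  let row : X × X → ℝ := fun p => if p.1 = x then G.b x p.2 * (u x - u p.2) else 0
  have hrow : HasSum row s := by
    refine ((Prod.mk_right_injective x).hasSum_iff ?_).1 ?_
    · rintro ⟨a, b⟩ hp
      exact if_neg fun ha => hp ⟨b, Prod.ext (Eq.symm ha) rfl⟩
    · simpa [Function.comp_def, row] using hs
  have hcolumn : HasSum (row ∘ Prod.swap) s := (Equiv.prodComm X X).hasSum_iff.2 hrow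
  rw [two_mul]
  refine (hrow.add hcolumn).congr_fun ?_
  rintro ⟨a, b⟩
  simp only [row, energyTerm, delta_apply, Function.comp_apply, Prod.swap_prod_mk]
  by_cases ha : a = x <;> by_cases hb : b = x
  · simp [ha, hb]
  · simp [ha, hb]
  · simp only [ha, hb, if_true, if_false, G.symm a x]
    ring
  · simp [ha, hb]

lemma delta_mem_neumannDom (x : X) : delta m x ∈ (neumannForm m G).dom := by
  classical
  refine (hasSum_energyTerm_delta (s := ∑' y, G.b x y * (delta m x x - delta m x y)) ?_).summable
  refine (Summable.of_nonneg_of_le (fun y => mul_nonneg (G.nonneg _ _) ?_)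
    (fun y => mul_le_of_le_one_right (G.nonneg _ _) ?_) (G.summable x)).hasSum
  all_goals
    simp only [delta_apply]
    split_ifs <;> simp

lemma mem_of_delta_mem {D : Submodule ℝ (ell2 m)} (h : ∀ x, delta m x ∈ D) : finSupp m ≤ D := by
  intro f hf
  have hf' : (Function.support (f : X → ℝ)).Finite := hf
  rw [eq_sum_delta (f := f) (s := hf'.toFinset) fun x hx => by simpa using hx]
  exact D.sum_mem fun x _ => D.smul_mem _ (h x)

lemma finSupp_le_neumannDom : finSupp m ≤ (neumannForm m G).dom :=
  mem_of_delta_mem delta_mem_neumannDom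

variable (m G) in
/-- `D(Q^(D))` as a closed subspace of the Hilbert space `D(Q^(N))`. -/
def dirichletSubspace : Submodule ℝ (NeumannSpace m G) :=
  ((finSupp m).comap (toEll2 (m := m) (G := G) : NeumannSpace m G →ₗ[ℝ] ell2 m)).topologicalClosure

lemma isClosed_dirichletSubspace : IsClosed (dirichletSubspace m G : Set (NeumannSpace m G)) :=
  Submodule.isClosed_topologicalClosure _

instance : CompleteSpace (dirichletSubspace m G) := isClosed_dirichletSubspace.completeSpace_coe

lemma mem_dirichletSubspace_of_finSupp {f : NeumannSpace m G} (h : toEll2 f ∈ finSupp m) :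
    f ∈ dirichletSubspace m G :=
  Submodule.le_topologicalClosure _ h

lemma mem_dirichletSubspace_iff {f : NeumannSpace m G} :
    f ∈ dirichletSubspace m G ↔ toEll2 f ∈ (dirichletForm m G).dom := by
  have hval (g : NeumannSpace m G) :
      (neumannForm m G).val₁ (toEll2 f - toEll2 g) = edist f g ^ 2 :=
    (neumannForm m G).val₁_sub_eq_edist_sq ((neumannForm m G).toSpace.symm f)
      ((neumannForm m G).toSpace.symm g)
  change f ∈ closure _ ↔ toEll2 f ∈ (neumannForm m G).dom ∧ _
  rw [EMetric.mem_closure_iff]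
  refine ⟨fun h => ⟨Form.incl_mem _ f, fun ε hε => ?_⟩, fun ⟨_, h⟩ ε hε => ?_⟩
  · obtain ⟨δ, hδ, rfl⟩ := exists_pos_sq_eq hε
    obtain ⟨g, hg, hlt⟩ := h δ hδ
    refine ⟨toEll2 g, hg, Form.incl_mem _ g, ?_⟩
    rw [hval]
    exact (ENNReal.pow_lt_pow_left_iff two_ne_zero).2 hlt
  · obtain ⟨g, hg, hgdom, hlt⟩ := h (ε ^ 2) (by positivity)
    obtain ⟨v, rfl⟩ := exists_toEll2_eq hgdom
    rw [hval] at hlt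
    exact ⟨v, hg, (ENNReal.pow_lt_pow_left_iff two_ne_zero).1 hlt⟩

lemma summable_row_sq (u : NeumannSpace m G) (x : X) :
    Summable fun y => G.b x y * (u x - u y) ^ 2 := by
  have := (summable_energy u).comp_injective (i := fun y => (x, y))
    fun a b h => (Prod.ext_iff.1 h).2
  simpa [Function.comp_def, energyTerm, sq] using this

lemma summable_row_abs (u : NeumannSpace m G) (x : X) :
    Summable fun y => G.b x y * |u x - u y| := by
  refine Summable.of_nonneg_of_le (fun y => mul_nonneg (G.nonneg _ _) (abs_nonneg _)) (fun y => ?_)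
    ((G.summable x).add (summable_row_sq u x))
  rw [← mul_one_add]
  refine mul_le_mul_of_nonneg_left ?_ (G.nonneg _ _)
  rw [← sq_abs]
  nlinarith [sq_nonneg (|u x - u y| - 1), abs_nonneg (u x - u y)]

lemma summable_row (u : NeumannSpace m G) (x : X) :
    Summable fun y => G.b x y * (u x - u y) := by
  refine (summable_row_abs u x).of_norm_bounded fun y => ?_
  rw [Real.norm_eq_abs, abs_mul, abs_of_nonneg (G.nonneg _ _)]

lemma summable_row_mul_abs (u : NeumannSpace m G) (x : X) :
    Summable fun y => G.b x y * |u y| := by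
  refine Summable.of_nonneg_of_le (fun y => mul_nonneg (G.nonneg _ _) (abs_nonneg _)) (fun y => ?_)
    (((G.summable x).mul_right |u x|).add (summable_row_abs u x))
  rw [← mul_add]
  refine mul_le_mul_of_nonneg_left ?_ (G.nonneg _ _)
  have := abs_sub_abs_le_abs_sub (u y) (u x)
  rw [abs_sub_comm] at this
  linarith

/-- The indicator function of a vertex as an element of `D(Q^(N))`. -/
def neumannDelta (m : X → Ioi (0 : ℝ)) (G : WGraph X) (x : X) : NeumannSpace m G :=
  (neumannForm m G).toSpace ⟨delta m x, delta_mem_neumannDom x⟩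

lemma toEll2_neumannDelta (x : X) : toEll2 (neumannDelta m G x) = delta m x := rfl

lemma neumannDelta_mem_dirichletSubspace (x : X) : neumannDelta m G x ∈ dirichletSubspace m G :=
  mem_dirichletSubspace_of_finSupp (delta_mem_finSupp x)

lemma inner_neumannDelta (u : NeumannSpace m G) (x : X) :
    inner ℝ u (neumannDelta m G x) = ∑' y, G.b x y * (u x - u y) + m x * u x := by
  rw [neumann_inner, toEll2_neumannDelta, inner_delta,
    (hasSum_energyTerm_delta (summable_row u x).hasSum).tsum_eq]
  ring

lemma mem_dirichletSubspace_orthogonal_iff {u : NeumannSpace m G} :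
    u ∈ (dirichletSubspace m G)ᗮ ↔ ∀ x, inner ℝ u (neumannDelta m G x) = 0 := by
  refine ⟨fun h x =>
    Submodule.inner_left_of_mem_orthogonal (neumannDelta_mem_dirichletSubspace x) h, fun h => ?_⟩
  rw [dirichletSubspace, Submodule.orthogonal_closure, Submodule.mem_orthogonal']
  intro g hg
  have hfin : (Function.support (toEll2 g : X → ℝ)).Finite := hg
  have hsum : g = ∑ x ∈ hfin.toFinset, g x • neumannDelta m G x := by
    apply toEll2_injective
    simp only [map_sum, map_smul]
    exact eq_sum_delta fun x hx => by simpa using hx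
  rw [hsum, inner_sum]
  refine Finset.sum_eq_zero fun x _ => ?_
  rw [real_inner_smul_right, h, mul_zero]

lemma isHarmonic_iff {u : NeumannSpace m G} :
    IsHarmonic m G (toEll2 u) ↔ u ∈ (dirichletSubspace m G)ᗮ := by
  have hequation (x : X) : (1 / (m x : ℝ)) * ∑' y, G.b x y * (u x - u y) + u x = 0 ↔
      inner ℝ u (neumannDelta m G x) = 0 := by
    have hm := weight_pos m x
    rw [inner_neumannDelta, ← mul_right_inj' hm.ne', mul_zero]
    field_simp
  rw [mem_dirichletSubspace_orthogonal_iff]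
  exact ⟨fun h x => (hequation x).1 (h.2 x),
    fun h => ⟨summable_row_mul_abs u, fun x => (hequation x).2 (h x)⟩⟩

/-- The harmonic part of `f ∈ D(Q^(N))`: its orthogonal projection to the complement of
`D(Q^(D))`. -/
def harmonicPart : NeumannSpace m G →L[ℝ] NeumannSpace m G :=
  (dirichletSubspace m G)ᗮ.starProjection

lemma harmonicPart_mem (f : NeumannSpace m G) : harmonicPart f ∈ (dirichletSubspace m G)ᗮ :=
  Submodule.starProjection_apply_mem _ f

lemma sub_harmonicPart_mem (f : NeumannSpace m G) :
    f - harmonicPart f ∈ dirichletSubspace m G := by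
  have hmem := Submodule.sub_starProjection_mem_orthogonal (K := (dirichletSubspace m G)ᗮ) f
  rwa [Submodule.orthogonal_orthogonal] at hmem

lemma harmonicPart_eq {f u : NeumannSpace m G} (hu : u ∈ (dirichletSubspace m G)ᗮ)
    (h : f - u ∈ dirichletSubspace m G) : harmonicPart f = u := by
  have horth : harmonicPart f - u ∈ (dirichletSubspace m G)ᗮ :=
    Submodule.sub_mem _ (harmonicPart_mem f) hu
  have hmem : harmonicPart f - u ∈ dirichletSubspace m G := by
    simpa using Submodule.sub_mem _ h (sub_harmonicPart_mem f)
  exact sub_eq_zero.1 (inner_self_eq_zero.1 (Submodule.inner_right_of_mem_orthogonal hmem horth))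

lemma harmonicPart_eq_self {u : NeumannSpace m G} (hu : u ∈ (dirichletSubspace m G)ᗮ) :
    harmonicPart u = u :=
  harmonicPart_eq hu (by simp)

lemma harmonicPart_eq_zero_iff {f : NeumannSpace m G} :
    harmonicPart f = 0 ↔ f ∈ dirichletSubspace m G :=
  ⟨fun h => by simpa [h] using sub_harmonicPart_mem f,
    fun h => harmonicPart_eq (Submodule.zero_mem _) (by simpa using h)⟩

lemma norm_harmonicPart_le (f : NeumannSpace m G) : ‖harmonicPart f‖ ≤ ‖f‖ :=
  Submodule.norm_starProjection_apply_le _ f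

lemma mem_dirichletSubspace_of_bounded {u : ℕ → NeumannSpace m G} {f : NeumannSpace m G} {K : ℝ}
    (hK : ∀ n, ‖u n‖ ≤ K) (hmem : ∀ n, u n ∈ dirichletSubspace m G)
    (hu : Tendsto (fun n => toEll2 (u n)) atTop (𝓝 (toEll2 f))) : f ∈ dirichletSubspace m G :=
  mem_of_bounded_of_tendsto (neumannForm m G).incl_injective hK hu isClosed_dirichletSubspace hmem

lemma sq_clamp_sub_clamp_le (t t' s s' : ℝ) :
    (clamp (-|s|) |s| t - clamp (-|s'|) |s'| t') ^ 2 ≤ (t - t') ^ 2 + (s - s') ^ 2 := by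
  have habs : |(|s| - |s'|)| ≤ |s - s'| := abs_abs_sub_abs_le s s'
  have hneg : |(-|s|) - (-|s'|)| ≤ |s - s'| := by rwa [neg_sub_neg, abs_sub_comm]
  have hmax : |clamp (-|s|) |s| t - clamp (-|s'|) |s'| t'| ≤ max |t - t'| |s - s'| :=
    (abs_max_sub_max_le_max _ _ _ _).trans <| max_le (hneg.trans (le_max_right _ _)) <|
      (abs_min_sub_min_le_max _ _ _ _).trans (max_le_max le_rfl habs)
  rcases le_max_iff.1 hmax with h | h
  · linarith [sq_le_sq.2 h, sq_nonneg (s - s')]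
  · linarith [sq_le_sq.2 h, sq_nonneg (t - t')]

lemma abs_clamp_abs_le (s t : ℝ) : |clamp (-|s|) |s| t| ≤ |t| :=
  abs_le_of_lipschitz (lipschitz_clamp _ _)
    (clamp_eq_self (neg_nonpos.2 (abs_nonneg s)) (abs_nonneg s)) t

lemma exists_neumann_clamp (f g : NeumannSpace m G) :
    ∃ v : NeumannSpace m G, (∀ x, v x = clamp (-|g x|) |g x| (f x)) ∧
      ‖v‖ ^ 2 ≤ 2 * ‖f‖ ^ 2 + ‖g‖ ^ 2 := by
  have hsq (x y : X) : (clamp (-|g x|) |g x| (f x) - clamp (-|g y|) |g y| (f y)) ^ 2 ≤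
      1 * (f x - f y) ^ 2 + 1 * (g x - g y) ^ 2 := by
    simpa only [one_mul] using sq_clamp_sub_clamp_le (f x) (f y) (g x) (g y)
  obtain ⟨v, hv⟩ := exists_neumann_of_sq_le f g (K := 1)
    (fun x => (abs_clamp_abs_le _ _).trans_eq (one_mul _).symm) hsq
  refine ⟨v, hv, ?_⟩
  simp only [← hv] at hsq
  linarith [neumann_norm_sq_le_of_sq_le zero_le_one zero_le_one
    (fun x => (hv x).symm ▸ abs_clamp_abs_le (g x) (f x)) hsq]

lemma mem_dirichletSubspace_of_abs_le {f g : NeumannSpace m G} (hg : g ∈ dirichletSubspace m G)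
    (hfg : ∀ x, |f x| ≤ |g x|) : f ∈ dirichletSubspace m G := by
  obtain ⟨u, hu, hlim⟩ := mem_closure_iff_seq_limit.1 (show g ∈ closure _ from hg)
  choose v hv hvnorm using fun n => exists_neumann_clamp f (u n)
  obtain ⟨K, hK⟩ := hlim.norm.bddAbove_range
  refine mem_dirichletSubspace_of_bounded (u := v) (K := √(2 * ‖f‖ ^ 2 + K ^ 2)) (fun n => ?_)
    (fun n => ?_) ?_
  · have hun : ‖u n‖ ≤ K := hK ⟨n, rfl⟩
    exact Real.le_sqrt_of_sq_le ((hvnorm n).trans (by gcongr))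
  · refine mem_dirichletSubspace_of_finSupp (Set.Finite.subset (hu n) fun x hx => ?_)
    contrapose! hx
    simp [hv, show u n x = 0 by simpa using hx, clamp]
  · refine ell2_tendsto_of_dominated (g := toEll2 f) (fun n x => ?_) (fun x => le_rfl) (fun x => ?_)
    · rw [hv]
      exact abs_clamp_abs_le _ _
    · have hux : Tendsto (fun n => u n x) atTop (𝓝 (g x)) :=
        tendsto_apply ((toEll2 (m := m) (G := G)).continuous.continuousAt.tendsto.comp hlim) x
      have hclamp := hux.abs.neg.max ((tendsto_const_nhds (x := f x)).min hux.abs)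
      rw [← clamp, clamp_eq_self (abs_le.1 (hfg x)).1 (abs_le.1 (hfg x)).2] at hclamp
      exact hclamp.congr fun n => (hv n x).symm

lemma neumannComp_mem_dirichletSubspace {C : ℝ → ℝ} (hC : LipschitzWith 1 C) (h0 : C 0 = 0)
    {f : NeumannSpace m G} (hf : f ∈ dirichletSubspace m G) :
    neumannComp hC h0 f ∈ dirichletSubspace m G :=
  mem_dirichletSubspace_of_abs_le hf fun x => by
    rw [neumannComp_apply]
    exact abs_le_of_lipschitz hC h0 _

end DirichletSubspace

/-! ### Resolvents of Markovian forms -/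

section Markovian

namespace Form.IsMarkovian

variable {α : Type*} [MeasurableSpace α] {μ : Measure α} {Q : Form (Lp ℝ 2 μ)}

lemma comp_mem (h : Q.IsMarkovian) {C : ℝ → ℝ} (hC : LipschitzWith 1 C) (h0 : C 0 = 0)
    (f : Q.dom) : hC.compLp h0 (f : Lp ℝ 2 μ) ∈ Q.dom := by
  rw [Q.mem_dom_iff]
  exact ((h C hC h0 f).trans_lt (lt_top_iff_ne_top.2 (Q.mem_dom_iff.1 f.2))).ne

/-- The composition of a function in the domain of a Markovian form with a normal contraction. -/
def comp (h : Q.IsMarkovian) {C : ℝ → ℝ} (hC : LipschitzWith 1 C) (h0 : C 0 = 0)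
    (f : Q.dom) : Q.dom := ⟨hC.compLp h0 (f : Lp ℝ 2 μ), h.comp_mem hC h0 f⟩

lemma bilin_comp_le (h : Q.IsMarkovian) {C : ℝ → ℝ} (hC : LipschitzWith 1 C) (h0 : C 0 = 0)
    (f : Q.dom) : Q.bilin (h.comp hC h0 f) (h.comp hC h0 f) ≤ Q.bilin f f := by
  have hval : Q.val (h.comp hC h0 f) ≤ Q.val f := h C hC h0 f
  rw [Q.val_of_mem f, Q.val_of_mem (h.comp hC h0 f)] at hval
  exact (ENNReal.ofReal_le_ofReal_iff (Q.nonneg f)).1 hval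

lemma scale (h : Q.IsMarkovian) (s : ℝ≥0) : (Q.scale s).IsMarkovian := by
  intro C hC h0 f
  by_cases hf : f ∈ Q.dom
  · rw [(Q.scale s).val_of_mem ⟨f, hf⟩, (Q.scale s).val_of_mem ⟨_, h.comp_mem hC h0 ⟨f, hf⟩⟩]
    exact ENNReal.ofReal_le_ofReal
      (mul_le_mul_of_nonneg_left (h.bilin_comp_le hC h0 ⟨f, hf⟩) s.2)
  · rw [(Q.scale s).val_of_notMem hf]
    exact le_top

end Form.IsMarkovian

end Markovian

section Resolvent

namespace Form

variable {E : Type*} [NormedAddCommGroup E] [InnerProductSpace ℝ E] [CompleteSpace E]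

/-- The resolvent `(1 + L)⁻¹` of the operator `L` associated with a closed form. -/
def resolvent (R : Form E) [CompleteSpace R.Space] : E →L[ℝ] E :=
  R.incl ∘L ContinuousLinearMap.adjoint R.incl

/-- The function `(1 + L)⁻¹ f` as an element of the domain of the form. -/
def resolventDom (R : Form E) [CompleteSpace R.Space] (f : E) : R.dom :=
  R.toSpace.symm (ContinuousLinearMap.adjoint R.incl f)

variable (R : Form E) [CompleteSpace R.Space]

lemma coe_resolventDom (f : E) : (R.resolventDom f : E) = R.resolvent f := rfl

lemma inner_resolvent_comm (f g : E) :
    inner ℝ (R.resolvent f) g = inner ℝ f (R.resolvent g) := by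
  rw [resolvent, ContinuousLinearMap.comp_apply, ContinuousLinearMap.comp_apply,
    ← ContinuousLinearMap.adjoint_inner_left, ← ContinuousLinearMap.adjoint_inner_right]

lemma bilin_resolventDom (f : E) (g : R.dom) :
    R.bilin (R.resolventDom f) g = inner ℝ (f - R.resolvent f) (g : E) := by
  have hadjoint : inner ℝ (R.toSpace (R.resolventDom f)) (R.toSpace g) = inner ℝ f (g : E) :=
    ContinuousLinearMap.adjoint_inner_left R.incl (R.toSpace g) f
  rw [inner_toSpace, coe_resolventDom] at hadjoint
  rw [inner_sub_left]
  linarith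

lemma bilin_self_add_norm_sub_sq (f : E) (u : R.dom) :
    R.bilin u u + ‖(u : E) - f‖ ^ 2 =
      R.bilin (R.resolventDom f) (R.resolventDom f) + ‖R.resolvent f - f‖ ^ 2 +
        R.bilin (u - R.resolventDom f) (u - R.resolventDom f) + ‖(u : E) - R.resolvent f‖ ^ 2 := by
  have hbilin := R.bilin_resolventDom f (u - R.resolventDom f)
  rw [Submodule.coe_sub, coe_resolventDom, ← neg_sub (R.resolvent f) f, inner_neg_left] at hbilin
  have hsplit : (u : E) - f = (R.resolvent f - f) + ((u : E) - R.resolvent f) := by abel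
  rw [hsplit, norm_add_sq_real]
  simp only [map_sub, LinearMap.sub_apply] at hbilin ⊢
  rw [R.symm u (R.resolventDom f)]
  linarith

end Form

lemma Form.IsMarkovian.comp_resolvent {α : Type*} [MeasurableSpace α] {μ : Measure α}
    {R : Form (Lp ℝ 2 μ)} [CompleteSpace R.Space] (hR : R.IsMarkovian) {C : ℝ → ℝ}
    (hC : LipschitzWith 1 C) (h0 : C 0 = 0) {f : Lp ℝ 2 μ} (hf : hC.compLp h0 f = f) :
    hC.compLp h0 (R.resolvent f) = R.resolvent f := by
  let u : R.dom := hR.comp hC h0 (R.resolventDom f)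
  have hnorm : ‖(u : Lp ℝ 2 μ) - f‖ ^ 2 ≤ ‖R.resolvent f - f‖ ^ 2 := by
    have hle : ‖(u : Lp ℝ 2 μ) - hC.compLp h0 f‖ ≤ 1 * ‖R.resolvent f - f‖ :=
      hC.norm_compLp_sub_le h0 _ _
    rw [hf, one_mul] at hle
    gcongr
  -- `(1 + L)⁻¹ f` is the unique minimizer of `u ↦ R(u) + ‖u - f‖²`.
  have hzero : ‖(u : Lp ℝ 2 μ) - R.resolvent f‖ ^ 2 ≤ 0 := by
    linarith [R.bilin_self_add_norm_sub_sq f u, R.nonneg (u - R.resolventDom f),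
      hR.bilin_comp_le hC h0 (R.resolventDom f)]
  exact sub_eq_zero.1 (norm_eq_zero.1 (sq_eq_zero_iff.1 (hzero.antisymm (sq_nonneg _))))

end Resolvent

section Kernel

lemma sum_symm_mul_sub_sq {X : Type*} {k : X → X → ℝ} (hk : ∀ x y, k x y = k y x)
    (s : Finset X) (f : X → ℝ) :
    ∑ p ∈ s ×ˢ s, k p.1 p.2 * (f p.1 - f p.2) ^ 2 =
      2 * ∑ x ∈ s, (∑ y ∈ s, k x y) * f x ^ 2 -
        2 * ∑ x ∈ s, ∑ y ∈ s, k x y * (f x * f y) := by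
  have hswap : ∑ x ∈ s, ∑ y ∈ s, k x y * f y ^ 2 = ∑ x ∈ s, ∑ y ∈ s, k x y * f x ^ 2 := by
    rw [Finset.sum_comm]
    simp only [hk]
  have hexpand (x y : X) : k x y * (f x - f y) ^ 2 =
      k x y * f x ^ 2 + k x y * f y ^ 2 - 2 * (k x y * (f x * f y)) := by ring
  simp only [Finset.sum_product, hexpand, Finset.sum_sub_distrib, Finset.sum_add_distrib, hswap,
    Finset.sum_mul, ← Finset.mul_sum]
  ring

variable {X : Type*} [MeasurableSpace X] [DiscreteMeasurableSpace X] {m : X → Ioi (0 : ℝ)}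
  {R : Form (ell2 m)} [CompleteSpace R.Space]

lemma Form.IsMarkovian.resolvent_mem_Icc (hR : R.IsMarkovian) {f : ell2 m}
    (hf : ∀ x, f x ∈ Icc (0 : ℝ) 1) (x : X) : R.resolvent f x ∈ Icc (0 : ℝ) 1 := by
  have h0 : clamp 0 1 0 = 0 := clamp_eq_self le_rfl zero_le_one
  have hfix : (lipschitz_clamp 0 1).compLp h0 f = f := ell2_ext fun x => by
    rw [ell2_comp_apply, clamp_eq_self (hf x).1 (hf x).2]
  rw [← hR.comp_resolvent (lipschitz_clamp 0 1) h0 hfix, ell2_comp_apply]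
  exact clamp_mem_Icc zero_le_one _

variable (R) in
/-- The kernel of the resolvent with respect to the counting measure. -/
def Form.kernel (x y : X) : ℝ := inner ℝ (R.resolvent (delta m x)) (delta m y)

lemma Form.kernel_symm (x y : X) : R.kernel x y = R.kernel y x := by
  rw [Form.kernel, Form.kernel, R.inner_resolvent_comm, real_inner_comm]

lemma Form.IsMarkovian.kernel_nonneg (hR : R.IsMarkovian) (x y : X) : 0 ≤ R.kernel x y := by
  classical
  rw [Form.kernel, inner_delta]
  refine mul_nonneg (weight_pos m y).le (hR.resolvent_mem_Icc (fun z => ?_) y).1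
  rw [delta_apply]
  split_ifs <;> simp

lemma Form.IsMarkovian.sum_kernel_le (hR : R.IsMarkovian) (x : X) (s : Finset X) :
    ∑ y ∈ s, R.kernel x y ≤ m x := by
  classical
  obtain ⟨e, he⟩ : ∃ e : ell2 m, ∀ y, e y = if y ∈ s then 1 else 0 :=
    exists_ell2 (summable_of_ne_finset_zero (s := s) fun y hy => by simp [hy])
  have hsum : ∑ y ∈ s, R.kernel x y = inner ℝ (R.resolvent (delta m x)) e := by
    rw [eq_sum_delta (f := e) (s := s) fun y hy => by simp [he, hy], inner_sum]
    refine Finset.sum_congr rfl fun y hy => ?_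
    rw [he, if_pos hy, one_smul, Form.kernel]
  rw [hsum, R.inner_resolvent_comm, real_inner_comm, inner_delta]
  refine mul_le_of_le_one_right (weight_pos m x).le (hR.resolvent_mem_Icc (fun z => ?_) x).2
  rw [he]
  split_ifs <;> simp

lemma Form.inner_sub_resolvent_of_finite {f : ell2 m} {s : Finset X} (hs : ∀ x ∉ s, f x = 0) :
    inner ℝ (f - R.resolvent f) f =
      1 / 2 * ∑ p ∈ s ×ˢ s, R.kernel p.1 p.2 * (f p.1 - f p.2) ^ 2 +
        ∑ x ∈ s, (m x - ∑ y ∈ s, R.kernel x y) * f x ^ 2 := by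
  have hf := eq_sum_delta hs
  have hinner (g : ell2 m) : inner ℝ g f = ∑ x ∈ s, f x * inner ℝ g (delta m x) := by
    nth_rewrite 1 [hf]
    simp only [inner_sum, real_inner_smul_right]
  have hnorm : inner ℝ f f = ∑ x ∈ s, m x * f x ^ 2 := by
    rw [hinner]
    refine Finset.sum_congr rfl fun x _ => ?_
    rw [inner_delta]
    ring
  have hkernel : inner ℝ (R.resolvent f) f = ∑ x ∈ s, ∑ y ∈ s, R.kernel x y * (f x * f y) := by
    rw [R.inner_resolvent_comm, real_inner_comm, hinner]
    refine Finset.sum_congr rfl fun x _ => ?_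
    rw [R.inner_resolvent_comm, real_inner_comm, hinner, Finset.mul_sum]
    refine Finset.sum_congr rfl fun y _ => ?_
    rw [Form.kernel]
    ring
  rw [inner_sub_left, hnorm, hkernel, sum_symm_mul_sub_sq Form.kernel_symm]
  simp only [sub_mul, Finset.sum_sub_distrib]
  ring

variable (R) in
/-- What remains of `⟪f - (1 + L)⁻¹ f, f⟫` after removing the energy of the pairs of vertices
in `t`. -/
def Form.resolventDefect (t : Finset (X × X)) (f : ell2 m) : ℝ :=
  inner ℝ (f - R.resolvent f) f - 1 / 2 * ∑ p ∈ t, R.kernel p.1 p.2 * (f p.1 - f p.2) ^ 2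

lemma Form.continuous_resolventDefect (t : Finset (X × X)) :
    Continuous (R.resolventDefect t) := by
  have happly (x : X) : Continuous fun f : ell2 m => f x :=
    continuous_iff_continuousAt.2 fun f => tendsto_apply tendsto_id x
  unfold Form.resolventDefect
  fun_prop

open Classical in
lemma Form.resolventDefect_of_finite {f : ell2 m} {s : Finset X} (hs : ∀ x ∉ s, f x = 0)
    {t : Finset (X × X)} (ht : t ⊆ s ×ˢ s) :
    R.resolventDefect t f =
      1 / 2 * ∑ p ∈ (s ×ˢ s) \ t, R.kernel p.1 p.2 * (f p.1 - f p.2) ^ 2 +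
        ∑ x ∈ s, (m x - ∑ y ∈ s, R.kernel x y) * f x ^ 2 := by
  rw [Form.resolventDefect, R.inner_sub_resolvent_of_finite hs, ← Finset.sum_sdiff ht]
  ring

lemma Form.IsMarkovian.resolventDefect_comp_le (hR : R.IsMarkovian) {C : ℝ → ℝ}
    (hC : LipschitzWith 1 C) (h0 : C 0 = 0) (t : Finset (X × X)) (f : ell2 m) :
    R.resolventDefect t (hC.compLp h0 f) ≤ R.resolventDefect t f := by
  classical
  refine (dense_finSupp m).induction (P := fun f =>
    R.resolventDefect t (hC.compLp h0 f) ≤ R.resolventDefect t f) (fun f hf => ?_)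
    (isClosed_le ((R.continuous_resolventDefect t).comp (hC.continuous_compLp h0))
      (R.continuous_resolventDefect t)) f
  have hfin : (Function.support (f : X → ℝ)).Finite := hf
  let s := hfin.toFinset ∪ (t.image Prod.fst ∪ t.image Prod.snd)
  have hs (x : X) (hx : x ∉ s) : f x = 0 := by
    simp only [s, Finset.mem_union, not_or] at hx
    simpa using hx.1
  have hCs (x : X) (hx : x ∉ s) : (hC.compLp h0 f : ell2 m) x = 0 := by
    rw [ell2_comp_apply, hs x hx, h0]
  have ht : t ⊆ s ×ˢ s := fun p hp => Finset.mem_product.2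
    ⟨Finset.mem_union_right _ (Finset.mem_union_left _ (Finset.mem_image_of_mem _ hp)),
      Finset.mem_union_right _ (Finset.mem_union_right _ (Finset.mem_image_of_mem _ hp))⟩
  rw [R.resolventDefect_of_finite hs ht, R.resolventDefect_of_finite hCs ht]
  simp only [ell2_comp_apply hC h0 f]
  refine add_le_add (mul_le_mul_of_nonneg_left (Finset.sum_le_sum fun p _ => ?_) (by norm_num))
    (Finset.sum_le_sum fun x _ => ?_)
  · exact mul_le_mul_of_nonneg_left (sq_sub_le_of_lipschitz hC _ _) (hR.kernel_nonneg _ _)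
  · exact mul_le_mul_of_nonneg_left (sq_le_sq.2 (abs_le_of_lipschitz hC h0 _))
      (sub_nonneg.2 (hR.sum_kernel_le x s))

end Kernel

section Approximation

/-- The null sequence `1/(n+1)` of positive parameters used in approximations. -/
def approxParam (n : ℕ) : ℝ≥0 := 1 / (n + 1)

lemma approxParam_pos (n : ℕ) : 0 < approxParam n := by
  unfold approxParam
  positivity

lemma tendsto_approxParam : Tendsto (fun n => (approxParam n : ℝ)) atTop (𝓝 0) := by
  simpa [approxParam] using tendsto_one_div_add_atTop_nhds_zero_nat (𝕜 := ℝ)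

namespace Form

variable {E : Type*} [NormedAddCommGroup E] [InnerProductSpace ℝ E] [CompleteSpace E]
  {Q : Form E}

instance [CompleteSpace Q.Space] (n : ℕ) : CompleteSpace (Q.scale (approxParam n)).Space :=
  (isClosed_iff_completeSpace _).1
    ((Q.isClosed_iff_completeSpace.2 ‹_›).scale (approxParam_pos n))

variable (Q) in
/-- The approximation `(1 + s L)⁻¹ f` of `f` with `s = 1/(n+1)`. -/
def approx [CompleteSpace Q.Space] (n : ℕ) (f : E) : Q.dom :=
  (Q.scale (approxParam n)).resolventDom f

variable [CompleteSpace Q.Space]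

lemma inner_sub_approx (n : ℕ) (f : E) (g : Q.dom) :
    inner ℝ (f - Q.approx n f) (g : E) = approxParam n * Q.bilin (Q.approx n f) g :=
  ((Q.scale (approxParam n)).bilin_resolventDom f g).symm

lemma bilin_approx_add_norm_sub_sq_le (n : ℕ) (f : Q.dom) :
    approxParam n * Q.bilin (Q.approx n f) (Q.approx n f) + ‖(f : E) - Q.approx n f‖ ^ 2 ≤
      approxParam n * Q.bilin f f := by
  have hvar := (Q.scale (approxParam n)).bilin_self_add_norm_sub_sq f f
  have hnonneg : 0 ≤ (approxParam n : ℝ) * Q.bilin (f - Q.approx n f) (f - Q.approx n f) :=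
    mul_nonneg (approxParam n).2 (Q.nonneg _)
  have hnorm := sq_nonneg ‖(Q.approx n f : E) - f‖
  rw [sub_self, norm_zero, zero_pow two_ne_zero, add_zero] at hvar
  change approxParam n * Q.bilin f f = approxParam n * Q.bilin (Q.approx n f) (Q.approx n f) +
    ‖(Q.approx n f : E) - f‖ ^ 2 + approxParam n * Q.bilin (f - Q.approx n f) (f - Q.approx n f) +
    ‖(f : E) - Q.approx n f‖ ^ 2 at hvar
  linarith

lemma bilin_approx_le (n : ℕ) (f : Q.dom) :
    Q.bilin (Q.approx n f) (Q.approx n f) ≤ Q.bilin f f := by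
  have hnorm : 0 ≤ ‖(f : E) - Q.approx n f‖ ^ 2 := sq_nonneg _
  exact le_of_mul_le_mul_left (by linarith [bilin_approx_add_norm_sub_sq_le n f])
    (NNReal.coe_pos.2 (approxParam_pos n))

lemma norm_sub_approx_sq_le (n : ℕ) (f : Q.dom) :
    ‖(f : E) - Q.approx n f‖ ^ 2 ≤ approxParam n * Q.bilin f f := by
  have hnonneg : 0 ≤ (approxParam n : ℝ) * Q.bilin (Q.approx n f) (Q.approx n f) :=
    mul_nonneg (approxParam n).2 (Q.nonneg _)
  linarith [bilin_approx_add_norm_sub_sq_le n f]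

lemma tendsto_coe_approx (f : Q.dom) :
    Tendsto (fun n => (Q.approx n f : E)) atTop (𝓝 (f : E)) := by
  have hlim : Tendsto (fun n => √(approxParam n * Q.bilin f f)) atTop (𝓝 0) := by
    simpa using (tendsto_approxParam.mul_const (Q.bilin f f)).sqrt
  refine tendsto_iff_norm_sub_tendsto_zero.2 (squeeze_zero (fun _ => norm_nonneg _) (fun n => ?_)
    hlim)
  rw [norm_sub_rev]
  exact Real.le_sqrt_of_sq_le (norm_sub_approx_sq_le n f)

lemma tendsto_bilin_approx (f g : Q.dom) :
    Tendsto (fun n => Q.bilin (Q.approx n f) g) atTop (𝓝 (Q.bilin f g)) := by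
  have hlim := tendsto_coe_approx f
  obtain ⟨K, hK⟩ := hlim.norm.bddAbove_range
  have hbound (n : ℕ) : ‖Q.toSpace (Q.approx n f)‖ ≤ √(Q.bilin f f + K ^ 2) := by
    have hnorm : ‖(Q.approx n f : E)‖ ≤ K := hK ⟨n, rfl⟩
    refine Real.le_sqrt_of_sq_le ?_
    rw [Q.norm_sq_toSpace]
    exact add_le_add (bilin_approx_le n f) (by gcongr)
  have hweak := tendsto_inner_of_bounded Q.incl_injective hbound (f := Q.toSpace f) hlim
    (Q.toSpace g)
  simpa only [inner_toSpace, add_sub_cancel_right] using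
    hweak.sub (hlim.inner (tendsto_const_nhds (x := (g : E))))

lemma tendsto_inner_sub_resolvent (f g : Q.dom) :
    Tendsto (fun n => (approxParam n : ℝ)⁻¹ *
      inner ℝ ((f : E) - (Q.scale (approxParam n)).resolvent f) (g : E))
      atTop (𝓝 (Q.bilin f g)) := by
  refine (tendsto_bilin_approx f g).congr fun n => ?_
  rw [← coe_resolventDom]
  change _ = (approxParam n : ℝ)⁻¹ * inner ℝ ((f : E) - Q.approx n f) (g : E)
  rw [inner_sub_approx, inv_mul_cancel_left₀ (NNReal.coe_ne_zero.2 (approxParam_pos n).ne')]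

end Form

end Approximation

section DirichletExtension

variable {X : Type*} [MeasurableSpace X] [DiscreteMeasurableSpace X] {m : X → Ioi (0 : ℝ)}
  {Q : Form (ell2 m)} {G : WGraph X}

lemma delta_mem_dirichletDom (x : X) : delta m x ∈ (dirichletForm m G).dom := by
  rw [← toEll2_neumannDelta (G := G)]
  exact mem_dirichletSubspace_iff.1 (neumannDelta_mem_dirichletSubspace x)

lemma bilin_delta_of_extends (h : Q.Extends (dirichletForm m G)) (hd : finSupp m ≤ Q.dom)
    {x y : X} (hxy : x ≠ y) :
    Q.bilin ⟨delta m x, hd (delta_mem_finSupp x)⟩ ⟨delta m y, hd (delta_mem_finSupp y)⟩ =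
      -G.b x y := by
  obtain ⟨_, hbilin⟩ := h
  have henergy :
      Q.bilin ⟨delta m y, hd (delta_mem_finSupp y)⟩ ⟨delta m x, hd (delta_mem_finSupp x)⟩ =
        1 / 2 * ∑' p, energyTerm G (delta m y) (delta m x) p :=
    hbilin ⟨_, delta_mem_dirichletDom y⟩ ⟨_, delta_mem_dirichletDom x⟩
  have hrow : HasSum (fun z => G.b x z * (delta m y x - delta m y z)) (-G.b x y) := by
    simpa [delta_of_ne hxy, delta_self] using
      hasSum_single (f := fun z => G.b x z * (delta m y x - delta m y z)) y fun z hz => by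
        rw [delta_of_ne hz, delta_of_ne hxy, sub_self, mul_zero]
  rw [Q.symm, henergy, (hasSum_energyTerm_delta hrow).tsum_eq]
  ring

lemma graph_unique {G' : WGraph X} (hd : finSupp m ≤ Q.dom) (h : Q.Extends (dirichletForm m G))
    (h' : Q.Extends (dirichletForm m G')) : G = G' := by
  have hb : G.b = G'.b := by
    funext x y
    by_cases hxy : x = y
    · rw [hxy, G.diag, G'.diag]
    · exact neg_injective
        ((bilin_delta_of_extends h hd hxy).symm.trans (bilin_delta_of_extends h' hd hxy))
  cases G
  cases G'
  cases hb
  rfl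

lemma tendsto_kernel_of_extends [CompleteSpace Q.Space] (hd : finSupp m ≤ Q.dom)
    (h : Q.Extends (dirichletForm m G)) {x y : X} (hxy : x ≠ y) :
    Tendsto (fun n => (approxParam n : ℝ)⁻¹ * (Q.scale (approxParam n)).kernel x y) atTop
      (𝓝 (G.b x y)) := by
  have hlim := (Form.tendsto_inner_sub_resolvent (⟨delta m x, hd (delta_mem_finSupp x)⟩ : Q.dom)
    ⟨delta m y, hd (delta_mem_finSupp y)⟩).neg
  rw [bilin_delta_of_extends h hd hxy, neg_neg] at hlim
  refine hlim.congr fun n => ?_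
  rw [inner_sub_left, inner_delta, delta_of_ne hxy.symm, Form.kernel]
  ring

lemma tendsto_resolventDefect [CompleteSpace Q.Space] (hd : finSupp m ≤ Q.dom)
    (h : Q.Extends (dirichletForm m G)) (t : Finset (X × X)) (f : Q.dom) :
    Tendsto (fun n => (approxParam n : ℝ)⁻¹ *
      (Q.scale (approxParam n)).resolventDefect t (f : ell2 m)) atTop
      (𝓝 (Q.bilin f f - 1 / 2 * ∑ p ∈ t, energyTerm G (f : ell2 m) (f : ell2 m) p)) := by
  have hsum : Tendsto (fun n => 1 / 2 * ∑ p ∈ t, ((approxParam n : ℝ)⁻¹ *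
      (Q.scale (approxParam n)).kernel p.1 p.2) * ((f : ell2 m) p.1 - (f : ell2 m) p.2) ^ 2) atTop
      (𝓝 (1 / 2 * ∑ p ∈ t, energyTerm G (f : ell2 m) (f : ell2 m) p)) := by
    refine (tendsto_finsetSum _ fun p _ => ?_).const_mul _
    by_cases hp : p.1 = p.2
    · simp [energyTerm, hp]
    · simp only [energyTerm, mul_assoc, ← sq]
      simpa only [mul_assoc] using (tendsto_kernel_of_extends hd h hp).mul_const
        (((f : ell2 m) p.1 - (f : ell2 m) p.2) ^ 2)
  refine ((Form.tendsto_inner_sub_resolvent f f).sub hsum).congr fun n => ?_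
  rw [Form.resolventDefect, mul_sub, mul_left_comm _ (1 / 2 : ℝ), Finset.mul_sum _ _ (_⁻¹)]
  simp only [mul_assoc]

variable (hQ : Q.IsClosed) (hM : Q.IsMarkovian) (hd : finSupp m ≤ Q.dom)
  (h : Q.Extends (dirichletForm m G))
include hQ hd h

lemma sub_sum_energyTerm_comp_le {C : ℝ → ℝ} (hC : LipschitzWith 1 C) (h0 : C 0 = 0)
    (f : Q.dom) (t : Finset (X × X)) :
    Q.bilin (hM.comp hC h0 f) (hM.comp hC h0 f) -
        1 / 2 * ∑ p ∈ t, energyTerm G (hM.comp hC h0 f : ell2 m) (hM.comp hC h0 f : ell2 m) p ≤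
      Q.bilin f f - 1 / 2 * ∑ p ∈ t, energyTerm G (f : ell2 m) (f : ell2 m) p := by
  have : CompleteSpace Q.Space := Q.isClosed_iff_completeSpace.1 hQ
  refine le_of_tendsto_of_tendsto' (tendsto_resolventDefect hd h t (hM.comp hC h0 f))
    (tendsto_resolventDefect hd h t f) fun n => ?_
  exact mul_le_mul_of_nonneg_left ((hM.scale (approxParam n)).resolventDefect_comp_le hC h0 t f)
    (inv_nonneg.2 (approxParam n).2)

include hM

lemma sum_energyTerm_le_of_extends (f : Q.dom) (t : Finset (X × X)) :
    ∑ p ∈ t, energyTerm G (f : ell2 m) (f : ell2 m) p ≤ 2 * Q.bilin f f := by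
  have hconst : LipschitzWith 1 fun _ : ℝ => (0 : ℝ) := LipschitzWith.const' 0
  have hle := sub_sum_energyTerm_comp_le hQ hM hd h hconst rfl f t
  have hzero (x : X) : (hM.comp hconst rfl f : ell2 m) x = 0 := ell2_comp_apply hconst rfl _ x
  simp only [energyTerm, hzero, sub_self, mul_zero, Finset.sum_const_zero] at hle ⊢
  linarith [Q.nonneg (hM.comp hconst rfl f)]

lemma dom_le_neumann_of_extends : Q.dom ≤ (neumannForm m G).dom := fun f hf =>
  summable_of_sum_le (fun p => energyTerm_self_nonneg _ p)
    (sum_energyTerm_le_of_extends hQ hM hd h ⟨f, hf⟩)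

lemma energy_le_of_extends (f : Q.dom) : energy G (f : ell2 m) ≤ Q.bilin f f := by
  have hle : ∑' p, energyTerm G (f : ell2 m) (f : ell2 m) p ≤ 2 * Q.bilin f f :=
    Summable.tsum_le_of_sum_le (dom_le_neumann_of_extends hQ hM hd h f.2)
      (sum_energyTerm_le_of_extends hQ hM hd h f)
  rw [energy]
  linarith

lemma sub_energy_comp_le {C : ℝ → ℝ} (hC : LipschitzWith 1 C) (h0 : C 0 = 0) (f : Q.dom) :
    Q.bilin (hM.comp hC h0 f) (hM.comp hC h0 f) - energy G (hM.comp hC h0 f : ell2 m) ≤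
      Q.bilin f f - energy G (f : ell2 m) := by
  have hsum (f : Q.dom) : Tendsto (fun t => Q.bilin f f -
      1 / 2 * ∑ p ∈ t, energyTerm G (f : ell2 m) (f : ell2 m) p) atTop
      (𝓝 (Q.bilin f f - energy G (f : ell2 m))) :=
    tendsto_const_nhds.sub
      ((dom_le_neumann_of_extends hQ hM hd h f.2 : Summable _).hasSum.const_mul (1 / 2))
  exact le_of_tendsto_of_tendsto' (hsum _) (hsum _) fun t =>
    sub_sum_energyTerm_comp_le hQ hM hd h hC h0 f t

end DirichletExtension

/-! ### Boundary values and the maximum principle -/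

section RoydenSpace

variable {X : Type*} [MeasurableSpace X] [DiscreteMeasurableSpace X] {m : X → Ioi (0 : ℝ)}
  {G : WGraph X}

instance : T2Space (Royden m G) :=
  inferInstanceAs (T2Space (closure (range fun (x : X) (f : BddDom m G) => (f.1 x : ℝ))))

instance : CompactSpace (Royden m G) := by
  choose K hK using fun f : BddDom m G => f.2.2
  refine isCompact_iff_compactSpace.1 (IsCompact.of_isClosed_subset
    (isCompact_univ_pi fun f => isCompact_Icc (a := -K f) (b := K f)) isClosed_closure
    (closure_minimal ?_ (isClosed_set_pi fun f _ => isClosed_Icc)))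
  rintro _ ⟨x, rfl⟩ f -
  exact abs_le.1 (hK f x)

lemma continuous_extend (f : BddDom m G) : Continuous (Royden.extend f) :=
  (continuous_apply f).comp continuous_subtype_val

lemma extend_embed (f : BddDom m G) (x : X) : Royden.extend f (Royden.embed m G x) = f.1 x := rfl

lemma denseRange_embed : DenseRange (Royden.embed m G) := by
  intro ξ
  have hval : IsInducing (fun ξ : Royden m G => (ξ.1 : BddDom m G → ℝ)) := ⟨rfl⟩
  rw [hval.closure_eq_preimage_closure_image, mem_preimage, ← range_comp]
  exact ξ.2

/-- The trace on `X` of the neighbourhood filter of a point of `X̂`. -/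
def vertexFilter (ξ : Royden m G) : Filter X := comap (Royden.embed m G) (𝓝 ξ)

instance (ξ : Royden m G) : (vertexFilter ξ).NeBot :=
  comap_neBot fun _ ht => by
    obtain ⟨_, hmem, x, rfl⟩ := mem_closure_iff_nhds.1 (denseRange_embed ξ) _ ht
    exact ⟨x, hmem⟩

lemma tendsto_extend (f : BddDom m G) (ξ : Royden m G) :
    Tendsto (fun x => f.1 x) (vertexFilter ξ) (𝓝 (Royden.extend f ξ)) :=
  ((continuous_extend f).tendsto ξ).comp tendsto_comap

lemma extend_eq_of_tendsto {f : BddDom m G} {ξ : Royden m G} {c : ℝ}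
    (h : Tendsto (fun x => f.1 x) (vertexFilter ξ) (𝓝 c)) : Royden.extend f ξ = c :=
  tendsto_nhds_unique (tendsto_extend f ξ) h

/-- A bounded element of the Hilbert space `D(Q^(N))` as an element of `D(Q^(N)) ∩ ℓ^∞(X)`. -/
def BddDom.ofNeumann (f : NeumannSpace m G) (h : ∃ K : ℝ, ∀ x, |f x| ≤ K) : BddDom m G :=
  ⟨toEll2 f, (neumannForm m G).incl_mem f, h⟩

lemma BddDom.val_ofNeumann (f : NeumannSpace m G) (h : ∃ K : ℝ, ∀ x, |f x| ≤ K) :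
    (BddDom.ofNeumann f h).1 = toEll2 f := rfl

/-- An element of `D(Q^(N)) ∩ ℓ^∞(X)` as an element of the Hilbert space `D(Q^(N))`. -/
def BddDom.toNeumann (f : BddDom m G) : NeumannSpace m G :=
  (neumannForm m G).toSpace ⟨f.1, f.2.1⟩

lemma BddDom.toEll2_toNeumann (f : BddDom m G) : toEll2 f.toNeumann = f.1 := rfl

end RoydenSpace

section Truncation

lemma abs_clamp_le {K : ℝ} (hK : 0 ≤ K) (t : ℝ) : |clamp (-K) K t| ≤ K :=
  abs_le.2 (clamp_mem_Icc (neg_le_self hK) t)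

lemma clamp_eq_self_of_abs_le {K t : ℝ} (h : |t| ≤ K) : clamp (-K) K t = t :=
  clamp_eq_self (abs_le.1 h).1 (abs_le.1 h).2

lemma clamp_neg_self_zero {K : ℝ} (hK : 0 ≤ K) : clamp (-K) K 0 = 0 :=
  clamp_eq_self_of_abs_le (by rwa [abs_zero])

lemma clamp_eq_self_of_abs_clamp_lt {K t : ℝ} (h : |clamp (-K) K t| < K) :
    clamp (-K) K t = t := by
  obtain ⟨hlow, hhigh⟩ := abs_lt.1 h
  unfold clamp at hlow hhigh ⊢
  grind

lemma tendsto_of_tendsto_clamp {α : Type*} {l : Filter α} {f : α → ℝ} {K c : ℝ}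
    (h : Tendsto (fun x => clamp (-K) K (f x)) l (𝓝 c)) (hc : |c| < K) : Tendsto f l (𝓝 c) := by
  refine h.congr' ?_
  filter_upwards [h.abs.eventually (gt_mem_nhds hc)] with x hx
  exact clamp_eq_self_of_abs_clamp_lt hx

/-- Soft thresholding: `t` is moved towards `0` by `ε`, and to `0` if `|t| ≤ ε`. -/
def softThreshold (ε t : ℝ) : ℝ := max (min 0 (t + ε)) (t - ε)

lemma lipschitz_softThreshold (ε : ℝ) : LipschitzWith 1 (softThreshold ε) :=
  (((IsometryEquiv.addRight ε).isometry.lipschitz.const_min 0).max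
    (IsometryEquiv.subRight ε).isometry.lipschitz).weaken (max_self 1).le

lemma softThreshold_eq_zero {ε t : ℝ} (h : |t| ≤ ε) : softThreshold ε t = 0 := by
  obtain ⟨hlow, hhigh⟩ := abs_le.1 h
  rw [softThreshold, min_eq_left (by linarith), max_eq_left (by linarith)]

lemma softThreshold_zero {ε : ℝ} (hε : 0 ≤ ε) : softThreshold ε 0 = 0 :=
  softThreshold_eq_zero (by rwa [abs_zero])

lemma abs_softThreshold_sub_le {ε : ℝ} (hε : 0 ≤ ε) (t : ℝ) : |softThreshold ε t - t| ≤ ε := by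
  rw [softThreshold, abs_le]
  constructor
  · linarith [le_max_right (min 0 (t + ε)) (t - ε)]
  · linarith [max_le (min_le_right 0 (t + ε)) (show t - ε ≤ t + ε by linarith)]

lemma lipschitz_excess (c : ℝ) : LipschitzWith 1 fun t : ℝ => max (t - c) 0 :=
  (IsometryEquiv.subRight c).isometry.lipschitz.max_const 0

lemma monotone_excess (c : ℝ) : Monotone fun t : ℝ => max (t - c) 0 := fun _ _ hst =>
  max_le_max (sub_le_sub_right hst c) le_rfl

variable {X : Type*} [MeasurableSpace X] [DiscreteMeasurableSpace X] {m : X → Ioi (0 : ℝ)}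
  {G : WGraph X}

/-- The truncation of `f ∈ D(Q^(N))` at the levels `±n`. -/
def neumannClamp (n : ℕ) (f : NeumannSpace m G) : NeumannSpace m G :=
  neumannComp (lipschitz_clamp (-n) n) (clamp_neg_self_zero n.cast_nonneg) f

lemma neumannClamp_apply (n : ℕ) (f : NeumannSpace m G) (x : X) :
    neumannClamp n f x = clamp (-n) n (f x) := neumannComp_apply _ _ _ _

lemma abs_neumannClamp_le (n : ℕ) (f : NeumannSpace m G) (x : X) : |neumannClamp n f x| ≤ n := by
  rw [neumannClamp_apply]
  exact abs_clamp_le n.cast_nonneg _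

lemma abs_neumannClamp_le_abs (n : ℕ) (f : NeumannSpace m G) (x : X) :
    |neumannClamp n f x| ≤ |f x| := by
  rw [neumannClamp_apply]
  exact abs_le_of_lipschitz (lipschitz_clamp _ _) (clamp_neg_self_zero n.cast_nonneg) _

lemma norm_neumannClamp_le (n : ℕ) (f : NeumannSpace m G) : ‖neumannClamp n f‖ ≤ ‖f‖ :=
  norm_neumannComp_le _ _ _

lemma neumannClamp_mem_dirichletSubspace (n : ℕ) {f : NeumannSpace m G}
    (hf : f ∈ dirichletSubspace m G) : neumannClamp n f ∈ dirichletSubspace m G :=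
  neumannComp_mem_dirichletSubspace _ _ hf

/-- The truncation of `f ∈ D(Q^(N))` at the levels `±n` as an element of
`D(Q^(N)) ∩ ℓ^∞(X)`. -/
def bddClamp (n : ℕ) (f : NeumannSpace m G) : BddDom m G :=
  BddDom.ofNeumann (neumannClamp n f) ⟨n, abs_neumannClamp_le n f⟩

lemma bddClamp_apply (n : ℕ) (f : NeumannSpace m G) (x : X) :
    (bddClamp n f).1 x = clamp (-n) n (f x) := neumannClamp_apply n f x

/-- The soft thresholding of `f ∈ D(Q^(N))` at the level `ε`. -/
def neumannThreshold (ε : ℝ≥0) (f : NeumannSpace m G) : NeumannSpace m G :=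
  neumannComp (lipschitz_softThreshold ε) (softThreshold_zero ε.2) f

lemma neumannThreshold_apply (ε : ℝ≥0) (f : NeumannSpace m G) (x : X) :
    neumannThreshold ε f x = softThreshold ε (f x) := neumannComp_apply _ _ _ _

lemma abs_neumannThreshold_le_abs (ε : ℝ≥0) (f : NeumannSpace m G) (x : X) :
    |neumannThreshold ε f x| ≤ |f x| := by
  rw [neumannThreshold_apply]
  exact abs_le_of_lipschitz (lipschitz_softThreshold _) (softThreshold_zero ε.2) _

lemma norm_neumannThreshold_le (ε : ℝ≥0) (f : NeumannSpace m G) : ‖neumannThreshold ε f‖ ≤ ‖f‖ :=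
  norm_neumannComp_le _ _ _

lemma tendsto_neumannClamp (f : NeumannSpace m G) :
    Tendsto (fun n => toEll2 (neumannClamp n f)) atTop (𝓝 (toEll2 f)) := by
  refine ell2_tendsto_of_dominated (g := toEll2 f) (fun n => abs_neumannClamp_le_abs n f)
    (fun x => le_rfl) fun x => ?_
  obtain ⟨N, hN⟩ := exists_nat_ge |f x|
  refine tendsto_const_nhds.congr' ?_
  filter_upwards [eventually_ge_atTop N] with n hn
  rw [neumannClamp_apply, clamp_eq_self_of_abs_le (hN.trans (Nat.cast_le.2 hn))]

lemma tendsto_neumannClamp_neumannThreshold (f : NeumannSpace m G) :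
    Tendsto (fun n => toEll2 (neumannClamp n (neumannThreshold (approxParam n) f))) atTop
      (𝓝 (toEll2 f)) := by
  refine ell2_tendsto_of_dominated (g := toEll2 f)
    (fun n x => (abs_neumannClamp_le_abs n _ x).trans (abs_neumannThreshold_le_abs _ f x))
    (fun x => le_rfl) fun x => ?_
  have hthreshold : Tendsto (fun n => softThreshold (approxParam n) (f x)) atTop (𝓝 (f x)) :=
    tendsto_iff_norm_sub_tendsto_zero.2 <| squeeze_zero (fun _ => norm_nonneg _)
      (fun n => abs_softThreshold_sub_le (approxParam n).2 _) tendsto_approxParam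
  refine hthreshold.congr' ?_
  obtain ⟨N, hN⟩ := exists_nat_ge |f x|
  filter_upwards [eventually_ge_atTop N] with n hn
  rw [neumannClamp_apply, neumannThreshold_apply, clamp_eq_self_of_abs_le]
  rw [← neumannThreshold_apply]
  exact (abs_neumannThreshold_le_abs _ f x).trans (hN.trans (Nat.cast_le.2 hn))

end Truncation

section Trace

variable {X : Type*} [MeasurableSpace X] [DiscreteMeasurableSpace X] {m : X → Ioi (0 : ℝ)}
  {G : WGraph X}

lemma exists_tendsto_ereal (f : NeumannSpace m G) (ξ : Royden m G) :
    ∃ c : EReal, Tendsto (fun x => ((f x : ℝ) : EReal)) (vertexFilter ξ) (𝓝 c) := by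
  refine tendsto_of_no_upcrossings dense_univ ?_
  rintro a - b - hab ⟨hfa, hfb⟩
  obtain ⟨a', haa', ha'b⟩ := EReal.lt_iff_exists_real_btwn.1 hab
  obtain ⟨b', ha'b', hb'b⟩ := EReal.lt_iff_exists_real_btwn.1 ha'b
  obtain ⟨n, hn⟩ := exists_nat_ge (max |a'| |b'|)
  -- The truncation of `f` at a large level has a limit `c`, and `f` crosses `[a', b']` at `ξ`.
  have hlim := tendsto_extend (bddClamp n f) ξ
  have hclampa : clamp (-n) n a' = a' := clamp_eq_self_of_abs_le ((le_max_left _ _).trans hn)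
  have hclampb : clamp (-n) n b' = b' := clamp_eq_self_of_abs_le ((le_max_right _ _).trans hn)
  have hle : Royden.extend (bddClamp n f) ξ ≤ a' :=
    le_of_tendsto_of_frequently hlim <| hfa.mono fun x hx => by
      rw [bddClamp_apply, ← hclampa]
      exact monotone_clamp _ _ (EReal.coe_lt_coe_iff.1 (hx.trans haa')).le
  have hge : b' ≤ Royden.extend (bddClamp n f) ξ :=
    ge_of_tendsto_of_frequently hlim <| hfb.mono fun x hx => by
      rw [bddClamp_apply, ← hclampb]
      exact monotone_clamp _ _ (EReal.coe_lt_coe_iff.1 (hb'b.trans hx)).le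
  exact (hge.trans hle).not_gt (EReal.coe_lt_coe_iff.1 ha'b')

lemma tendsto_trace (f : NeumannSpace m G) (ξ : Boundary m G) :
    Tendsto (fun x => ((f x : ℝ) : EReal)) (vertexFilter ξ.1) (𝓝 (trace G (toEll2 f) ξ)) :=
  tendsto_nhds_limUnder (exists_tendsto_ereal f ξ.1)

lemma trace_eq_of_tendsto {f : NeumannSpace m G} {ξ : Boundary m G} {c : EReal}
    (h : Tendsto (fun x => ((f x : ℝ) : EReal)) (vertexFilter ξ.1) (𝓝 c)) :
    trace G (toEll2 f) ξ = c := tendsto_nhds_unique (tendsto_trace f ξ) h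

lemma trace_eq_coe_iff {f : NeumannSpace m G} {ξ : Boundary m G} {c : ℝ} :
    trace G (toEll2 f) ξ = c ↔ Tendsto (fun x => f x) (vertexFilter ξ.1) (𝓝 c) :=
  ⟨fun h => EReal.tendsto_coe.1 (h ▸ tendsto_trace f ξ),
    fun h => trace_eq_of_tendsto (EReal.tendsto_coe.2 h)⟩

lemma trace_eq_extend (f : BddDom m G) (ξ : Boundary m G) :
    trace G f.1 ξ = (Royden.extend f ξ.1 : ℝ) :=
  trace_eq_coe_iff (f := f.toNeumann).2 (tendsto_extend f ξ.1)

lemma tendsto_zero_of_mem_dirichletSubspace {f : NeumannSpace m G}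
    (hf : f ∈ dirichletSubspace m G) (ξ : Boundary m G) :
    Tendsto (fun x => f x) (vertexFilter ξ.1) (𝓝 0) := by
  have hmem : (bddClamp 1 f).1 ∈ (dirichletForm m G).dom :=
    mem_dirichletSubspace_iff.1 (neumannClamp_mem_dirichletSubspace 1 hf)
  have hlim := tendsto_extend (bddClamp 1 f) ξ.1
  rw [ξ.2.2 _ hmem] at hlim
  simp only [bddClamp_apply] at hlim
  exact tendsto_of_tendsto_clamp hlim (by simp)

lemma trace_eq_of_sub_mem {f g : NeumannSpace m G} (h : f - g ∈ dirichletSubspace m G) :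
    trace G (toEll2 f) = trace G (toEll2 g) := by
  funext ξ
  refine trace_eq_of_tendsto ?_
  have hsub : Tendsto (fun x => (((f - g) x : ℝ) : EReal)) (vertexFilter ξ.1) (𝓝 0) :=
    EReal.tendsto_coe.2 (tendsto_zero_of_mem_dirichletSubspace h ξ)
  have hadd : ContinuousAt (fun p : EReal × EReal => p.1 + p.2) (trace G (toEll2 g) ξ, 0) :=
    EReal.continuousAt_add (by simp) (by simp)
  have hlim := hadd.tendsto.comp ((tendsto_trace g ξ).prodMk_nhds hsub)
  simp only [add_zero] at hlim
  refine hlim.congr fun x => ?_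
  rw [Function.comp_apply, ← EReal.coe_add, neumann_sub_apply, add_sub_cancel]

lemma trace_harmonicPart (f : NeumannSpace m G) :
    trace G (toEll2 (harmonicPart f)) = trace G (toEll2 f) :=
  (trace_eq_of_sub_mem (sub_harmonicPart_mem f)).symm

variable (m G) in
lemma exists_extend_embed_ne_zero (x : X) :
    ∃ f : BddDom m G, f.toNeumann ∈ dirichletSubspace m G ∧
      Royden.extend f (Royden.embed m G x) ≠ 0 := by
  classical
  refine ⟨.ofNeumann (neumannDelta m G x) ⟨1, fun y => ?_⟩,
    neumannDelta_mem_dirichletSubspace x, ?_⟩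
  · rw [toEll2_neumannDelta, delta_apply]
    split_ifs <;> simp
  · rw [extend_embed, BddDom.val_ofNeumann, toEll2_neumannDelta, delta_self]
    exact one_ne_zero

lemma exists_extend_ne_zero {ξ : Royden m G} (hξ : ∀ η : Boundary m G, η.1 ≠ ξ) :
    ∃ f : BddDom m G, f.toNeumann ∈ dirichletSubspace m G ∧ Royden.extend f ξ ≠ 0 := by
  by_cases hrange : ξ ∈ range (Royden.embed m G)
  · obtain ⟨x, rfl⟩ := hrange
    exact exists_extend_embed_ne_zero m G x
  · by_contra! hzero
    exact hξ ⟨ξ, hrange, fun f hf => hzero f (mem_dirichletSubspace_iff.2 hf)⟩ rfl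

lemma exists_nhds_dirichletSubspace_ge_one {ξ : Royden m G} (hξ : ∀ η : Boundary m G, η.1 ≠ ξ) :
    ∃ U ∈ 𝓝 ξ, ∃ g ∈ dirichletSubspace m G,
      ∀ x, 0 ≤ g x ∧ (Royden.embed m G x ∈ U → 1 ≤ g x) := by
  obtain ⟨f, hf, hne⟩ := exists_extend_ne_zero hξ
  set c := |Royden.extend f ξ|
  have hcpos : 0 < c := abs_pos.2 hne
  have hopen : IsOpen {η | c / 2 < |Royden.extend f η|} :=
    isOpen_lt continuous_const (continuous_extend f).abs
  refine ⟨_, hopen.mem_nhds (half_lt_self hcpos),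
    (2 / c) • neumannComp lipschitzWith_one_norm norm_zero f.toNeumann,
    Submodule.smul_mem _ _ (neumannComp_mem_dirichletSubspace _ _ hf), fun x => ?_⟩
  rw [neumann_smul_apply, neumannComp_apply, BddDom.toEll2_toNeumann, Real.norm_eq_abs]
  refine ⟨by positivity, fun hx => ?_⟩
  rw [mem_ofPred_eq, extend_embed] at hx
  rw [div_mul_eq_mul_div, le_div_iff₀ hcpos]
  linarith

lemma exists_dirichletSubspace_ge_one {K : Set (Royden m G)} (hK : IsCompact K)
    (hd : ∀ η : Boundary m G, η.1 ∉ K) :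
    ∃ g ∈ dirichletSubspace m G, ∀ x, 0 ≤ g x ∧ (Royden.embed m G x ∈ K → 1 ≤ g x) := by
  refine hK.induction_on (p := fun S => ∃ g ∈ dirichletSubspace m G, ∀ x, 0 ≤ g x ∧
    (Royden.embed m G x ∈ S → 1 ≤ g x)) ?_ ?_ ?_ fun ξ hξ => ?_
  · exact ⟨0, Submodule.zero_mem _, fun x => ⟨by rw [neumann_zero_apply], fun hx => hx.elim⟩⟩
  · rintro S T hST ⟨g, hg, hgT⟩
    exact ⟨g, hg, fun x => ⟨(hgT x).1, fun hx => (hgT x).2 (hST hx)⟩⟩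
  · rintro S T ⟨g, hg, hgS⟩ ⟨g', hg', hgT⟩
    refine ⟨g + g', Submodule.add_mem _ hg hg', fun x => ?_⟩
    rw [neumann_add_apply]
    refine ⟨add_nonneg (hgS x).1 (hgT x).1, ?_⟩
    rintro (hx | hx)
    · linarith [(hgS x).2 hx, (hgT x).1]
    · linarith [(hgT x).2 hx, (hgS x).1]
  · obtain ⟨U, hU, hg⟩ := exists_nhds_dirichletSubspace_ge_one (ξ := ξ)
      fun η hη => hd η (hη ▸ hξ)
    exact ⟨U, mem_nhdsWithin_of_mem_nhds hU, hg⟩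

lemma neumannClamp_neumannThreshold_mem {f : NeumannSpace m G}
    (h : ∀ ξ : Boundary m G, Tendsto (fun x => f x) (vertexFilter ξ.1) (𝓝 0)) {ε : ℝ≥0}
    (hε : 0 < ε) (n : ℕ) : neumannClamp n (neumannThreshold ε f) ∈ dirichletSubspace m G := by
  obtain ⟨N, hN⟩ := exists_nat_ge (ε : ℝ)
  have hcompact : IsCompact {ξ : Royden m G | (ε : ℝ) ≤ |Royden.extend (bddClamp N f) ξ|} :=
    (isClosed_le continuous_const (continuous_extend _).abs).isCompact
  obtain ⟨g, hg, hgK⟩ := exists_dirichletSubspace_ge_one hcompact fun ξ hξ => by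
    have hlim := ((lipschitz_clamp (-N) N).continuous.tendsto 0).comp (h ξ)
    rw [clamp_neg_self_zero N.cast_nonneg] at hlim
    have hzero : Royden.extend (bddClamp N f) ξ.1 = 0 :=
      extend_eq_of_tendsto (hlim.congr fun x => (bddClamp_apply N f x).symm)
    rw [mem_ofPred_eq, hzero, abs_zero] at hξ
    exact hξ.not_gt hε
  refine mem_dirichletSubspace_of_abs_le (g := (n : ℝ) • g) (Submodule.smul_mem _ _ hg)
    fun x => ?_
  rw [neumann_smul_apply, abs_of_nonneg (mul_nonneg n.cast_nonneg (hgK x).1)]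
  by_cases hx : |f x| ≤ ε
  · rw [neumannClamp_apply, neumannThreshold_apply, softThreshold_eq_zero hx,
      clamp_neg_self_zero n.cast_nonneg, abs_zero]
    exact mul_nonneg n.cast_nonneg (hgK x).1
  · refine (abs_neumannClamp_le n _ x).trans (le_mul_of_one_le_right n.cast_nonneg ((hgK x).2 ?_))
    rw [mem_ofPred_eq, extend_embed, bddClamp_apply]
    by_contra! hlt
    rw [clamp_eq_self_of_abs_clamp_lt (hlt.trans_le hN)] at hlt
    exact hx hlt.le

lemma mem_dirichletSubspace_of_tendsto_zero {f : NeumannSpace m G}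
    (h : ∀ ξ : Boundary m G, Tendsto (fun x => f x) (vertexFilter ξ.1) (𝓝 0)) :
    f ∈ dirichletSubspace m G :=
  mem_dirichletSubspace_of_bounded
    (fun n => (norm_neumannClamp_le n _).trans (norm_neumannThreshold_le (approxParam n) f))
    (fun n => neumannClamp_neumannThreshold_mem h (approxParam_pos n) n)
    (tendsto_neumannClamp_neumannThreshold f)

-- The excess `(u - c)⁺` of the harmonic part `u` vanishes at the boundary, so it lies in
-- `D(Q^(D))` and is orthogonal to `u`.
lemma harmonicPart_le_of_trace_le {f : NeumannSpace m G} {c : ℝ} (hc : 0 ≤ c)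
    (h : ∀ ξ : Boundary m G, trace G (toEll2 f) ξ ≤ c) (x : X) : harmonicPart f x ≤ c := by
  have hzero : max (0 - c) 0 = 0 := max_eq_right (by linarith)
  set v := neumannComp (lipschitz_excess c) hzero (harmonicPart f) with hv
  have hvmem : v ∈ dirichletSubspace m G := by
    refine mem_dirichletSubspace_of_tendsto_zero fun ξ => Metric.tendsto_nhds.2 fun δ hδ => ?_
    have hlim := tendsto_trace (harmonicPart f) ξ
    rw [trace_harmonicPart] at hlim
    have hlt : trace G (toEll2 f) ξ < ((c + δ : ℝ) : EReal) :=
      (h ξ).trans_lt (EReal.coe_lt_coe_iff.2 (by linarith))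
    filter_upwards [hlim.eventually (gt_mem_nhds hlt)] with y hy
    rw [hv, neumannComp_apply, Real.dist_eq, sub_zero, abs_of_nonneg (le_max_right _ _)]
    exact max_lt (by linarith [EReal.coe_lt_coe_iff.1 hy]) hδ
  have hnorm := norm_sq_neumannComp_le_inner (lipschitz_excess c) hzero (harmonicPart f)
    (monotone_excess c)
  rw [← hv, Submodule.inner_left_of_mem_orthogonal hvmem (harmonicPart_mem f)] at hnorm
  have hv0 : v = 0 := norm_eq_zero.1 (sq_eq_zero_iff.1 (hnorm.antisymm (sq_nonneg _)))
  have hexcess := neumannComp_apply (lipschitz_excess c) hzero (harmonicPart f) x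
  rw [← hv, hv0, neumann_zero_apply] at hexcess
  linarith [le_max_left (harmonicPart f x - c) 0]

lemma abs_harmonicPart_le_of_abs_le {f : NeumannSpace m G} {K : ℝ} (hK : 0 ≤ K)
    (h : ∀ x, |f x| ≤ K) (x : X) : |harmonicPart f x| ≤ K := by
  have hle (f : NeumannSpace m G) (h : ∀ x, |f x| ≤ K) : harmonicPart f x ≤ K :=
    harmonicPart_le_of_trace_le hK (fun ξ => le_of_tendsto' (tendsto_trace f ξ) fun y =>
      EReal.coe_le_coe_iff.2 ((le_abs_self _).trans (h y))) x
  have hneg := hle (-f) fun x => by rw [neumann_neg_apply, abs_neg]; exact h x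
  rw [map_neg, neumann_neg_apply] at hneg
  exact abs_le.2 ⟨neg_le.1 hneg, hle f h⟩

end Trace

/-! ### Existence and second moments of harmonic measures -/

section Representation

variable {K : Type*} [TopologicalSpace K] [CompactSpace K]

lemma norm_sup_zero_smul {c : ℝ} (hc : 0 ≤ c) (φ : C(K, ℝ)) :
    ‖(c • φ) ⊔ 0‖ = c * ‖φ ⊔ 0‖ := by
  have hsmul : (c • φ) ⊔ 0 = c • (φ ⊔ 0) := by
    ext ξ
    simp [mul_max_of_nonneg _ _ hc]
  rw [hsmul, norm_smul, Real.norm_of_nonneg hc]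

lemma le_norm_sup_zero (φ : C(K, ℝ)) (ξ : K) : φ ξ ≤ ‖φ ⊔ 0‖ :=
  (le_max_left _ _).trans ((le_abs_self _).trans ((φ ⊔ 0).norm_coe_le_norm ξ))

lemma norm_sup_zero_le {φ : C(K, ℝ)} {c : ℝ} (hc : 0 ≤ c) (h : ∀ ξ, φ ξ ≤ c) : ‖φ ⊔ 0‖ ≤ c :=
  (ContinuousMap.norm_le _ hc).2 fun ξ => by
    rw [ContinuousMap.sup_apply, ContinuousMap.zero_apply,
      Real.norm_of_nonneg (le_max_right _ _)]
    exact max_le (h ξ) hc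

lemma norm_add_sup_zero_le (φ ψ : C(K, ℝ)) : ‖(φ + ψ) ⊔ 0‖ ≤ ‖φ ⊔ 0‖ + ‖ψ ⊔ 0‖ :=
  norm_sup_zero_le (by positivity) fun ξ => add_le_add (le_norm_sup_zero φ ξ) (le_norm_sup_zero ψ ξ)

lemma exists_linearMap_le_norm_sup_zero {V : Type*} [AddCommGroup V] [Module ℝ V]
    (T : V →ₗ[ℝ] C(K, ℝ)) (e : V →ₗ[ℝ] ℝ) (h : ∀ v, e v ≤ ‖T v ⊔ 0‖) :
    ∃ Λ : C(K, ℝ) →ₗ[ℝ] ℝ, (∀ φ, Λ φ ≤ ‖φ ⊔ 0‖) ∧ ∀ v, Λ (T v) = e v := by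
  have hker : e ∈ T.ker.dualAnnihilator := by
    refine (Submodule.mem_dualAnnihilator e).2 fun v hv => ?_
    have hpos := h v
    have hneg := h (-v)
    rw [map_neg, map_neg, LinearMap.mem_ker.1 hv, neg_zero, sup_idem, norm_zero] at hneg
    rw [LinearMap.mem_ker.1 hv, sup_idem, norm_zero] at hpos
    linarith
  rw [← LinearMap.range_dualMap_eq_dualAnnihilator_ker] at hker
  obtain ⟨Λ₀, rfl⟩ := hker
  obtain ⟨Λ, hΛ, hle⟩ := exists_extension_of_le_sublinear ⟨T.range, Λ₀.domRestrict T.range⟩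
    (fun φ => ‖φ ⊔ 0‖) (fun c hc φ => norm_sup_zero_smul hc.le φ) norm_add_sup_zero_le
    (by rintro ⟨-, v, rfl⟩; exact h v)
  exact ⟨Λ, hle, fun v => hΛ ⟨T v, v, rfl⟩⟩

lemma exists_regular_measure_of_le_norm_sup_zero [T2Space K] [MeasurableSpace K] [BorelSpace K]
    {V : Type*} [AddCommGroup V] [Module ℝ V] (T : V →ₗ[ℝ] C(K, ℝ)) (e : V →ₗ[ℝ] ℝ)
    (h : ∀ v, e v ≤ ‖T v ⊔ 0‖) :
    ∃ ν : Measure K, ν.Regular ∧ ν univ ≤ 1 ∧ ∀ v, ∫ ξ, T v ξ ∂ν = e v := by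
  obtain ⟨Λ, hle, hΛ⟩ := exists_linearMap_le_norm_sup_zero T e h
  let ι : CompactlySupportedContinuousMap K ℝ →ₗ[ℝ] C(K, ℝ) :=
    { toFun := fun φ => φ
      map_add' := fun _ _ => rfl
      map_smul' := fun _ _ => rfl }
  have hpos (φ) (hφ : 0 ≤ φ) : 0 ≤ Λ (ι φ) := by
    have hneg := (hle (-ι φ)).trans
      (norm_sup_zero_le le_rfl fun ξ => neg_nonpos.2 (hφ ξ))
    rwa [map_neg, neg_nonpos] at hneg
  let ν := RealRMK.rieszMeasure (PositiveLinearMap.mk₀ (Λ ∘ₗ ι) hpos)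
  have hintegral (φ : C(K, ℝ)) : ∫ ξ, φ ξ ∂ν = Λ φ :=
    RealRMK.integral_rieszMeasure (PositiveLinearMap.mk₀ (Λ ∘ₗ ι) hpos)
      (CompactlySupportedContinuousMap.continuousMapEquiv φ)
  have hmass : ν.real univ ≤ 1 := by
    have hone := hintegral 1
    simp only [ContinuousMap.one_apply, integral_const, smul_eq_mul, mul_one] at hone
    exact hone.trans_le ((hle 1).trans (norm_sup_zero_le zero_le_one fun _ => le_rfl))
  exact ⟨ν, inferInstance, (ENNReal.toReal_le_toReal (measure_ne_top ν univ)
    ENNReal.one_ne_top).1 hmass, fun v => (hintegral (T v)).trans (hΛ v)⟩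

end Representation

section HarmonicMeasure

variable {X : Type*} [MeasurableSpace X] [DiscreteMeasurableSpace X] {m : X → Ioi (0 : ℝ)}
  {G : WGraph X}

instance : T2Space (Boundary m G) := inferInstanceAs (T2Space (Subtype _))

lemma setOf_boundary_eq : {ξ : Royden m G | ξ ∉ range (Royden.embed m G) ∧
    ∀ f : BddDom m G, f.1 ∈ (dirichletForm m G).dom → Royden.extend f ξ = 0} =
    ⋂ f : BddDom m G, ⋂ _ : f.1 ∈ (dirichletForm m G).dom, {ξ | Royden.extend f ξ = 0} := by
  ext ξ
  simp only [mem_iInter]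
  refine ⟨fun h => h.2, fun h => ⟨?_, h⟩⟩
  rintro ⟨x, rfl⟩
  obtain ⟨f, hf, hne⟩ := exists_extend_embed_ne_zero m G x
  exact hne (h f (mem_dirichletSubspace_iff (f := f.toNeumann).1 hf))

instance : CompactSpace (Boundary m G) := by
  have hclosed : IsClosed {ξ : Royden m G | ξ ∉ range (Royden.embed m G) ∧
      ∀ f : BddDom m G, f.1 ∈ (dirichletForm m G).dom → Royden.extend f ξ = 0} := by
    rw [setOf_boundary_eq]
    exact isClosed_iInter fun f => isClosed_iInter fun _ =>
      isClosed_eq (continuous_extend f) continuous_const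
  exact isCompact_iff_compactSpace.1 hclosed.isCompact

lemma continuous_extend_boundary (f : BddDom m G) :
    Continuous fun ξ : Boundary m G => Royden.extend f ξ.1 :=
  (continuous_extend f).comp continuous_subtype_val

variable (m G) in
/-- The bounded functions in `D(Q^(N))`, as a subspace. -/
def boundedNeumann : Submodule ℝ (NeumannSpace m G) where
  carrier := {f | ∃ K : ℝ, ∀ x, |f x| ≤ K}
  add_mem' := by
    rintro f g ⟨K, hK⟩ ⟨L, hL⟩
    refine ⟨K + L, fun x => ?_⟩
    rw [neumann_add_apply]
    exact (abs_add_le _ _).trans (add_le_add (hK x) (hL x))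
  zero_mem' := ⟨0, fun x => by rw [neumann_zero_apply, abs_zero]⟩
  smul_mem' := by
    rintro a f ⟨K, hK⟩
    refine ⟨|a| * K, fun x => ?_⟩
    rw [neumann_smul_apply, abs_mul]
    exact mul_le_mul_of_nonneg_left (hK x) (abs_nonneg a)

variable (m G) in
/-- The trace on bounded functions in `D(Q^(N))`, which are extended continuously to `∂X`. -/
def boundedTrace : boundedNeumann m G →ₗ[ℝ] C(Boundary m G, ℝ) where
  toFun f := ⟨fun ξ => Royden.extend (.ofNeumann f.1 f.2) ξ.1, continuous_extend_boundary _⟩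
  map_add' f g := by
    ext ξ
    refine extend_eq_of_tendsto ?_
    refine ((tendsto_extend (.ofNeumann f.1 f.2) ξ.1).add
      (tendsto_extend (.ofNeumann g.1 g.2) ξ.1)).congr fun x => ?_
    exact (neumann_add_apply f.1 g.1 x).symm
  map_smul' a f := by
    ext ξ
    refine extend_eq_of_tendsto ?_
    refine ((tendsto_extend (.ofNeumann f.1 f.2) ξ.1).const_mul a).congr fun x => ?_
    exact (neumann_smul_apply a f.1 x).symm

variable (m G) in
/-- Evaluation at `x` of the harmonic part of a bounded function in `D(Q^(N))`. -/
def boundedHarmonicEval (x : X) : boundedNeumann m G →ₗ[ℝ] ℝ where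
  toFun f := harmonicPart f.1 x
  map_add' f g := by rw [Submodule.coe_add, map_add, neumann_add_apply]
  map_smul' a f := by rw [Submodule.coe_smul, map_smul, neumann_smul_apply]; rfl

lemma boundedHarmonicEval_le (x : X) (f : boundedNeumann m G) :
    boundedHarmonicEval m G x f ≤ ‖boundedTrace m G f ⊔ 0‖ :=
  harmonicPart_le_of_trace_le (norm_nonneg _) (fun ξ =>
    (trace_eq_extend (.ofNeumann f.1 f.2) ξ).trans_le
      (EReal.coe_le_coe_iff.2 (le_norm_sup_zero (boundedTrace m G f) ξ))) x

lemma eq_harmonicPart {f u : NeumannSpace m G} (hu : IsHarmonic m G (toEll2 u))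
    (hf : ∀ ξ : Boundary m G, ∃ c : ℝ, trace G (toEll2 f) ξ = c)
    (h : trace G (toEll2 u) = trace G (toEll2 f)) : u = harmonicPart f := by
  refine (harmonicPart_eq (isHarmonic_iff.1 hu) ?_).symm
  refine mem_dirichletSubspace_of_tendsto_zero fun ξ => ?_
  obtain ⟨c, hc⟩ := hf ξ
  have hsub := (trace_eq_coe_iff.1 hc).sub (trace_eq_coe_iff.1 ((congrFun h ξ).trans hc))
  rw [sub_self] at hsub
  exact hsub.congr fun x => (neumann_sub_apply f u x).symm

variable (m G) in
lemma exists_isHarmonicMeasure (x : X) : ∃ μ, IsHarmonicMeasure m G x μ := by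
  obtain ⟨ν, hreg, hmass, hν⟩ := exists_regular_measure_of_le_norm_sup_zero
    (boundedTrace m G) (boundedHarmonicEval m G x) (boundedHarmonicEval_le x)
  have hfin : IsFiniteMeasure ν := ⟨hmass.trans_lt ENNReal.one_lt_top⟩
  set Z : Set (Boundary m G) := {ξ | ∀ f : BddDom m G, Royden.extend f ξ.1 = 0}
  refine ⟨ν.restrict Zᶜ, Measure.Regular.restrict_of_measure_ne_top (measure_ne_top _ _),
    ?_, ?_, fun ξ hξ => ?_⟩
  · exact Measure.restrict_apply_univ (μ := ν) Zᶜ ▸ (measure_mono (subset_univ _)).trans hmass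
  · intro f u hu hharm htr
    obtain ⟨u, rfl⟩ := exists_toEll2_eq hu
    have hzero (ξ) (hξ : ξ ∉ Zᶜ) : Royden.extend f ξ.1 = 0 := notMem_compl_iff.1 hξ f
    rw [setIntegral_eq_integral_of_forall_compl_eq_zero hzero,
      eq_harmonicPart (f := f.toNeumann) hharm (fun ξ => ⟨_, trace_eq_extend f ξ⟩) htr]
    exact hν ⟨f.toNeumann, f.2.2⟩
  · rw [Measure.restrict_apply (measurableSet_singleton ξ),
      singleton_inter_eq_empty.2 (fun h : ξ ∈ Zᶜ => h hξ), measure_empty]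

lemma isHarmonicMeasure (x : X) : IsHarmonicMeasure m G x (harmonicMeasure m G x) := by
  rw [harmonicMeasure, dif_pos (exists_isHarmonicMeasure m G x)]
  exact (exists_isHarmonicMeasure m G x).choose_spec

instance (x : X) : IsFiniteMeasure (harmonicMeasure m G x) :=
  ⟨(isHarmonicMeasure x).2.1.trans_lt ENNReal.one_lt_top⟩

lemma integral_extend (f : BddDom m G) (x : X) :
    ∫ ξ, Royden.extend f ξ.1 ∂(harmonicMeasure m G x) = harmonicPart f.toNeumann x :=
  (isHarmonicMeasure x).2.2.1 f (toEll2 (harmonicPart f.toNeumann)) (Form.incl_mem _ _)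
    (isHarmonic_iff.2 (harmonicPart_mem _)) (trace_harmonicPart f.toNeumann)

lemma weight_mul_sq_le_inner_clamp {f : NeumannSpace m G} {x : X} (hx : 0 ≤ f x) :
    m x * f x ^ 2 ≤
      inner ℝ f (neumannComp (lipschitz_clamp 0 (f x)) (clamp_eq_self le_rfl hx) f) := by
  set φ := neumannComp (lipschitz_clamp 0 (f x)) (clamp_eq_self le_rfl hx) f with hφ
  have hφx : φ x = f x := by rw [hφ, neumannComp_apply, clamp_eq_self hx le_rfl]
  calc m x * f x ^ 2 = m x * φ x ^ 2 := by rw [hφx]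
    _ ≤ ‖toEll2 φ‖ ^ 2 := weight_mul_sq_le _ x
    _ ≤ ‖φ‖ ^ 2 := pow_le_pow_left₀ (norm_nonneg _) (Form.norm_incl_le _ _) 2
    _ ≤ inner ℝ f φ := norm_sq_neumannComp_le_inner _ _ _ (monotone_clamp 0 (f x))

-- With `v = u²` and `ψ = uφ`, the energy terms satisfy
-- `(∇v)(∇φ) = 2 (∇u)(∇ψ) - (φ(x) + φ(y)) (∇u)²`.
lemma neg_inner_sq_le {u v φ ψ : NeumannSpace m G} {c : ℝ} (hc : 0 ≤ c)
    (hv : ∀ x, v x = u x * u x) (hψ : ∀ x, ψ x = u x * φ x) (hφ : ∀ x, φ x ≤ c) :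
    -inner ℝ v φ ≤ 2 * c * ‖u‖ ^ 2 - 2 * inner ℝ u ψ := by
  have hterm (p : X × X) : -energyTerm G v φ p ≤
      2 * c * energyTerm G u u p - 2 * energyTerm G u ψ p := by
    have hsum : φ p.1 + φ p.2 ≤ 2 * c := by linarith [hφ p.1, hφ p.2]
    have hmul := mul_le_mul_of_nonneg_left hsum
      (mul_nonneg (G.nonneg p.1 p.2) (sq_nonneg (u p.1 - u p.2)))
    simp only [energyTerm, hv, hψ]
    linarith
  have hu := (summable_energy u).mul_left (2 * c)
  have huψ := (summable_energyTerm G (summable_energy u) (summable_energy ψ)).mul_left 2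
  have henergy := (summable_energyTerm G (summable_energy v) (summable_energy φ)).neg.tsum_le_tsum
    hterm (hu.sub huψ)
  rw [tsum_neg, hu.tsum_sub huψ, tsum_mul_left, tsum_mul_left] at henergy
  have hinner : inner ℝ (toEll2 v) (toEll2 φ) = inner ℝ (toEll2 u) (toEll2 ψ) := by
    refine (hasSum_inner _ _).unique ((hasSum_inner (toEll2 u) (toEll2 ψ)).congr_fun fun y => ?_)
    rw [hv, hψ]; ring
  have hle : inner ℝ (toEll2 u) (toEll2 ψ) ≤ c * ‖toEll2 u‖ ^ 2 := by
    refine hasSum_le (fun y => ?_) (hasSum_inner _ _) ((hasSum_norm_sq (toEll2 u)).mul_left c)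
    rw [hψ]
    linarith [mul_le_mul_of_nonneg_left (hφ y) (mul_nonneg (weight_pos m y).le (sq_nonneg (u y)))]
  have hnorm : 0 ≤ c * ‖toEll2 u‖ ^ 2 := by positivity
  rw [neumann_norm_sq, neumann_inner, neumann_inner, energy, hinner]
  linarith

lemma weight_mul_harmonicPart_sq_le {u v : NeumannSpace m G}
    (hu : u ∈ (dirichletSubspace m G)ᗮ) {K : ℝ} (hK : ∀ x, |u x| ≤ K)
    (hv : ∀ x, v x = u x * u x) (x : X) : m x * harmonicPart v x ≤ 3 * ‖u‖ ^ 2 := by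
  set d := harmonicPart v - v with hd
  have hd_mem : d ∈ dirichletSubspace m G := by
    rw [hd, ← neg_sub]
    exact Submodule.neg_mem _ (sub_harmonicPart_mem v)
  have hsq : m x * u x ^ 2 ≤ ‖u‖ ^ 2 :=
    (weight_mul_sq_le (toEll2 u) x).trans
      (pow_le_pow_left₀ (norm_nonneg _) (Form.norm_incl_le _ _) 2)
  have hsplit : harmonicPart v x = d x + u x ^ 2 := by
    rw [hd, neumann_sub_apply, hv]; ring
  suffices hdx : m x * d x ≤ 2 * ‖u‖ ^ 2 by rw [hsplit, mul_add]; linarith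
  rcases le_or_gt (d x) 0 with hx | hx
  · exact (mul_nonpos_of_nonneg_of_nonpos (weight_pos m x).le hx).trans (by positivity)
  -- Test `d` with its truncation `φ` at height `d x`, and `u` with `u φ`.
  set φ := neumannComp (lipschitz_clamp 0 (d x)) (clamp_eq_self le_rfl hx.le) d
  have hφ (y : X) : φ y ∈ Icc 0 (d x) := by
    rw [neumannComp_apply]
    exact clamp_mem_Icc hx.le _
  have hφ_mem : φ ∈ dirichletSubspace m G := neumannComp_mem_dirichletSubspace _ _ hd_mem
  obtain ⟨ψ, hψ⟩ := exists_neumann_mul (f := u) (g := φ) (K := max K (d x))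
    (fun y => (hK y).trans (le_max_left _ _))
    (fun y => (abs_of_nonneg (hφ y).1).trans_le ((hφ y).2.trans (le_max_right _ _)))
  have hψ_mem : ψ ∈ dirichletSubspace m G := by
    refine mem_dirichletSubspace_of_abs_le (g := K • φ) (Submodule.smul_mem _ _ hφ_mem) fun y => ?_
    rw [hψ, neumann_smul_apply, abs_mul, abs_mul, abs_of_nonneg ((abs_nonneg _).trans (hK y))]
    exact mul_le_mul_of_nonneg_right (hK y) (abs_nonneg _)
  have hmain : m x * d x ^ 2 ≤ 2 * d x * ‖u‖ ^ 2 := calc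
    m x * d x ^ 2 ≤ inner ℝ d φ := weight_mul_sq_le_inner_clamp hx.le
    _ = -inner ℝ v φ := by
      rw [hd, inner_sub_left, Submodule.inner_left_of_mem_orthogonal hφ_mem (harmonicPart_mem v),
        zero_sub]
    _ ≤ 2 * d x * ‖u‖ ^ 2 - 2 * inner ℝ u ψ := neg_inner_sq_le hx.le hv hψ fun y => (hφ y).2
    _ = 2 * d x * ‖u‖ ^ 2 := by
      rw [Submodule.inner_left_of_mem_orthogonal hψ_mem hu, mul_zero, sub_zero]
  exact le_of_mul_le_mul_right (by linarith) hx

lemma integral_extend_sq_le (f : BddDom m G) (x : X) :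
    ∫ ξ, Royden.extend f ξ.1 ^ 2 ∂(harmonicMeasure m G x) ≤ 3 * ‖f.toNeumann‖ ^ 2 / m x := by
  obtain ⟨K, hK⟩ := f.2.2
  set u := harmonicPart f.toNeumann with hu
  have huK : ∀ y, |u y| ≤ |K| :=
    abs_harmonicPart_le_of_abs_le (abs_nonneg K) fun y => (hK y).trans (le_abs_self K)
  obtain ⟨v, hv⟩ := exists_neumann_mul huK huK
  have hv_bdd : ∃ C : ℝ, ∀ y, |v y| ≤ C := ⟨|K| * |K|, fun y => by
    rw [hv, abs_mul]
    exact mul_le_mul (huK y) (huK y) (abs_nonneg _) (abs_nonneg _)⟩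
  have hsq (ξ : Boundary m G) :
      Royden.extend f ξ.1 ^ 2 = Royden.extend (.ofNeumann v hv_bdd) ξ.1 := by
    refine (extend_eq_of_tendsto ?_).symm
    have htrace : trace G (toEll2 u) ξ = (Royden.extend f ξ.1 : ℝ) := by
      rw [hu, trace_harmonicPart, BddDom.toEll2_toNeumann, trace_eq_extend]
    refine ((trace_eq_coe_iff.1 htrace).pow 2).congr fun y => ?_
    rw [BddDom.val_ofNeumann, hv, sq]
  simp only [hsq]
  rw [integral_extend, le_div_iff₀ (weight_pos m x), mul_comm]
  refine (weight_mul_harmonicPart_sq_le (harmonicPart_mem f.toNeumann) huK hv x).trans ?_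
  gcongr
  exact norm_harmonicPart_le f.toNeumann

end HarmonicMeasure

/-! ### The trace operator -/

lemma abs_clamp_neg_self {K : ℝ} (hK : 0 ≤ K) (t : ℝ) : |clamp (-K) K t| = min |t| K := by
  unfold clamp
  grind

section TraceOperator

variable {X : Type*} [MeasurableSpace X] [DiscreteMeasurableSpace X] {m : X → Ioi (0 : ℝ)}
  {G : WGraph X} {w : X → ℝ≥0}

/-- The trace of the truncation `(-n) ∨ (f ∧ n)`, which is finite everywhere on `∂X`. -/
def truncTrace (f : NeumannSpace m G) (n : ℕ) (ξ : Boundary m G) : ℝ :=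
  Royden.extend (bddClamp n f) ξ.1

lemma continuous_truncTrace (f : NeumannSpace m G) (n : ℕ) : Continuous (truncTrace f n) :=
  continuous_extend_boundary _

lemma tendsto_truncTrace (f : NeumannSpace m G) (n : ℕ) (ξ : Boundary m G) :
    Tendsto (fun x => clamp (-n) n (f x)) (vertexFilter ξ.1) (𝓝 (truncTrace f n ξ)) :=
  (tendsto_extend (bddClamp n f) ξ.1).congr (bddClamp_apply n f)

lemma truncTrace_of_trace_eq {f : NeumannSpace m G} {ξ : Boundary m G} {c : ℝ}
    (h : trace G (toEll2 f) ξ = c) (n : ℕ) : truncTrace f n ξ = clamp (-n) n c :=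
  tendsto_nhds_unique (tendsto_truncTrace f n ξ)
    (((lipschitz_clamp _ _).continuous.tendsto c).comp (trace_eq_coe_iff.1 h))

lemma trace_of_abs_truncTrace_lt {f : NeumannSpace m G} {ξ : Boundary m G} {n : ℕ}
    (h : |truncTrace f n ξ| < n) : trace G (toEll2 f) ξ = (truncTrace f n ξ : ℝ) :=
  trace_eq_coe_iff.2 (tendsto_of_tendsto_clamp (tendsto_truncTrace f n ξ) h)

lemma monotone_sq_truncTrace (f : NeumannSpace m G) (ξ : Boundary m G) :
    Monotone fun n : ℕ => ENNReal.ofReal (truncTrace f n ξ ^ 2) := by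
  intro n k hnk
  refine ENNReal.ofReal_le_ofReal (le_of_tendsto_of_tendsto' ((tendsto_truncTrace f n ξ).pow 2)
    ((tendsto_truncTrace f k ξ).pow 2) fun x => sq_le_sq.2 ?_)
  rw [abs_clamp_neg_self n.cast_nonneg, abs_clamp_neg_self k.cast_nonneg]
  gcongr

lemma measurable_sq_truncTrace (f : NeumannSpace m G) (n : ℕ) :
    Measurable fun ξ => ENNReal.ofReal (truncTrace f n ξ ^ 2) :=
  ((continuous_truncTrace f n).pow 2).measurable.ennreal_ofReal

/-- The square of the absolute value of the trace, as the supremum over the truncations. -/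
def sqTrace (f : NeumannSpace m G) (ξ : Boundary m G) : ℝ≥0∞ :=
  ⨆ n : ℕ, ENNReal.ofReal (truncTrace f n ξ ^ 2)

lemma exists_trace_eq {f : NeumannSpace m G} {ξ : Boundary m G} (h : sqTrace f ξ < ⊤) :
    ∃ c : ℝ, trace G (toEll2 f) ξ = c ∧ ENNReal.ofReal (c ^ 2) ≤ sqTrace f ξ := by
  obtain ⟨n, hn⟩ := exists_nat_gt (√(sqTrace f ξ).toReal)
  have hle : ENNReal.ofReal (truncTrace f n ξ ^ 2) ≤ sqTrace f ξ :=
    le_iSup (fun n : ℕ => ENNReal.ofReal (truncTrace f n ξ ^ 2)) n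
  refine ⟨truncTrace f n ξ, trace_of_abs_truncTrace_lt (lt_of_le_of_lt ?_ hn), hle⟩
  exact Real.abs_le_sqrt ((ENNReal.ofReal_le_iff_le_toReal h.ne).1 hle)

lemma measurable_sqTrace (f : NeumannSpace m G) : Measurable (sqTrace f) :=
  Measurable.iSup fun n => measurable_sq_truncTrace f n

lemma lintegral_sqTrace_le (f : NeumannSpace m G) (x : X) :
    ∫⁻ ξ, sqTrace f ξ ∂(harmonicMeasure m G x) ≤ ENNReal.ofReal (3 * ‖f‖ ^ 2 / m x) := by
  unfold sqTrace
  rw [lintegral_iSup (measurable_sq_truncTrace f) fun n k hnk ξ => monotone_sq_truncTrace f ξ hnk]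
  refine iSup_le fun n => ?_
  have hintegral :
      Integrable (fun ξ : Boundary m G => truncTrace f n ξ ^ 2) (harmonicMeasure m G x) :=
    ((continuous_truncTrace f n).pow 2).integrable_of_hasCompactSupport
      (HasCompactSupport.of_compactSpace _)
  have hm := (weight_pos m x).le
  rw [← ofReal_integral_eq_lintegral_ofReal hintegral (Eventually.of_forall fun ξ => sq_nonneg _)]
  refine ENNReal.ofReal_le_ofReal ((integral_extend_sq_le (bddClamp n f) x).trans ?_)
  gcongr
  exact norm_neumannClamp_le n f

/-- The constant in the norm estimate for the trace operator. -/
def traceConst (m : X → Ioi (0 : ℝ)) (w : X → ℝ≥0) : ℝ := 3 * ∑' x, (w x : ℝ) / (m x : ℝ)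

omit [MeasurableSpace X] [DiscreteMeasurableSpace X] in
lemma traceConst_nonneg : 0 ≤ traceConst m w :=
  mul_nonneg (by norm_num) (tsum_nonneg fun x => div_nonneg (w x).2 (weight_pos m x).le)

lemma lintegral_sqTrace_refMeasure_le (hw : IsAdmissible m G w) (f : NeumannSpace m G) :
    ∫⁻ ξ, sqTrace f ξ ∂(refMeasure m G w) ≤ ENNReal.ofReal (traceConst m w * ‖f‖ ^ 2) := by
  rw [refMeasure, lintegral_sum_measure]
  have hconst : traceConst m w * ‖f‖ ^ 2 = ∑' x, (w x : ℝ) * (3 * ‖f‖ ^ 2 / m x) := by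
    rw [traceConst, mul_right_comm, ← tsum_mul_left]
    exact tsum_congr fun x => by ring
  rw [hconst, ENNReal.ofReal_tsum_of_nonneg]
  · refine ENNReal.tsum_le_tsum fun x => ?_
    rw [lintegral_smul_measure, ENNReal.ofReal_mul (NNReal.coe_nonneg _),
      ENNReal.ofReal_coe_nnreal, smul_eq_mul]
    gcongr
    exact lintegral_sqTrace_le f x
  · intro x
    have := weight_pos m x
    positivity
  · refine (hw.summable_div.mul_left (3 * ‖f‖ ^ 2)).congr fun x => ?_
    ring

lemma ae_sqTrace_lt_top (hw : IsAdmissible m G w) (f : NeumannSpace m G) :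
    ∀ᵐ ξ ∂(refMeasure m G w), sqTrace f ξ < ⊤ :=
  ae_lt_top (measurable_sqTrace f)
    ((lintegral_sqTrace_refMeasure_le hw f).trans_lt ENNReal.ofReal_lt_top).ne

/-- The real-valued trace; at points where the trace is infinite it takes the value `0`. -/
def realTrace (f : NeumannSpace m G) (ξ : Boundary m G) : ℝ := (trace G (toEll2 f) ξ).toReal

lemma coe_realTrace {f : NeumannSpace m G} {ξ : Boundary m G} (h : sqTrace f ξ < ⊤) :
    (realTrace f ξ : EReal) = trace G (toEll2 f) ξ := by
  obtain ⟨c, hc, -⟩ := exists_trace_eq h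
  rw [realTrace, hc, EReal.toReal_coe]

lemma aestronglyMeasurable_realTrace (hw : IsAdmissible m G w) (f : NeumannSpace m G) :
    AEStronglyMeasurable (realTrace f) (refMeasure m G w) := by
  refine aestronglyMeasurable_of_tendsto_ae atTop (f := fun n => truncTrace f n)
    (fun n => (continuous_truncTrace f n).aestronglyMeasurable) ?_
  filter_upwards [ae_sqTrace_lt_top hw f] with ξ hξ
  have h := (coe_realTrace hξ).symm
  refine tendsto_const_nhds.congr' ?_
  obtain ⟨N, hN⟩ := exists_nat_ge |realTrace f ξ|
  filter_upwards [eventually_ge_atTop N] with n hn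
  rw [truncTrace_of_trace_eq h, clamp_eq_self_of_abs_le (hN.trans (Nat.cast_le.2 hn))]

lemma lintegral_realTrace_le (hw : IsAdmissible m G w) (f : NeumannSpace m G) :
    ∫⁻ ξ, ‖realTrace f ξ‖ₑ ^ 2 ∂(refMeasure m G w) ≤
      ENNReal.ofReal (traceConst m w * ‖f‖ ^ 2) := by
  refine (lintegral_mono_ae ?_).trans (lintegral_sqTrace_refMeasure_le hw f)
  filter_upwards [ae_sqTrace_lt_top hw f] with ξ hξ
  obtain ⟨c, hc, hle⟩ := exists_trace_eq hξ
  rw [realTrace, hc, EReal.toReal_coe, Real.enorm_eq_ofReal_abs,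
    ← ENNReal.ofReal_pow (abs_nonneg _), sq_abs]
  exact hle

lemma memLp_realTrace (hw : IsAdmissible m G w) (f : NeumannSpace m G) :
    MemLp (realTrace f) 2 (refMeasure m G w) := by
  refine ⟨aestronglyMeasurable_realTrace hw f, ?_⟩
  rw [eLpNorm_lt_top_iff_lintegral_rpow_enorm_lt_top (by norm_num) (by norm_num)]
  simpa using (lintegral_realTrace_le hw f).trans_lt ENNReal.ofReal_lt_top

lemma isTrace_toLp (hw : IsAdmissible m G w) (f : NeumannSpace m G) :
    IsTrace G w (toEll2 f) ((memLp_realTrace hw f).toLp _) := by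
  unfold IsTrace
  filter_upwards [ae_sqTrace_lt_top hw f, (memLp_realTrace hw f).coeFn_toLp] with ξ hlt hcoe
  rw [hcoe, coe_realTrace hlt]

lemma isTrace_iff_eq (hw : IsAdmissible m G w) {f : NeumannSpace m G} {φ : BoundaryL2 m G w} :
    IsTrace G w (toEll2 f) φ ↔ φ = (memLp_realTrace hw f).toLp _ := by
  constructor
  · intro h
    refine Lp.ext ?_
    filter_upwards [h, isTrace_toLp hw f] with ξ hφ hf
    exact EReal.coe_eq_coe_iff.1 (hφ.trans hf.symm)
  · rintro rfl
    exact isTrace_toLp hw f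

lemma norm_toLp_realTrace_le (hw : IsAdmissible m G w) (f : NeumannSpace m G) :
    ‖(memLp_realTrace hw f).toLp _‖ ≤ √(traceConst m w) * ‖f‖ := by
  have hsq : eLpNorm (realTrace f) 2 (refMeasure m G w) ^ 2 ≤
      ENNReal.ofReal (traceConst m w * ‖f‖ ^ 2) := by
    refine le_of_eq_of_le ?_ (lintegral_realTrace_le hw f)
    simpa using eLpNorm_nnreal_pow_eq_lintegral (p := 2) (f := realTrace f)
      (μ := refMeasure m G w) (by norm_num)
  have hreal := ENNReal.toReal_mono ENNReal.ofReal_ne_top hsq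
  rw [ENNReal.toReal_pow, ENNReal.toReal_ofReal (mul_nonneg traceConst_nonneg (sq_nonneg _))]
    at hreal
  rw [Lp.norm_toLp]
  refine abs_le_of_sq_le_sq' ?_ (by positivity) |>.2
  rwa [mul_pow, Real.sq_sqrt traceConst_nonneg]

lemma IsTrace.add {f g : NeumannSpace m G} {φ ψ : BoundaryL2 m G w}
    (hf : IsTrace G w (toEll2 f) φ) (hg : IsTrace G w (toEll2 g) ψ) :
    IsTrace G w (toEll2 (f + g)) (φ + ψ) := by
  unfold IsTrace at *
  filter_upwards [hf, hg, Lp.coeFn_add φ ψ] with ξ hfξ hgξ hadd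
  rw [hadd, Pi.add_apply]
  refine (trace_eq_coe_iff.2 ?_).symm
  exact ((trace_eq_coe_iff.1 hfξ.symm).add (trace_eq_coe_iff.1 hgξ.symm)).congr fun x =>
    (neumann_add_apply f g x).symm

lemma IsTrace.smul (a : ℝ) {f : NeumannSpace m G} {φ : BoundaryL2 m G w}
    (hf : IsTrace G w (toEll2 f) φ) : IsTrace G w (toEll2 (a • f)) (a • φ) := by
  unfold IsTrace at *
  filter_upwards [hf, Lp.coeFn_smul a φ] with ξ hfξ hsmul
  rw [hsmul, Pi.smul_apply, smul_eq_mul]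
  refine (trace_eq_coe_iff.2 ?_).symm
  exact ((trace_eq_coe_iff.1 hfξ.symm).const_mul a).congr fun x => (neumann_smul_apply a f x).symm

lemma IsTrace.neumannComp {C : ℝ → ℝ} (hC : LipschitzWith 1 C) (h0 : C 0 = 0)
    {f : NeumannSpace m G} {φ : BoundaryL2 m G w} (hf : IsTrace G w (toEll2 f) φ) :
    IsTrace G w (toEll2 (neumannComp hC h0 f)) (hC.compLp h0 φ) := by
  unfold IsTrace at *
  filter_upwards [hf, hC.coeFn_compLp h0 φ] with ξ hfξ hcomp
  rw [hcomp, Function.comp_apply]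
  refine (trace_eq_coe_iff.2 ?_).symm
  exact ((hC.continuous.tendsto _).comp (trace_eq_coe_iff.1 hfξ.symm)).congr fun x =>
    (neumannComp_apply hC h0 f x).symm

/-- The trace operator `γ : D(Q^(N)) → L²(∂X)`. -/
def traceOp (hw : IsAdmissible m G w) : NeumannSpace m G →L[ℝ] BoundaryL2 m G w :=
  LinearMap.mkContinuous
    { toFun := fun f => (memLp_realTrace hw f).toLp _
      map_add' := fun f g =>
        ((isTrace_iff_eq hw).1 ((isTrace_toLp hw f).add (isTrace_toLp hw g))).symm
      map_smul' := fun a f => ((isTrace_iff_eq hw).1 ((isTrace_toLp hw f).smul a)).symm }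
    (√(traceConst m w)) (norm_toLp_realTrace_le hw)

lemma isTrace_iff (hw : IsAdmissible m G w) {f : NeumannSpace m G} {φ : BoundaryL2 m G w} :
    IsTrace G w (toEll2 f) φ ↔ φ = traceOp hw f := isTrace_iff_eq hw

lemma isTrace_traceOp (hw : IsAdmissible m G w) (f : NeumannSpace m G) :
    IsTrace G w (toEll2 f) (traceOp hw f) := isTrace_toLp hw f

lemma traceOp_neumannComp (hw : IsAdmissible m G w) {C : ℝ → ℝ} (hC : LipschitzWith 1 C)
    (h0 : C 0 = 0) (f : NeumannSpace m G) :
    traceOp hw (neumannComp hC h0 f) = hC.compLp h0 (traceOp hw f) :=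
  ((isTrace_iff hw).1 ((isTrace_traceOp hw f).neumannComp hC h0)).symm

lemma eq_zero_of_connected {u : NeumannSpace m G} (hu : u ∈ (dirichletSubspace m G)ᗮ)
    (hpos : ∀ x, 0 ≤ u x) {x y : X} (hxy : G.Connected x y) (hy : u y = 0) : u x = 0 := by
  refine Relation.ReflTransGen.head_induction_on hxy hy fun {a c} hac _ hc => ?_
  have hharm := mem_dirichletSubspace_orthogonal_iff.1 hu c
  simp only [inner_neumannDelta, hc, mul_zero, add_zero, zero_sub, mul_neg, tsum_neg,
    neg_eq_zero] at hharm
  have hsummable := (summable_row_mul_abs u c).congr fun z => by rw [abs_of_nonneg (hpos z)]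
  have hrow := (hasSum_zero_iff_of_nonneg fun z => mul_nonneg (G.nonneg c z) (hpos z)).1
    (hharm ▸ hsummable.hasSum)
  exact (mul_eq_zero.1 (congrFun hrow a)).resolve_left (G.symm a c ▸ hac.ne')

lemma harmonicPart_eq_integral_abs {f : BddDom m G} {a : NeumannSpace m G}
    (ha : ∀ x, a x = |f.1 x|) (x : X) :
    harmonicPart a x = ∫ ξ, |Royden.extend f ξ.1| ∂(harmonicMeasure m G x) := by
  have ha_bdd : ∃ K : ℝ, ∀ x, |a x| ≤ K := by simpa only [ha, abs_abs] using f.2.2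
  have habs (ξ : Boundary m G) :
      Royden.extend (.ofNeumann a ha_bdd) ξ.1 = |Royden.extend f ξ.1| :=
    extend_eq_of_tendsto ((tendsto_extend f ξ.1).abs.congr fun x => (ha x).symm)
  simp only [← habs]
  exact (integral_extend (.ofNeumann a ha_bdd) x).symm

variable [Countable X]

lemma mem_dirichletSubspace_of_ae_zero (hw : IsAdmissible m G w) (f : BddDom m G)
    (h : ∀ᵐ ξ ∂(refMeasure m G w), Royden.extend f ξ.1 = 0) :
    f.toNeumann ∈ dirichletSubspace m G := by
  set a := neumannComp lipschitzWith_one_norm norm_zero f.toNeumann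
  have ha := harmonicPart_eq_integral_abs (neumannComp_apply lipschitzWith_one_norm norm_zero
    f.toNeumann)
  have hpos (x : X) : 0 ≤ harmonicPart a x := ha x ▸ integral_nonneg fun ξ => abs_nonneg _
  rw [refMeasure, Measure.ae_sum_iff] at h
  have hzero (x : X) : harmonicPart a x = 0 := by
    obtain ⟨y, hxy, hy⟩ := hw.meets x
    refine eq_zero_of_connected (harmonicPart_mem a) hpos hxy ((ha y).trans ?_)
    have hae := h y
    rw [Measure.ae_ennreal_smul_measure_iff (ENNReal.coe_ne_zero.2 hy.ne')] at hae
    refine integral_eq_zero_of_ae (hae.mono fun ξ hξ => ?_)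
    exact abs_eq_zero.2 hξ
  rw [← harmonicPart_eq_zero_iff]
  refine neumann_ext fun x => ?_
  rw [neumann_zero_apply, ← integral_extend, ← abs_nonpos_iff]
  exact abs_integral_le_integral_abs.trans ((ha x).symm.trans (hzero x)).le

lemma traceOp_eq_zero_iff (hw : IsAdmissible m G w) {f : NeumannSpace m G} :
    traceOp hw f = 0 ↔ f ∈ dirichletSubspace m G := by
  rw [eq_comm, ← isTrace_iff]
  constructor
  · intro h
    refine mem_dirichletSubspace_of_bounded (u := fun n : ℕ => neumannClamp n f)
      (fun n => norm_neumannClamp_le n f) (fun n => ?_) (tendsto_neumannClamp f)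
    refine mem_dirichletSubspace_of_ae_zero hw (bddClamp n f) ?_
    filter_upwards [h, Lp.coeFn_zero ℝ 2 (refMeasure m G w)] with ξ htrace hzero
    rw [hzero, Pi.zero_apply] at htrace
    exact (truncTrace_of_trace_eq htrace.symm n).trans (clamp_neg_self_zero n.cast_nonneg)
  · intro h
    unfold IsTrace
    filter_upwards [Lp.coeFn_zero ℝ 2 (refMeasure m G w)] with ξ hzero
    rw [hzero, Pi.zero_apply]
    exact (trace_eq_coe_iff.2 (tendsto_zero_of_mem_dirichletSubspace h ξ)).symm

lemma traceOp_eq_iff (hw : IsAdmissible m G w) {f g : NeumannSpace m G} :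
    traceOp hw f = traceOp hw g ↔ harmonicPart f = harmonicPart g := by
  rw [← sub_eq_zero, ← map_sub, traceOp_eq_zero_iff, ← harmonicPart_eq_zero_iff, map_sub,
    sub_eq_zero]

lemma traceOp_harmonicPart (hw : IsAdmissible m G w) (f : NeumannSpace m G) :
    traceOp hw (harmonicPart f) = traceOp hw f :=
  (traceOp_eq_iff hw).2 (harmonicPart_eq_self (harmonicPart_mem f))

lemma harmonicExt_traceOp (hw : IsAdmissible m G w) (f : NeumannSpace m G) :
    harmonicExt G w (traceOp hw f) = toEll2 (harmonicPart f) := by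
  have hex : ∃ u : ell2 m, u ∈ (neumannForm m G).dom ∧ IsHarmonic m G u ∧
      IsTrace G w u (traceOp hw f) :=
    ⟨toEll2 (harmonicPart f), Form.incl_mem _ _, isHarmonic_iff.2 (harmonicPart_mem f), by
      rw [← traceOp_harmonicPart]; exact isTrace_traceOp hw _⟩
  rw [harmonicExt, dif_pos hex]
  obtain ⟨hdom, hharm, htrace⟩ := hex.choose_spec
  obtain ⟨u, hu⟩ := exists_toEll2_eq hdom
  rw [← hu] at hharm htrace ⊢
  rw [isTrace_iff hw, traceOp_eq_iff, harmonicPart_eq_self (isHarmonic_iff.1 hharm)] at htrace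
  rw [htrace]

end TraceOperator

/-! ### The trace form -/

section TraceForm

variable {X : Type*} [MeasurableSpace X] [DiscreteMeasurableSpace X]
  {m : X → Ioi (0 : ℝ)} {G : WGraph X} {w : X → ℝ≥0}

lemma val_toEll2 (f : NeumannSpace m G) :
    (neumannForm m G).val (toEll2 f) = ENNReal.ofReal (energy G f) :=
  (neumannForm m G).val_of_mem ((neumannForm m G).toSpace.symm f)

lemma toReal_val_toEll2 (f : NeumannSpace m G) :
    ((neumannForm m G).val (toEll2 f)).toReal = energy G f :=
  (neumannForm m G).toReal_val ((neumannForm m G).toSpace.symm f)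

lemma dirichletForm_val_toEll2 {f : NeumannSpace m G} (hf : f ∈ dirichletSubspace m G) :
    (dirichletForm m G).val (toEll2 f) = (neumannForm m G).val (toEll2 f) := by
  rw [(dirichletForm m G).val_of_mem ⟨_, mem_dirichletSubspace_iff.1 hf⟩, val_toEll2]
  rfl

lemma extends_dirichletForm_iff {Q : Form (ell2 m)} :
    Q.Extends (dirichletForm m G) ↔ ∀ f ∈ dirichletSubspace m G,
      Q.val (toEll2 f) = (neumannForm m G).val (toEll2 f) := by
  rw [Form.extends_iff]
  refine ⟨fun h f hf => (h _ (mem_dirichletSubspace_iff.1 hf)).trans (dirichletForm_val_toEll2 hf),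
    fun h f hf => ?_⟩
  obtain ⟨f, rfl⟩ := exists_toEll2_eq hf.1
  have hf' := mem_dirichletSubspace_iff.2 hf
  rw [h f hf', dirichletForm_val_toEll2 hf']

lemma neumannForm_val_le_of_extends {Q : Form (ell2 m)} (hQ : Q.IsClosed) (hM : Q.IsMarkovian)
    (hd : finSupp m ≤ Q.dom) (h : Q.Extends (dirichletForm m G)) :
    (neumannForm m G).val ≤ Q.val := by
  intro f
  by_cases hf : f ∈ Q.dom
  · rw [Q.val_of_mem ⟨f, hf⟩,
      (neumannForm m G).val_of_mem ⟨f, dom_le_neumann_of_extends hQ hM hd h hf⟩]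
    exact ENNReal.ofReal_le_ofReal (energy_le_of_extends hQ hM hd h ⟨f, hf⟩)
  · exact (Q.val_of_notMem hf).symm ▸ le_top

variable [Countable X] (hw : IsAdmissible m G w)

include hw

lemma dnForm_traceOp (f : NeumannSpace m G) :
    dnForm m G w (traceOp hw f) = ENNReal.ofReal (‖harmonicPart f‖ ^ 2) := by
  rw [dnForm, traceForm, if_pos ⟨toEll2 f, Form.incl_mem _ _, isTrace_traceOp hw f⟩,
    harmonicExt_traceOp]
  exact (neumannForm m G).val₁_of_mem ((neumannForm m G).toSpace.symm (harmonicPart f))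

lemma toReal_dnForm_traceOp (f : NeumannSpace m G) :
    (dnForm m G w (traceOp hw f)).toReal = ‖harmonicPart f‖ ^ 2 := by
  rw [dnForm_traceOp, ENNReal.toReal_ofReal (sq_nonneg _)]

lemma dnForm_zero : dnForm m G w 0 = 0 := by
  simpa using dnForm_traceOp hw 0

omit [Countable X] in
lemma exists_traceOp_eq_of_dnForm_ne_top {φ : BoundaryL2 m G w} (h : dnForm m G w φ ≠ ⊤) :
    ∃ f, traceOp hw f = φ := by
  by_contra hc
  refine h ?_
  rw [dnForm, traceForm, if_neg]
  rintro ⟨f, hf, hφ⟩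
  obtain ⟨f, rfl⟩ := exists_toEll2_eq hf
  exact hc ⟨f, ((isTrace_iff hw).1 hφ).symm⟩

lemma toReal_dnForm_comp_le {C : ℝ → ℝ} (hC : LipschitzWith 1 C) (h0 : C 0 = 0)
    (f : NeumannSpace m G) :
    (dnForm m G w (hC.compLp h0 (traceOp hw f))).toReal ≤ (dnForm m G w (traceOp hw f)).toReal := by
  have hcomp : hC.compLp h0 (traceOp hw f) = traceOp hw (neumannComp hC h0 (harmonicPart f)) := by
    rw [traceOp_neumannComp, traceOp_harmonicPart]
  rw [hcomp, toReal_dnForm_traceOp, toReal_dnForm_traceOp]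
  gcongr
  exact (norm_harmonicPart_le _).trans (norm_neumannComp_le _ _ _)

omit hw [Countable X] in
/-- The `1`-harmonic functions in `D(Q) ∩ D(Q^(N))`. -/
def harmonicDom (G : WGraph X) (Q : Form (ell2 m)) : Submodule ℝ (NeumannSpace m G) :=
  Q.dom.comap (toEll2 (m := m) (G := G)).toLinearMap ⊓ (dirichletSubspace m G)ᗮ

omit hw [Countable X] in
lemma mem_harmonicDom_iff {Q : Form (ell2 m)} {u : NeumannSpace m G} :
    u ∈ harmonicDom G Q ↔ toEll2 u ∈ Q.dom ∧ u ∈ (dirichletSubspace m G)ᗮ := Iff.rfl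

lemma traceOp_domRestrict_injective (Q : Form (ell2 m)) :
    Function.Injective ((traceOp hw).toLinearMap.domRestrict (harmonicDom G Q)) := fun u v huv => by
  have h : harmonicPart (u : NeumannSpace m G) = harmonicPart (v : NeumannSpace m G) :=
    (traceOp_eq_iff hw).1 huv
  rw [harmonicPart_eq_self u.2.2, harmonicPart_eq_self v.2.2] at h
  exact Subtype.ext h

/-- The `1`-harmonic extension `φ ↦ H φ` on the traces of the functions in `harmonicDom G Q`. -/
def harmonicLift (Q : Form (ell2 m)) :
    ((traceOp hw).toLinearMap.domRestrict (harmonicDom G Q)).range ≃ₗ[ℝ] harmonicDom G Q :=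
  (LinearEquiv.ofInjective _ (traceOp_domRestrict_injective hw Q)).symm

/-- The map `φ ↦ H φ` with values in the form space of `Q`. -/
def traceLift (Q : Form (ell2 m)) :
    ((traceOp hw).toLinearMap.domRestrict (harmonicDom G Q)).range →ₗ[ℝ] Q.Space :=
  Q.toSpace.toLinearMap ∘ₗ LinearMap.codRestrict Q.dom
    ((toEll2 (m := m) (G := G)).toLinearMap ∘ₗ (harmonicDom G Q).subtype ∘ₗ
      (harmonicLift hw Q).toLinearMap) fun φ => (harmonicLift hw Q φ).2.1

/-- The trace form `Tr Q` as a form: `Tr Q (φ, ψ) = Q₁(H φ, H ψ)`. -/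
@[reducible] def inducedTraceForm (Q : Form (ell2 m)) : Form (BoundaryL2 m G w) where
  dom := ((traceOp hw).toLinearMap.domRestrict (harmonicDom G Q)).range
  bilin := (innerₗ Q.Space).compl₁₂ (traceLift hw Q) (traceLift hw Q)
  symm φ ψ := by
    simp only [LinearMap.compl₁₂_apply, innerₗ_apply_apply]
    rw [real_inner_comm]
  nonneg φ := by
    simp only [LinearMap.compl₁₂_apply, innerₗ_apply_apply]
    exact real_inner_self_nonneg

variable {Q : Form (ell2 m)}

lemma traceOp_mem_inducedTraceForm {u : NeumannSpace m G} (hu : u ∈ harmonicDom G Q) :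
    traceOp hw u ∈ (inducedTraceForm hw Q).dom := ⟨⟨u, hu⟩, rfl⟩

lemma exists_traceOp_eq_of_mem_inducedTraceForm {φ : BoundaryL2 m G w}
    (hφ : φ ∈ (inducedTraceForm hw Q).dom) : ∃ u ∈ harmonicDom G Q, traceOp hw u = φ := by
  obtain ⟨⟨u, hu⟩, rfl⟩ := hφ
  exact ⟨u, hu, rfl⟩

lemma traceLift_traceOp {u : NeumannSpace m G} (hu : u ∈ harmonicDom G Q) :
    traceLift hw Q ⟨traceOp hw u, traceOp_mem_inducedTraceForm hw hu⟩ =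
      Q.toSpace ⟨toEll2 u, hu.1⟩ := by
  have hlift : harmonicLift hw Q ⟨traceOp hw u, traceOp_mem_inducedTraceForm hw hu⟩ = ⟨u, hu⟩ :=
    (LinearEquiv.symm_apply_eq _).2 rfl
  refine congrArg Q.toSpace (Subtype.ext ?_)
  change toEll2 (harmonicLift hw Q _ : NeumannSpace m G) = toEll2 u
  rw [hlift]

lemma inducedTraceForm_bilin_self (φ : (inducedTraceForm hw Q).dom) :
    (inducedTraceForm hw Q).bilin φ φ = ‖traceLift hw Q φ‖ ^ 2 :=
  real_inner_self_eq_norm_sq (traceLift hw Q φ)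

lemma inducedTraceForm_val_traceOp {u : NeumannSpace m G} (hu : u ∈ harmonicDom G Q) :
    (inducedTraceForm hw Q).val (traceOp hw u) = Q.val₁ (toEll2 u) := by
  rw [(inducedTraceForm hw Q).val_of_mem ⟨_, traceOp_mem_inducedTraceForm hw hu⟩,
    inducedTraceForm_bilin_self, traceLift_traceOp hw hu, ← Q.val₁_of_mem]

lemma dnForm_le_inducedTraceForm (hle : (neumannForm m G).val ≤ Q.val) (φ : BoundaryL2 m G w) :
    dnForm m G w φ ≤ (inducedTraceForm hw Q).val φ := by
  by_cases hφ : φ ∈ (inducedTraceForm hw Q).dom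
  · obtain ⟨u, hu, rfl⟩ := exists_traceOp_eq_of_mem_inducedTraceForm hw hφ
    rw [inducedTraceForm_val_traceOp hw hu, dnForm_traceOp, harmonicPart_eq_self hu.2,
      neumann_norm_sq, ENNReal.ofReal_add (energy_nonneg _) (sq_nonneg _), Form.val₁, ← val_toEll2]
    gcongr
    exact hle _
  · exact (Form.val_of_notMem _ hφ).symm ▸ le_top

/-- The graph of `φ ↦ H φ` is closed because `H` is inverse to the bounded operator `γ`. -/
lemma isClosed_range_traceLift (hle : (neumannForm m G).val ≤ Q.val) :
    IsClosed (range fun φ : (inducedTraceForm hw Q).dom =>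
      ((φ : BoundaryL2 m G w), traceLift hw Q φ)) := by
  set J : Q.Space →L[ℝ] NeumannSpace m G := Form.spaceInclusion hle
  have hrange : range (fun φ : (inducedTraceForm hw Q).dom => ((φ : BoundaryL2 m G w),
      traceLift hw Q φ)) = {p | J p.2 ∈ (dirichletSubspace m G)ᗮ} ∩
        {p | traceOp hw (J p.2) = p.1} := by
    ext ⟨φ, f⟩
    constructor
    · rintro ⟨⟨φ, hφ⟩, ⟨⟩⟩
      obtain ⟨u, hu, rfl⟩ := exists_traceOp_eq_of_mem_inducedTraceForm hw hφ
      have hJ : J (traceLift hw Q ⟨traceOp hw u, traceOp_mem_inducedTraceForm hw hu⟩) = u := by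
        rw [traceLift_traceOp hw hu]
        rfl
      refine ⟨?_, congrArg (traceOp hw) hJ⟩
      change J (traceLift hw Q _) ∈ (dirichletSubspace m G)ᗮ
      rw [hJ]
      exact hu.2
    · rintro ⟨horth, rfl : traceOp hw (J f) = φ⟩
      have hmem : J f ∈ harmonicDom G Q := ⟨Q.incl_mem f, horth⟩
      exact ⟨⟨_, traceOp_mem_inducedTraceForm hw hmem⟩,
        Prod.ext rfl (traceLift_traceOp hw hmem)⟩
  rw [hrange]
  exact ((Submodule.isClosed_orthogonal _).preimage (by fun_prop)).inter
    (isClosed_eq (by fun_prop) continuous_fst)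

lemma inducedTraceForm_isClosed (hle : (neumannForm m G).val ≤ Q.val) (hQ : Q.IsClosed) :
    (inducedTraceForm hw Q).IsClosed := by
  have : CompleteSpace Q.Space := Q.isClosed_iff_completeSpace.1 hQ
  have hnorm (φ : (inducedTraceForm hw Q).dom) :
      ‖traceLift hw Q φ‖ ≤ 1 * ‖(inducedTraceForm hw Q).toSpace φ‖ := by
    rw [one_mul]
    refine abs_le_of_sq_le_sq' ?_ (norm_nonneg _) |>.2
    rw [Form.norm_sq_toSpace, inducedTraceForm_bilin_self]
    exact le_add_of_nonneg_right (sq_nonneg _)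
  exact (inducedTraceForm hw Q).isClosed_of_isClosed_graph (traceLift hw Q) hnorm (K' := 1)
    (fun φ => ((inducedTraceForm_bilin_self hw φ).trans (one_mul _).symm).le)
    (isClosed_range_traceLift hw hle)

section Extension

variable (h : Q.Extends (dirichletForm m G))

include h

omit hw [Countable X] in
lemma toEll2_mem_of_mem_dirichletSubspace {f : NeumannSpace m G}
    (hf : f ∈ dirichletSubspace m G) : toEll2 f ∈ Q.dom :=
  h.choose (mem_dirichletSubspace_iff.1 hf)

omit hw [Countable X] in
lemma harmonicPart_mem_harmonicDom_iff {f : NeumannSpace m G} :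
    harmonicPart f ∈ harmonicDom G Q ↔ toEll2 f ∈ Q.dom := by
  have hsub := toEll2_mem_of_mem_dirichletSubspace h (sub_harmonicPart_mem f)
  rw [map_sub] at hsub
  rw [mem_harmonicDom_iff, and_iff_left (harmonicPart_mem f),
    ← Q.dom.add_mem_iff_right hsub, sub_add_cancel]

lemma traceOp_mem_inducedTraceForm_iff {f : NeumannSpace m G} :
    traceOp hw f ∈ (inducedTraceForm hw Q).dom ↔ toEll2 f ∈ Q.dom := by
  rw [← harmonicPart_mem_harmonicDom_iff h, ← traceOp_harmonicPart]
  refine ⟨fun hf => ?_, traceOp_mem_inducedTraceForm hw⟩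
  obtain ⟨u, hu, htrace⟩ := exists_traceOp_eq_of_mem_inducedTraceForm hw hf
  have hharm := (traceOp_eq_iff hw).1 htrace
  rw [harmonicPart_eq_self hu.2, harmonicPart_eq_self (harmonicPart_mem f)] at hharm
  exact hharm ▸ hu

lemma inducedTraceForm_val (hdom : Q.dom ≤ (neumannForm m G).dom) :
    (inducedTraceForm hw Q).val = traceForm G w Q := by
  funext φ
  by_cases hφ : φ ∈ (inducedTraceForm hw Q).dom
  · obtain ⟨u, hu, rfl⟩ := exists_traceOp_eq_of_mem_inducedTraceForm hw hφ
    rw [inducedTraceForm_val_traceOp hw hu, traceForm,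
      if_pos ⟨toEll2 u, hu.1, isTrace_traceOp hw u⟩, harmonicExt_traceOp,
      harmonicPart_eq_self hu.2]
  · rw [(inducedTraceForm hw Q).val_of_notMem hφ, traceForm, if_neg]
    rintro ⟨f, hf, htrace⟩
    obtain ⟨f, rfl⟩ := exists_toEll2_eq (hdom hf)
    rw [(isTrace_iff hw).1 htrace] at hφ
    exact hφ ((traceOp_mem_inducedTraceForm_iff hw h).2 hf)

/-- Both `Q - Q^(N)` and `Tr Q - q^{DN}` only see the `1`-harmonic part, as `Q` and `Q^(N)` agree
on `D(Q^(D))`. -/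
lemma toReal_inducedTraceForm_sub_dnForm (hle : (neumannForm m G).val ≤ Q.val)
    {f : NeumannSpace m G} (hf : toEll2 f ∈ Q.dom) :
    ((inducedTraceForm hw Q).val (traceOp hw f)).toReal - (dnForm m G w (traceOp hw f)).toReal =
      (Q.val (toEll2 f)).toReal - energy G f := by
  have hharm := (harmonicPart_mem_harmonicDom_iff h).2 hf
  have hsub := sub_harmonicPart_mem f
  have hmem := (mem_harmonicDom_iff.1 hharm).1
  have hadd := Form.toReal_val_add_sub_of_val_eq hle hmem
    (toEll2_mem_of_mem_dirichletSubspace h hsub) (extends_dirichletForm_iff.1 h _ hsub)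
  have hsum : toEll2 (harmonicPart f) + toEll2 (f - harmonicPart f) = toEll2 f := by
    rw [← map_add, add_sub_cancel]
  rw [hsum, toReal_val_toEll2, toReal_val_toEll2] at hadd
  rw [toReal_dnForm_traceOp, ← traceOp_harmonicPart, inducedTraceForm_val_traceOp hw hharm,
    Form.val₁, ENNReal.toReal_add (Q.mem_dom_iff.1 hmem) ENNReal.ofReal_ne_top,
    ENNReal.toReal_ofReal (sq_nonneg _), neumann_norm_sq, hadd]
  ring

variable (hQ : Q.IsClosed) (hM : Q.IsMarkovian) (hd : finSupp m ≤ Q.dom)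

include hQ hM hd

lemma inducedTraceForm_sub_comp_le {C : ℝ → ℝ} (hC : LipschitzWith 1 C) (h0 : C 0 = 0)
    {φ : BoundaryL2 m G w} (hφ : φ ∈ (inducedTraceForm hw Q).dom) :
    hC.compLp h0 φ ∈ (inducedTraceForm hw Q).dom ∧
      ((inducedTraceForm hw Q).val (hC.compLp h0 φ)).toReal -
          (dnForm m G w (hC.compLp h0 φ)).toReal ≤
        ((inducedTraceForm hw Q).val φ).toReal - (dnForm m G w φ).toReal := by
  obtain ⟨f, -, rfl⟩ := exists_traceOp_eq_of_mem_inducedTraceForm hw hφ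
  have hle := neumannForm_val_le_of_extends hQ hM hd h
  have hf := (traceOp_mem_inducedTraceForm_iff hw h).1 hφ
  have hCf : toEll2 (neumannComp hC h0 f) ∈ Q.dom := by
    rw [toEll2_neumannComp]
    exact hM.comp_mem hC h0 ⟨toEll2 f, hf⟩
  rw [← traceOp_neumannComp, toReal_inducedTraceForm_sub_dnForm hw h hle hf,
    toReal_inducedTraceForm_sub_dnForm hw h hle hCf, Q.toReal_val ⟨_, hf⟩, Q.toReal_val ⟨_, hCf⟩]
  refine ⟨(traceOp_mem_inducedTraceForm_iff hw h).2 hCf, ?_⟩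
  simp only [toEll2_neumannComp]
  exact sub_energy_comp_le hQ hM hd h hC h0 ⟨toEll2 f, hf⟩

lemma inducedTraceForm_isMarkovian : (inducedTraceForm hw Q).IsMarkovian := by
  intro C hC h0 φ
  by_cases hφ : φ ∈ (inducedTraceForm hw Q).dom
  · obtain ⟨hmem, hsub⟩ := inducedTraceForm_sub_comp_le hw h hQ hM hd hC h0 hφ
    rw [← ENNReal.toReal_le_toReal (Form.mem_dom_iff _ |>.1 hmem) (Form.mem_dom_iff _ |>.1 hφ)]
    obtain ⟨f, -, rfl⟩ := exists_traceOp_eq_of_mem_inducedTraceForm hw hφ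
    linarith [toReal_dnForm_comp_le hw hC h0 f]
  · exact (Form.val_of_notMem _ hφ).symm ▸ le_top

lemma inducedTraceForm_mem_traceForms : inducedTraceForm hw Q ∈ traceForms m G w :=
  have hle := neumannForm_val_le_of_extends hQ hM hd h
  ⟨⟨inducedTraceForm_isClosed hw hle hQ, inducedTraceForm_isMarkovian hw h hQ hM hd⟩,
    dnForm_le_inducedTraceForm hw hle,
    fun _ hC h0 _ => inducedTraceForm_sub_comp_le hw h hQ hM hd hC h0⟩

lemma inducedTraceForm_represents : Represents G w (inducedTraceForm hw Q) Q := by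
  have hle := neumannForm_val_le_of_extends hQ hM hd h
  refine ⟨Form.dom_le_of_val_le hle, fun f hf => ?_⟩
  obtain ⟨f, rfl⟩ := exists_toEll2_eq (Form.dom_le_of_val_le hle hf)
  refine ⟨traceOp hw f, (traceOp_mem_inducedTraceForm_iff hw h).2 hf, isTrace_traceOp hw f, ?_⟩
  rw [toReal_val_toEll2]
  linarith [toReal_inducedTraceForm_sub_dnForm hw h hle hf]

end Extension

theorem exists_traceForm_of_extends (hQ : Q ∈ discreteForms m)
    (h : Q.Extends (dirichletForm m G)) :
    ∃ q ∈ traceForms m G w, q.val = traceForm G w Q ∧ Represents G w q Q := by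
  obtain ⟨⟨-, hclosed, hM⟩, hd⟩ := hQ
  exact ⟨inducedTraceForm hw Q, inducedTraceForm_mem_traceForms hw h hclosed hM hd,
    inducedTraceForm_val hw h (dom_le_neumann_of_extends hclosed hM hd h),
    inducedTraceForm_represents hw h hclosed hM hd⟩

end TraceForm

/-! ### Forms with a given trace -/

section Correspondence

variable {X : Type*} [MeasurableSpace X] [DiscreteMeasurableSpace X] [Countable X]
  {m : X → Ioi (0 : ℝ)} {G : WGraph X} {w : X → ℝ≥0} (hw : IsAdmissible m G w)

include hw

lemma Represents.val_toEll2 {Q : Form (ell2 m)} {q : Form (BoundaryL2 m G w)}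
    (hr : Represents G w q Q) {f : NeumannSpace m G} (hf : f ∈ dirichletSubspace m G)
    (hfQ : toEll2 f ∈ Q.dom) : Q.val (toEll2 f) = (neumannForm m G).val (toEll2 f) := by
  obtain ⟨φ, -, htrace, hval⟩ := hr.2 _ hfQ
  rw [isTrace_iff hw, (traceOp_eq_zero_iff hw).2 hf] at htrace
  rw [htrace, q.val_zero, dnForm_zero hw, ENNReal.toReal_zero, add_zero, sub_zero] at hval
  exact (ENNReal.toReal_eq_toReal_iff' (Q.mem_dom_iff.1 hfQ)
    ((neumannForm m G).mem_dom_iff.1 (Form.incl_mem _ f))).1 hval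

theorem extends_of_represents {Q : Form (ell2 m)} (hQ : Q.IsClosed) (hd : finSupp m ≤ Q.dom)
    {q : Form (BoundaryL2 m G w)} (hr : Represents G w q Q) : Q.Extends (dirichletForm m G) := by
  refine extends_dirichletForm_iff.2 fun f hf => hr.val_toEll2 hw hf ?_
  refine hQ.incl_mem_of_mem_topologicalClosure (fun g hg => ?_) hf
  exact (hr.val_toEll2 hw (mem_dirichletSubspace_of_finSupp hg) (hd hg)).le

lemma val_le_of_inducedTraceForm_eq {Q Q' : Form (ell2 m)} (hle : (neumannForm m G).val ≤ Q.val)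
    (hle' : (neumannForm m G).val ≤ Q'.val) (h : Q.Extends (dirichletForm m G))
    (h' : Q'.Extends (dirichletForm m G)) (heq : inducedTraceForm hw Q = inducedTraceForm hw Q') :
    Q.val ≤ Q'.val := by
  intro f
  by_cases hf' : f ∈ Q'.dom
  · obtain ⟨f, rfl⟩ := exists_toEll2_eq (Form.dom_le_of_val_le hle' hf')
    have hf : toEll2 f ∈ Q.dom := by
      rwa [← traceOp_mem_inducedTraceForm_iff hw h, heq, traceOp_mem_inducedTraceForm_iff hw h']
    have hsub := toReal_inducedTraceForm_sub_dnForm hw h hle hf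
    rw [heq, toReal_inducedTraceForm_sub_dnForm hw h' hle' hf', sub_left_inj] at hsub
    exact ((ENNReal.toReal_eq_toReal_iff' (Q'.mem_dom_iff.1 hf') (Q.mem_dom_iff.1 hf)).1 hsub).ge
  · exact (Q'.val_of_notMem hf').symm ▸ le_top

theorem eq_of_traceForm_eq {Q Q' : Form (ell2 m)} (hQ : Q ∈ discreteForms m)
    (hQ' : Q' ∈ discreteForms m) (h : Q.Extends (dirichletForm m G))
    (h' : Q'.Extends (dirichletForm m G)) (heq : traceForm G w Q = traceForm G w Q') :
    Q = Q' := by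
  have hle := neumannForm_val_le_of_extends hQ.1.2.1 hQ.1.2.2 hQ.2 h
  have hle' := neumannForm_val_le_of_extends hQ'.1.2.1 hQ'.1.2.2 hQ'.2 h'
  have hinduced : inducedTraceForm hw Q = inducedTraceForm hw Q' := by
    refine Form.val_injective ?_
    rw [inducedTraceForm_val hw h (Form.dom_le_of_val_le hle),
      inducedTraceForm_val hw h' (Form.dom_le_of_val_le hle'), heq]
  exact Form.val_injective (le_antisymm (val_le_of_inducedTraceForm_eq hw hle hle' h h' hinduced)
    (val_le_of_inducedTraceForm_eq hw hle' hle h' h hinduced.symm))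

section Lift

variable (q : Form (BoundaryL2 m G w))

/-- The domain `{f ∈ D(Q^(N)) : γ f ∈ D(q)}` of the form with trace `q`. -/
def liftDom : Submodule ℝ (ell2 m) :=
  (q.dom.comap (traceOp hw).toLinearMap).map (toEll2 (m := m) (G := G)).toLinearMap

omit [Countable X] in
lemma toEll2_mem_liftDom {f : NeumannSpace m G} :
    toEll2 f ∈ liftDom hw q ↔ traceOp hw f ∈ q.dom :=
  ⟨fun ⟨_, hg, heq⟩ => (neumannForm m G).incl_injective heq ▸ hg, fun h => ⟨f, h, rfl⟩⟩

omit [Countable X] in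
lemma liftDom_le : liftDom hw q ≤ (neumannForm m G).dom := by
  rintro _ ⟨g, -, rfl⟩
  exact Form.incl_mem _ g

lemma toEll2_mem_liftDom_of_mem_dirichletSubspace {f : NeumannSpace m G}
    (hf : f ∈ dirichletSubspace m G) : toEll2 f ∈ liftDom hw q := by
  rw [toEll2_mem_liftDom, (traceOp_eq_zero_iff hw).2 hf]
  exact q.dom.zero_mem

lemma finSupp_le_liftDom : finSupp m ≤ liftDom hw q := by
  intro f hf
  obtain ⟨f, rfl⟩ := exists_toEll2_eq (finSupp_le_neumannDom (G := G) hf)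
  exact toEll2_mem_liftDom_of_mem_dirichletSubspace hw q (mem_dirichletSubspace_of_finSupp hf)

/-- The inclusion of `liftDom` into the form space of `Q^(N)`. -/
def liftNeumann : liftDom hw q →ₗ[ℝ] NeumannSpace m G :=
  (neumannForm m G).toSpace.toLinearMap ∘ₗ Submodule.inclusion (liftDom_le hw q)

omit [Countable X] in
lemma toEll2_liftNeumann (f : liftDom hw q) : toEll2 (liftNeumann hw q f) = f := rfl

/-- The trace operator on `liftDom`, with values in `D(q)`. -/
def liftTrace : liftDom hw q →ₗ[ℝ] q.dom :=
  LinearMap.codRestrict q.dom ((traceOp hw).toLinearMap ∘ₗ liftNeumann hw q) fun f =>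
    (toEll2_mem_liftDom hw q (f := liftNeumann hw q f)).1 f.2

variable {q} (hle : dnForm m G w ≤ q.val)

include hle

lemma norm_harmonicPart_sq_le (f : liftDom hw q) :
    ‖harmonicPart (liftNeumann hw q f)‖ ^ 2 ≤ q.bilin (liftTrace hw q f) (liftTrace hw q f) := by
  have h := hle (liftTrace hw q f)
  rw [q.val_of_mem] at h
  exact (ENNReal.ofReal_le_ofReal_iff (q.nonneg _)).1 ((dnForm_traceOp hw _).symm.trans_le h)

/-- The form `Q^(N)(f) + q(γ f) - q^{DN}(γ f)`, where `q^{DN}(γ f)` is the squared norm of the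
`1`-harmonic part of `f`. -/
@[reducible] def liftForm : Form (ell2 m) where
  dom := liftDom hw q
  bilin := (neumannForm m G).bilin.compl₁₂ (Submodule.inclusion (liftDom_le hw q))
      (Submodule.inclusion (liftDom_le hw q)) +
        q.bilin.compl₁₂ (liftTrace hw q) (liftTrace hw q) -
      (innerₗ (NeumannSpace m G)).compl₁₂
        ((harmonicPart (m := m) (G := G)).toLinearMap ∘ₗ liftNeumann hw q)
        ((harmonicPart (m := m) (G := G)).toLinearMap ∘ₗ liftNeumann hw q)
  symm f g := by
    simp only [LinearMap.sub_apply, LinearMap.add_apply, LinearMap.compl₁₂_apply,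
      innerₗ_apply_apply]
    rw [(neumannForm m G).symm, q.symm, real_inner_comm]
  nonneg f := by
    simp only [LinearMap.sub_apply, LinearMap.add_apply, LinearMap.compl₁₂_apply,
      innerₗ_apply_apply, real_inner_self_eq_norm_sq]
    exact sub_nonneg.2 ((norm_harmonicPart_sq_le hw hle f).trans
      (le_add_of_nonneg_left ((neumannForm m G).nonneg _)))

lemma liftForm_bilin_self (f : liftDom hw q) :
    (liftForm hw hle).bilin f f = energy G (f : ell2 m) +
      q.bilin (liftTrace hw q f) (liftTrace hw q f) - ‖harmonicPart (liftNeumann hw q f)‖ ^ 2 := by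
  rw [← real_inner_self_eq_norm_sq]
  rfl

lemma toReal_liftForm_val {f : NeumannSpace m G} (hf : traceOp hw f ∈ q.dom) :
    ((liftForm hw hle).val (toEll2 f)).toReal =
      energy G f + (q.val (traceOp hw f)).toReal - (dnForm m G w (traceOp hw f)).toReal := by
  rw [(liftForm hw hle).toReal_val ⟨toEll2 f, (toEll2_mem_liftDom hw q).2 hf⟩,
    liftForm_bilin_self, toReal_dnForm_traceOp, q.toReal_val ⟨_, hf⟩]
  rfl

lemma liftForm_extends : (liftForm hw hle).Extends (dirichletForm m G) := by
  refine extends_dirichletForm_iff.2 fun f hf => ?_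
  have hmem := toEll2_mem_liftDom_of_mem_dirichletSubspace hw q hf
  rw [← ENNReal.toReal_eq_toReal_iff' ((liftForm hw hle).mem_dom_iff.1 hmem)
      ((neumannForm m G).mem_dom_iff.1 (Form.incl_mem _ f)),
    toReal_liftForm_val hw hle ((toEll2_mem_liftDom hw q).1 hmem), (traceOp_eq_zero_iff hw).2 hf,
    q.val_zero, dnForm_zero hw, ENNReal.toReal_zero, add_zero, sub_zero, toReal_val_toEll2]

lemma neumannForm_val_le_liftForm : (neumannForm m G).val ≤ (liftForm hw hle).val := by
  intro f
  by_cases hf : f ∈ liftDom hw q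
  · rw [(liftForm hw hle).val_of_mem ⟨f, hf⟩, liftForm_bilin_self,
      (neumannForm m G).val_of_mem ⟨f, liftDom_le hw q hf⟩]
    refine ENNReal.ofReal_le_ofReal ?_
    change energy G f ≤ _
    linarith [norm_harmonicPart_sq_le hw hle ⟨f, hf⟩]
  · exact ((liftForm hw hle).val_of_notMem hf).symm ▸ le_top

lemma norm_liftNeumann_le (f : liftDom hw q) :
    ‖liftNeumann hw q f‖ ≤ ‖(liftForm hw hle).toSpace f‖ := by
  refine abs_le_of_sq_le_sq' ?_ (norm_nonneg _) |>.2
  rw [neumann_norm_sq, Form.norm_sq_toSpace, liftForm_bilin_self, toEll2_liftNeumann]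
  linarith [norm_harmonicPart_sq_le hw hle f]

lemma norm_toSpace_liftTrace_le (f : liftDom hw q) :
    ‖q.toSpace (liftTrace hw q f)‖ ≤ √(1 + ‖traceOp hw‖ ^ 2) * ‖(liftForm hw hle).toSpace f‖ := by
  refine abs_le_of_sq_le_sq' ?_ (by positivity) |>.2
  have hbilin : q.bilin (liftTrace hw q f) (liftTrace hw q f) ≤
      ‖(liftForm hw hle).toSpace f‖ ^ 2 := by
    have hharm := pow_le_pow_left₀ (norm_nonneg _) (norm_harmonicPart_le (liftNeumann hw q f)) 2
    rw [neumann_norm_sq (liftNeumann hw q f), toEll2_liftNeumann] at hharm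
    rw [Form.norm_sq_toSpace, liftForm_bilin_self]
    linarith
  have htrace : ‖traceOp hw (liftNeumann hw q f)‖ ≤
      ‖traceOp hw‖ * ‖(liftForm hw hle).toSpace f‖ :=
    (traceOp hw).le_opNorm_of_le (norm_liftNeumann_le hw hle f)
  calc ‖q.toSpace (liftTrace hw q f)‖ ^ 2
      = q.bilin (liftTrace hw q f) (liftTrace hw q f) +
          ‖traceOp hw (liftNeumann hw q f)‖ ^ 2 := q.norm_sq_toSpace _
    _ ≤ ‖(liftForm hw hle).toSpace f‖ ^ 2 +
          (‖traceOp hw‖ * ‖(liftForm hw hle).toSpace f‖) ^ 2 := by gcongr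
    _ = (√(1 + ‖traceOp hw‖ ^ 2) * ‖(liftForm hw hle).toSpace f‖) ^ 2 := by
        rw [mul_pow √_, Real.sq_sqrt (by positivity)]
        ring

omit [Countable X] hle in
lemma isClosed_range_liftNeumann_liftTrace :
    IsClosed (range fun f : liftDom hw q =>
      ((f : ell2 m), liftNeumann hw q f, q.toSpace (liftTrace hw q f))) := by
  have hrange : range (fun f : liftDom hw q =>
      ((f : ell2 m), liftNeumann hw q f, q.toSpace (liftTrace hw q f))) =
        {p | toEll2 p.2.1 = p.1} ∩ {p | traceOp hw p.2.1 = q.incl p.2.2} := by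
    ext ⟨f, u, ψ⟩
    constructor
    · rintro ⟨f, ⟨⟩⟩
      exact ⟨rfl, rfl⟩
    · rintro ⟨rfl : toEll2 u = f, htrace : traceOp hw u = q.incl ψ⟩
      have hmem : toEll2 u ∈ liftDom hw q :=
        (toEll2_mem_liftDom hw q).2 (htrace ▸ q.incl_mem ψ)
      exact ⟨⟨toEll2 u, hmem⟩, Prod.ext rfl (Prod.ext rfl (q.incl_injective htrace))⟩
  rw [hrange]
  exact (isClosed_eq (by fun_prop) (by fun_prop)).inter (isClosed_eq (by fun_prop) (by fun_prop))

lemma liftForm_isClosed (hq : q.IsClosed) : (liftForm hw hle).IsClosed := by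
  have : CompleteSpace q.Space := q.isClosed_iff_completeSpace.1 hq
  refine (liftForm hw hle).isClosed_of_isClosed_graph
    ((liftNeumann hw q).prod (q.toSpace.toLinearMap ∘ₗ liftTrace hw q))
    (K := √(1 + ‖traceOp hw‖ ^ 2)) (K' := 2) (fun f => ?_) (fun f => ?_)
    (isClosed_range_liftNeumann_liftTrace hw)
  · refine max_le ((norm_liftNeumann_le hw hle f).trans ?_) (norm_toSpace_liftTrace_le hw hle f)
    exact le_mul_of_one_le_left (norm_nonneg _)
      (Real.one_le_sqrt.2 (le_add_of_nonneg_right (sq_nonneg _)))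
  · set L := (liftNeumann hw q f, q.toSpace (liftTrace hw q f))
    have hfst : ‖liftNeumann hw q f‖ ^ 2 ≤ ‖L‖ ^ 2 :=
      pow_le_pow_left₀ (norm_nonneg _) (norm_fst_le L) 2
    have hsnd : ‖q.toSpace (liftTrace hw q f)‖ ^ 2 ≤ ‖L‖ ^ 2 :=
      pow_le_pow_left₀ (norm_nonneg _) (norm_snd_le L) 2
    change _ ≤ 2 * ‖L‖ ^ 2
    rw [neumann_norm_sq, toEll2_liftNeumann] at hfst
    rw [Form.norm_sq_toSpace] at hsnd
    rw [liftForm_bilin_self]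
    linarith [sq_nonneg ‖harmonicPart (liftNeumann hw q f)‖, sq_nonneg ‖(f : ell2 m)‖,
      sq_nonneg ‖(liftTrace hw q f : BoundaryL2 m G w)‖]

lemma traceForm_liftForm : traceForm G w (liftForm hw hle) = q.val := by
  rw [← inducedTraceForm_val hw (liftForm_extends hw hle) (liftDom_le hw q)]
  funext φ
  by_cases hφ : φ ∈ q.dom
  · obtain ⟨f, rfl⟩ := exists_traceOp_eq_of_dnForm_ne_top hw
      ((hle φ).trans_lt (q.mem_dom_iff.1 hφ).lt_top).ne
    have hf : toEll2 f ∈ (liftForm hw hle).dom := (toEll2_mem_liftDom hw q).2 hφ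
    have hmem := (traceOp_mem_inducedTraceForm_iff hw (liftForm_extends hw hle)).2 hf
    have hsub := toReal_inducedTraceForm_sub_dnForm hw (liftForm_extends hw hle)
      (neumannForm_val_le_liftForm hw hle) hf
    rw [toReal_liftForm_val hw hle hφ] at hsub
    rw [← ENNReal.toReal_eq_toReal_iff' (Form.mem_dom_iff _ |>.1 hmem) (q.mem_dom_iff.1 hφ)]
    linarith
  · rw [q.val_of_notMem hφ, Form.val_of_notMem]
    intro hmem
    obtain ⟨u, hu, rfl⟩ := exists_traceOp_eq_of_mem_inducedTraceForm hw hmem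
    exact hφ ((toEll2_mem_liftDom hw q).1 (mem_harmonicDom_iff.1 hu).1)

omit hle in
lemma liftForm_isMarkovian (hq : q ∈ traceForms m G w) : (liftForm hw hq.2.1).IsMarkovian := by
  intro C hC h0 f
  by_cases hf : f ∈ (liftForm hw hq.2.1).dom
  · obtain ⟨f, rfl⟩ := exists_toEll2_eq (liftDom_le hw q hf)
    have htrace : traceOp hw f ∈ q.dom := (toEll2_mem_liftDom hw q).1 hf
    obtain ⟨hmem, hsub⟩ := hq.2.2 C hC h0 _ htrace
    rw [← traceOp_neumannComp] at hmem hsub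
    rw [← toEll2_neumannComp, ← ENNReal.toReal_le_toReal
      ((liftForm hw hq.2.1).mem_dom_iff.1 ((toEll2_mem_liftDom hw q).2 hmem))
      ((liftForm hw hq.2.1).mem_dom_iff.1 hf), toReal_liftForm_val hw hq.2.1 hmem,
      toReal_liftForm_val hw hq.2.1 htrace]
    linarith [energy_neumannComp_le hC h0 f]
  · exact ((liftForm hw hq.2.1).val_of_notMem hf).symm ▸ le_top

omit hle in
lemma liftForm_mem_discreteForms (hq : q ∈ traceForms m G w) :
    liftForm hw hq.2.1 ∈ discreteForms m :=
  ⟨⟨(dense_finSupp m).mono (finSupp_le_liftDom hw q), liftForm_isClosed hw hq.2.1 hq.1.1,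
    liftForm_isMarkovian hw hq⟩, finSupp_le_liftDom hw q⟩

end Lift

end Correspondence

section TraceData

variable {X : Type*} [MeasurableSpace X] [DiscreteMeasurableSpace X] {m : X → Ioi (0 : ℝ)}
  {w : WGraph X → X → ℝ≥0} {Q : Form (ell2 m)}
  {σ τ : Σ G : WGraph X, {q : Form (BoundaryL2 m G (w G)) // q ∈ traceForms m G (w G)}}

/-- The pair `σ` is `((b_Q,0), Tr Q)`, that is, its graph `b` satisfies `Q ⊇ Q^(D)_{b,0}` and its
form is the trace of `Q`. -/
def IsTraceData (Q : Form (ell2 m))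
    (σ : Σ G : WGraph X, {q : Form (BoundaryL2 m G (w G)) // q ∈ traceForms m G (w G)}) : Prop :=
  Q.Extends (dirichletForm m σ.1) ∧ σ.2.1.val = traceForm σ.1 (w σ.1) Q

lemma IsTraceData.unique (hd : finSupp m ≤ Q.dom) (hσ : IsTraceData Q σ) (hτ : IsTraceData Q τ) :
    σ = τ := by
  obtain ⟨G, q, hq⟩ := σ
  obtain ⟨G', q', hq'⟩ := τ
  obtain rfl : G = G' := graph_unique hd hσ.1 hτ.1
  obtain rfl : q = q' := Form.val_injective (hσ.2.trans hτ.2.symm)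
  rfl

end TraceData

end GraphForm

end

theorem mainTheorem2 {X : Type*} [Countable X] [MeasurableSpace X] [DiscreteMeasurableSpace X]
    (m : X → Ioi (0 : ℝ)) (w : WGraph X → X → ℝ≥0) (hw : ∀ G, IsAdmissible m G (w G)) :
    (∀ Q ∈ discreteForms m,
      ((∃ G : WGraph X, Q.Extends (dirichletForm m G)) ↔
        ∃ G : WGraph X, ∃ q ∈ traceForms m G (w G), Represents G (w G) q Q) ∧
      (∀ G : WGraph X, Q.Extends (dirichletForm m G) ↔
        ∃ q ∈ traceForms m G (w G), Represents G (w G) q Q) ∧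
      (∀ G G' : WGraph X, Q.Extends (dirichletForm m G) → Q.Extends (dirichletForm m G') →
        G = G') ∧
      ∀ G : WGraph X, Q.Extends (dirichletForm m G) →
        ∃ q ∈ traceForms m G (w G), q.val = traceForm G (w G) Q ∧ Represents G (w G) q Q) ∧
    ∃ Φ : {Q : Form (ell2 m) // Q ∈ discreteForms m ∧ ∃ G, Q.Extends (dirichletForm m G)} →
        Σ G : WGraph X, {q : Form (BoundaryL2 m G (w G)) // q ∈ traceForms m G (w G)},
      Function.Bijective Φ ∧
      ∀ Q, Q.1.Extends (dirichletForm m (Φ Q).1) ∧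
        (Φ Q).2.1.val = traceForm (Φ Q).1 (w (Φ Q).1) Q.1 := by
  refine ⟨fun Q hQ => ?_, ?_⟩
  · have hiff (G : WGraph X) : Q.Extends (dirichletForm m G) ↔
        ∃ q ∈ traceForms m G (w G), Represents G (w G) q Q :=
      ⟨fun h => (exists_traceForm_of_extends (hw G) hQ h).imp fun _ hq => ⟨hq.1, hq.2.2⟩,
        fun ⟨_, _, hr⟩ => extends_of_represents (hw G) hQ.1.2.1 hQ.2 hr⟩
    exact ⟨exists_congr hiff, hiff, fun _ _ h h' => graph_unique hQ.2 h h',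
      fun G h => exists_traceForm_of_extends (hw G) hQ h⟩
  · have hex (Q : {Q : Form (ell2 m) // Q ∈ discreteForms m ∧ ∃ G, Q.Extends (dirichletForm m G)}) :
        ∃ σ, IsTraceData (w := w) Q.1 σ := by
      obtain ⟨Q, hQ, G, h⟩ := Q
      obtain ⟨q, hq, hval, -⟩ := exists_traceForm_of_extends (hw G) hQ h
      exact ⟨⟨G, q, hq⟩, h, hval⟩
    choose Φ hΦ using hex
    refine ⟨Φ, ⟨fun Q Q' heq => ?_, fun ⟨G, q, hq⟩ => ?_⟩, hΦ⟩
    · have h := hΦ Q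
      have h' := hΦ Q'
      rw [← heq] at h'
      exact Subtype.ext
        (eq_of_traceForm_eq (hw _) Q.2.1 Q'.2.1 h.1 h'.1 (h.2.symm.trans h'.2))
    · have hmem := liftForm_mem_discreteForms (hw G) hq
      have hext := liftForm_extends (hw G) hq.2.1
      exact ⟨⟨liftForm (hw G) hq.2.1, hmem, G, hext⟩,
        (hΦ _).unique hmem.2 ⟨hext, (traceForm_liftForm (hw G) hq.2.1).symm⟩⟩
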